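/- Throughout, manifolds and maps are $C^\infty$. A conic manifold is a manifold with a smooth action $(r,v)\mapsto r\cdot v$ of $\mathbb R_+$ which near every point is isomorphic, on an invariant open set, to multiplication by scalars on an open cone in $\mathbb R^N\setminus 0$; a conic symplectic manifold is a conic manifold with a symplectic form $\omega$ that is homogeneous of degree $1$. Its canonical one-form is $\alpha=\omega(\rho,\cdot)$, with $\rho$ the radial vector field generating the dilations. A map $g$ between conic manifolds is conic if it commutes with the dilations. A map $g:V^N\to U^M$, $N<M$, with critical set $\mathcal S_1=\{v:\operatorname{rank}dg(v)<N\}$, is a cross cap if near every $v\in\mathcal S_1$ there are local coordinates on $V$ and $U$ in which $g(x_1,\dots,x_N)=(x_1,\dots,x_{N-1},g_1(x),\dots,g_q(x))$, $q=M-N+1$, where $\partial^2g_i/\partial x_N^2\neq0$ at $v$ for some $i$, and $\chi=(\partial g_1/\partial x_N,\dots,\partial g_q/\partial x_N)$ has $\operatorname{rank}d\chi=q$ at $v$ (so that $\mathcal S_1$ is a submanifold of codimension $q$ on which $g$ is an immersion). **Proposition.** Let $n\ge 3$, let $V$ be a conic manifold of dimension $2n-1$, let $(U,\omega)$ be a conic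 symplectic manifold of dimension $2n$, and let $g:V\to U$ be a smooth conic map that is a cross cap, with critical set $\mathcal S_1$. Assume that for all $v\in\mathcal S_1$: * $dg(T_vV)\subseteq T_{g(v)}U$ is involutive, i.e. contains its $\omega$-annihilator; * $dg(T_v\mathcal S_1)\subseteq T_{g(v)}U$ is maximally noninvolutive, i.e. the restriction of $\omega$ to it has rank $2n-4$; * $dg(T_v\mathcal S_1)$ is nonradial, i.e. $\alpha$ does not vanish identically on it. Let $v_0\in\mathcal S_1$ and $u_0=g(v_0)$. Then there exist local homogeneous coordinates $$(t,\tau)=(t'',t_n,\tau'',\tau''')\in\mathbb R^{n-2}\times\mathbb R\times(\mathbb R^{n-2}\setminus0)\times\mathbb R^2$$ on a conic open neighborhood of $v_0$ in $V$ ($t$ homogeneous of degree $0$, $\tau$ homogeneous of degree $1$), and local canonical coordinates $(x,\xi)\in T^*\mathbb R^n\setminus0$ on a conic open neighborhood of $u_0$ in $U$ ($x$ homogeneous of degree $0$, $\xi$ homogeneous of degree $1$, $\omega=\sum_j d\xi_j\wedge dx_j$), the first neighborhood being mapped into the second by $g$, such that $v_0=(0,0,e_1,0)$, $u_0=(0;e_1)$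 and, writing $\tau'''=(\tau_{n-1},\tau_n)$, $$g(t,\tau)=\bigl(t'',g_{n-1}(t,\tau),t_n;\ \tau'',\gamma_{n-1}(t,\tau),\gamma_n(t,\tau)\bigr),$$ $$\frac{\partial g_{n-1}}{\partial\tau_{n-1}}\neq0\ \text{ everywhere on the coordinate domain},$$ $$\gamma_i\big|_{\tau'''=0}=\frac{\partial\gamma_i}{\partial\tau_j}\Big|_{\tau'''=0}=0,\qquad n-1\le i,j\le n.$$ -/

import Mathlib

open scoped Manifold ContDiff

noncomputable section

/-! ### Conic manifolds -/

/-- A smooth conic manifold: a smooth action `dil r` of the positive reals `r` on `V` which near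
every point is isomorphic, on an invariant open set, to the multiplication by positive scalars on
an open cone in `E ∖ 0` (the image of `χ` is automatically an open cone).
The values `dil r` for `r ≤ 0` play no role. -/
structure ConicStructure (E : Type*) [NormedAddCommGroup E] [NormedSpace ℝ E]
    (V : Type*) [TopologicalSpace V] [ChartedSpace E V] where
  dil : ℝ → V → V
  dil_one : ∀ v, dil 1 v = v
  dil_mul : ∀ r s : ℝ, 0 < r → 0 < s → ∀ v, dil (r * s) v = dil r (dil s v)
  contMDiffOn_dil : ContMDiffOn (𝓘(ℝ, ℝ).prod 𝓘(ℝ, E)) 𝓘(ℝ, E) ∞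
    (fun p : ℝ × V => dil p.1 p.2) (Set.Ioi 0 ×ˢ Set.univ)
  exists_cone : ∀ v, ∃ χ : PartialDiffeomorph 𝓘(ℝ, E) 𝓘(ℝ, E) V E ∞,
    v ∈ χ.source ∧ (0 : E) ∉ χ.target ∧
      ∀ w ∈ χ.source, ∀ r : ℝ, 0 < r → dil r w ∈ χ.source ∧ χ (dil r w) = r • χ w

/-- The radial vector field, generating the dilations: `d/dr (dil r u)` at `r = 1`. -/
def ConicStructure.radial {F : Type*} [NormedAddCommGroup F] [NormedSpace ℝ F]
    {U : Type*} [TopologicalSpace U] [ChartedSpace F U] (K : ConicStructure F U) (u : U) :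
    TangentSpace 𝓘(ℝ, F) u :=
  mfderiv 𝓘(ℝ, ℝ) 𝓘(ℝ, F) (fun r : ℝ => K.dil r u) 1 (1 : ℝ)

/-- A smooth conic map: smooth, and commuting with the dilations. -/
def IsConicMap {E F V U : Type*} [NormedAddCommGroup E] [NormedSpace ℝ E]
    [NormedAddCommGroup F] [NormedSpace ℝ F]
    [TopologicalSpace V] [ChartedSpace E V] [TopologicalSpace U] [ChartedSpace F U]
    (KV : ConicStructure E V) (KU : ConicStructure F U) (g : V → U) : Prop :=
  ContMDiff 𝓘(ℝ, E) 𝓘(ℝ, F) ∞ g ∧ ∀ r : ℝ, 0 < r → ∀ v, g (KV.dil r v) = KU.dil r (g v)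

/-! ### Conic symplectic manifolds -/

/-- The expression in the chart `c` of a field of alternating 2-forms on tangent spaces: the
pullback by the inverse of `c`. -/
def chartForm {F U : Type*} [NormedAddCommGroup F] [NormedSpace ℝ F]
    [TopologicalSpace U] [ChartedSpace F U]
    (σ : ∀ u : U, (TangentSpace 𝓘(ℝ, F) u) [⋀^Fin 2]→L[ℝ] ℝ) (c : OpenPartialHomeomorph U F)
    (y : F) : F [⋀^Fin 2]→L[ℝ] ℝ :=
  (σ (c.symm y)).compContinuousLinearMap (mfderiv 𝓘(ℝ, F) 𝓘(ℝ, F) c.symm y)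

/-- A symplectic form (smooth, closed, nondegenerate 2-form) on a conic manifold which is
homogeneous of degree 1, `(dil r)^* form = r form`. -/
structure ConicSymplecticForm {F U : Type*} [NormedAddCommGroup F] [NormedSpace ℝ F]
    [TopologicalSpace U] [ChartedSpace F U] (K : ConicStructure F U) where
  form : ∀ u : U, (TangentSpace 𝓘(ℝ, F) u) [⋀^Fin 2]→L[ℝ] ℝ
  smooth : ∀ c ∈ atlas F U, ContDiffOn ℝ ∞ (chartForm form c) c.target
  closed : ∀ c ∈ atlas F U, ∀ y ∈ c.target, extDeriv (chartForm form c) y = 0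
  nondegenerate : ∀ (u : U) (a : TangentSpace 𝓘(ℝ, F) u), (∀ b, form u ![a, b] = 0) → a = 0
  homogeneous : ∀ r : ℝ, 0 < r → ∀ (u : U) (a b : TangentSpace 𝓘(ℝ, F) u),
    form (K.dil r u) ![mfderiv 𝓘(ℝ, F) 𝓘(ℝ, F) (K.dil r) u a,
      mfderiv 𝓘(ℝ, F) 𝓘(ℝ, F) (K.dil r) u b] = r * form u ![a, b]

/-! ### Linear symplectic algebra -/

/-- The annihilator `W^σ` of the subspace `W` with respect to the 2-form `σ`. -/
def annihilator2 {T : Type*} [AddCommGroup T] [Module ℝ T] [TopologicalSpace T]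
    (σ : T [⋀^Fin 2]→L[ℝ] ℝ) (W : Submodule ℝ T) : Submodule ℝ T where
  carrier := {a | ∀ b ∈ W, σ ![a, b] = 0}
  zero_mem' := fun b _ => σ.map_coord_zero (0 : Fin 2) rfl
  add_mem' := by
    intro a a' ha ha' b hb
    have h := σ.vecCons_add ![b] a a'
    exact h.trans (by rw [ha b hb, ha' b hb, add_zero])
  smul_mem' := by
    intro c a ha b hb
    have h := σ.vecCons_smul ![b] c a
    exact h.trans (by rw [ha b hb, smul_zero])

/-- `W` is involutive (coisotropic): `W^σ ⊆ W`. -/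
def IsInvolutive {T : Type*} [AddCommGroup T] [Module ℝ T] [TopologicalSpace T]
    (σ : T [⋀^Fin 2]→L[ℝ] ℝ) (W : Submodule ℝ T) : Prop :=
  annihilator2 σ W ≤ W

/-- The rank of the restriction of `σ` to `W`: the dimension of `W` minus that of the radical
`W ∩ W^σ` of the restriction. -/
def rankOn {T : Type*} [AddCommGroup T] [Module ℝ T] [TopologicalSpace T]
    (σ : T [⋀^Fin 2]→L[ℝ] ℝ) (W : Submodule ℝ T) : ℕ :=
  Module.finrank ℝ W - Module.finrank ℝ ↥(W ⊓ annihilator2 σ W)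

/-! ### Critical points and cross caps -/

section Maps

variable {E F V U : Type*} [NormedAddCommGroup E] [NormedSpace ℝ E]
  [NormedAddCommGroup F] [NormedSpace ℝ F]
  [TopologicalSpace V] [ChartedSpace E V] [TopologicalSpace U] [ChartedSpace F U]

variable (E F) in
/-- The set where the rank of `dg` is less than the dimension of the domain. -/
def criticalSet (g : V → U) : Set V :=
  {v | ¬ Function.Injective (mfderiv 𝓘(ℝ, E) 𝓘(ℝ, F) g v)}

variable (E F) in
/-- The cross cap (`S_{1,0}`) condition at a critical point `v`: in suitable adapted local
coordinates `Φ` near `v` and `Ψ` near `g v`, the map is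
`(x₁, …, x_m, x_{m+1}) ↦ (x₁, …, x_m, g₁, …, g_q)`, where `∂²gᵢ/∂x_{m+1}² ≠ 0` at `v` for some `i`,
and `χ = (∂g₁/∂x_{m+1}, …, ∂g_q/∂x_{m+1})` has a differential of rank `q` at `v`. (Necessarily
`m + 1 = dim V` and `m + q = dim U`.) -/
def IsCrossCapAt (g : V → U) (v : V) : Prop :=
  ∃ (m q : ℕ)
    (Φ : PartialDiffeomorph 𝓘(ℝ, E) 𝓘(ℝ, (Fin m → ℝ) × ℝ) V ((Fin m → ℝ) × ℝ) ∞)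
    (Ψ : PartialDiffeomorph 𝓘(ℝ, F) 𝓘(ℝ, (Fin m → ℝ) × (Fin q → ℝ))
      U ((Fin m → ℝ) × (Fin q → ℝ)) ∞)
    (G χ : (Fin m → ℝ) × ℝ → Fin q → ℝ),
    v ∈ Φ.source ∧ (∀ w ∈ Φ.source, g w ∈ Ψ.source ∧ Ψ (g w) = ((Φ w).1, G (Φ w))) ∧
    (∀ p ∈ Φ.target, χ p = fderiv ℝ G p (0, 1)) ∧
    (∃ i, fderiv ℝ (fun p => χ p i) (Φ v) (0, 1) ≠ 0) ∧
    Function.Surjective (fderiv ℝ χ (Φ v))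

variable (E F) in
/-- `g` is a cross cap: all its singularities are cross cap singularities. -/
def IsCrossCap (g : V → U) : Prop := ∀ v ∈ criticalSet E F g, IsCrossCapAt E F g v

variable (E) in
/-- The tangent space `T_v S`: the span of the velocities at `v` of the smooth curves in the ambient
manifold that run inside `S`. If `S` is a submanifold, this is its tangent space at `v`. -/
def tangentAt (S : Set V) (v : V) : Submodule ℝ (TangentSpace 𝓘(ℝ, E) v) :=
  Submodule.span ℝ {a | ∃ c : ℝ → V, ContMDiff 𝓘(ℝ, ℝ) 𝓘(ℝ, E) ∞ c ∧ (∀ s, c s ∈ S) ∧ c 0 = v ∧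
    a = mfderiv 𝓘(ℝ, ℝ) 𝓘(ℝ, E) c 0 (1 : ℝ)}

variable (E F) in
/-- The subspace `dg(T_v V)` of `T_{g v} U`. -/
def imageTangent (g : V → U) (v : V) : Submodule ℝ (TangentSpace 𝓘(ℝ, F) (g v)) :=
  LinearMap.range (mfderiv 𝓘(ℝ, E) 𝓘(ℝ, F) g v).toLinearMap

variable (E F) in
/-- The subspace `dg(T_v S₁)` of `T_{g v} U`, where `S₁` is the critical set of `g`. -/
def imageTangentCritical (g : V → U) (v : V) : Submodule ℝ (TangentSpace 𝓘(ℝ, F) (g v)) :=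
  (tangentAt E (criticalSet E F g) v).map (mfderiv 𝓘(ℝ, E) 𝓘(ℝ, F) g v).toLinearMap

/-- `W ⊆ T_u U` is nonradial: the canonical one-form `σU(radial, ·)` (in canonical coordinates,
`∑ ξ_j dx_j`) does not vanish identically on `W`. -/
def IsNonradialAt {K : ConicStructure F U} (σU : ConicSymplecticForm K) (u : U)
    (W : Submodule ℝ (TangentSpace 𝓘(ℝ, F) u)) : Prop :=
  ∃ b ∈ W, σU.form u ![K.radial u, b] ≠ 0

end Maps

/-! ### Homogeneous and canonical coordinates -/

/-- `T^*ℝⁿ`, with coordinates `(x, ξ)`. -/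
abbrev CotCoord (n : ℕ) : Type := (Fin n → ℝ) × (Fin n → ℝ)

/-- `CotCoord n` as a manifold, with the identity as its chart. -/
instance instCotCoordChartedSpace (n : ℕ) : ChartedSpace (CotCoord n) (CotCoord n) :=
  chartedSpaceSelf (CotCoord n)

/-- The standard symplectic form `∑ dξ_j ∧ dx_j` on `T^*ℝⁿ`. -/
def stdForm (n : ℕ) (a b : CotCoord n) : ℝ := ∑ j, (a.2 j * b.1 j - b.2 j * a.1 j)

/-- `ℝ^{n-2} × ℝ × ℝ^{n-2} × ℝ²`, with coordinates `(t'', t_n, τ'', τ''')`. -/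
abbrev CrossCoord (n : ℕ) : Type := (Fin (n - 2) → ℝ) × ℝ × (Fin (n - 2) → ℝ) × (Fin 2 → ℝ)

/-- `CrossCoord n` as a manifold, with the identity as its chart. -/
instance instCrossCoordChartedSpace (n : ℕ) : ChartedSpace (CrossCoord n) (CrossCoord n) :=
  chartedSpaceSelf (CrossCoord n)

namespace CrossCoord

/-- The coordinates `t''`. -/
def tpp {n : ℕ} (p : CrossCoord n) : Fin (n - 2) → ℝ := p.1

/-- The coordinate `t_n`. -/
def tn {n : ℕ} (p : CrossCoord n) : ℝ := p.2.1

/-- The coordinates `τ''`. -/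
def taupp {n : ℕ} (p : CrossCoord n) : Fin (n - 2) → ℝ := p.2.2.1

/-- The coordinates `τ''' = (τ_{n-1}, τ_n)`. -/
def tauppp {n : ℕ} (p : CrossCoord n) : Fin 2 → ℝ := p.2.2.2

/-- The coordinate direction of `τ_{n-1}` (for `j = 0`) or `τ_n` (for `j = 1`). -/
def tauDir (n : ℕ) (j : Fin 2) : CrossCoord n := (0, 0, 0, Pi.single j 1)

/-- The partial derivative `∂f/∂τ_{n-1}` (for `j = 0`) or `∂f/∂τ_n` (for `j = 1`). -/
def dtau {n : ℕ} (j : Fin 2) (f : CrossCoord n → ℝ) (p : CrossCoord n) : ℝ :=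
  fderiv ℝ f p (tauDir n j)

end CrossCoord

/-- The first unit vector `e₁`. -/
def unitOne (k : ℕ) : Fin k → ℝ := fun j => if (j : ℕ) = 0 then 1 else 0

/-- The first `n - 2` of the indices `1, …, n` (which `Fin n` counts from `0`). -/
def idxHead {n : ℕ} (j : Fin (n - 2)) : Fin n := ⟨j, by omega⟩

/-- The index `n - 1` of `1, …, n`. -/
def idxPen {n : ℕ} (hn : 3 ≤ n) : Fin n := ⟨n - 2, by omega⟩

/-- The index `n` of `1, …, n`. -/
def idxLast {n : ℕ} (hn : 3 ≤ n) : Fin n := ⟨n - 1, by omega⟩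

/-- `Φ` is a system of local homogeneous coordinates `(t'', t_n, τ'', τ''')` with `τ'' ≠ 0`: its
domain is conic, `t` is homogeneous of degree 0 and `τ` is homogeneous of degree 1. -/
def IsHomogeneousCoord {E V : Type*} [NormedAddCommGroup E] [NormedSpace ℝ E]
    [TopologicalSpace V] [ChartedSpace E V] (K : ConicStructure E V) {n : ℕ}
    (Φ : PartialDiffeomorph 𝓘(ℝ, E) 𝓘(ℝ, CrossCoord n) V (CrossCoord n) ∞) : Prop :=
  ∀ v ∈ Φ.source, CrossCoord.taupp (Φ v) ≠ 0 ∧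
    ∀ r : ℝ, 0 < r → K.dil r v ∈ Φ.source ∧
      Φ (K.dil r v) = (CrossCoord.tpp (Φ v), CrossCoord.tn (Φ v),
        r • CrossCoord.taupp (Φ v), r • CrossCoord.tauppp (Φ v))

/-- `Ψ` is a system of local (homogeneous) canonical coordinates `(x, ξ) ∈ T^*ℝⁿ ∖ 0`: its domain
is conic, `x` is homogeneous of degree 0, `ξ ≠ 0` is homogeneous of degree 1, and
the symplectic form is `∑ dξ_j ∧ dx_j`. -/
def IsCanonicalCoord {F U : Type*} [NormedAddCommGroup F] [NormedSpace ℝ F]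
    [TopologicalSpace U] [ChartedSpace F U] {K : ConicStructure F U} (σU : ConicSymplecticForm K)
    {n : ℕ} (Ψ : PartialDiffeomorph 𝓘(ℝ, F) 𝓘(ℝ, CotCoord n) U (CotCoord n) ∞) : Prop :=
  ∀ u ∈ Ψ.source, (Ψ u).2 ≠ 0 ∧
    (∀ r : ℝ, 0 < r → K.dil r u ∈ Ψ.source ∧ Ψ (K.dil r u) = ((Ψ u).1, r • (Ψ u).2)) ∧
    ∀ a b : TangentSpace 𝓘(ℝ, F) u,
      σU.form u ![a, b] = stdForm n (mfderiv 𝓘(ℝ, F) 𝓘(ℝ, CotCoord n) Ψ u a)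
        (mfderiv 𝓘(ℝ, F) 𝓘(ℝ, CotCoord n) Ψ u b)

end

open scoped Topology
open Filter Set

-- Cone charts turn the two manifolds into open cones in E and F, the dilations into scalar
-- multiplication, and the map into a germ `g` homogeneous of degree one. In such a chart the
-- contraction θ of the symplectic form with the Euler field y ↦ y is a primitive of the form
-- (`LiouvilleGerm.of_form`), so the symplectic geometry is that of germs of one-forms θ with dθ
-- nondegenerate and dθ(y, ·) = θ (`LiouvilleGerm`).
--
-- Let χ, with values in ℝ², cut out the critical set S (`CriticalGerm`). One dimension count starts
-- everything. The image W of dg at the base point has dimension at most 2n - 2, so its annihilator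
-- has dimension at least 2; dg(TS) has dimension at most 2n - 3 and carries a form of rank 2n - 4,
-- so it cannot contain that annihilator (`exists_annihilator_not_mem`). Hence some X₀ annihilates W
-- and is not in dg(TS), and involutivity puts X₀ in W.
--
-- The cross cap normal form extends the conormal covector -dθ(X₀, ·) to a function p, which can be
-- made homogeneous of degree one, whose pullback by g vanishes to second order on S. This p is
-- ξ_{n-1}. Its field X, defined by dθ(X, ·) = -dp, lies in the image of dg along S, again by
-- involutivity. Symplectic reduction by p (`LiouvilleGerm.exists_reduced_germ`) yields a quotient
-- of dimension 2n - 2 into which S immerses, because X₀ is not in dg(TS). The image is a conic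
-- hypersurface; its homogeneous defining function p₂, pulled back, is ξ_n. It vanishes on g(S), is
-- constant along X, and the image of dg along S is spanned by dg(TS) and X, so its pullback by g
-- also vanishes to second order on S. A second reduction and the homogeneous Darboux theorem supply
-- the remaining n - 2 pairs. Nonradiality is what keeps dp and dp₂ from being multiples of the
-- canonical one-form, as the reductions require (`CriticalGerm.exists_adapted_darboux`).
--
-- On the source the coordinates are x'', x_n, ξ'' composed with g, together with a homogeneous
-- version of χ. They are independent because a vector killed by all of them is tangent to S and is
-- mapped by dg to a multiple of ∂/∂x_{n-1} = X₀. Since X₀ is itself in the image of dg, the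
-- function x_{n-1} ∘ g has nonzero derivative along one of the two τ''' directions, which is named
-- τ_{n-1} (`CriticalGerm.exists_cross_coordinates`).
--
-- All of this takes place near one point. Euler relations integrate to homogeneity, and a local
-- diffeomorphism satisfying them extends to an invariant open cone (`exists_homogeneous_diffeo`);
-- the conclusions are then carried along rays. The reduction and Darboux steps rest on a flow box
-- theorem, whose smooth flow comes from the inverse function theorem in a space of curves.

universe u v

/-! ### Smooth germs and the local inverse theorem -/

section Germs

variable {E F G H : Type*} [NormedAddCommGroup E] [NormedSpace ℝ E]
  [NormedAddCommGroup F] [NormedSpace ℝ F] [NormedAddCommGroup G] [NormedSpace ℝ G]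
  [NormedAddCommGroup H] [NormedSpace ℝ H]

/-- `f` is smooth on a neighbourhood of `x`. -/
def EvSmooth (f : E → F) (x : E) : Prop := ∀ᶠ y in 𝓝 x, ContDiffAt ℝ ∞ f y

namespace EvSmooth

variable {f g : E → F} {x : E}

theorem contDiffAt (h : EvSmooth f x) : ContDiffAt ℝ ∞ f x := h.self_of_nhds

theorem differentiableAt (h : EvSmooth f x) : DifferentiableAt ℝ f x :=
  h.contDiffAt.differentiableAt (by simp)

theorem continuousAt (h : EvSmooth f x) : ContinuousAt f x := h.contDiffAt.continuousAt

theorem eventually (h : EvSmooth f x) : ∀ᶠ y in 𝓝 x, EvSmooth f y := eventually_eventually_nhds.2 h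

theorem eventually_differentiableAt (h : EvSmooth f x) : ∀ᶠ y in 𝓝 x, DifferentiableAt ℝ f y :=
  h.eventually.mono fun _ hy => hy.differentiableAt

theorem of_contDiff (h : ContDiff ℝ ∞ f) : EvSmooth f x :=
  Eventually.of_forall fun _ => h.contDiffAt

theorem of_contDiffOn {s : Set E} (h : ContDiffOn ℝ ∞ f s) (hs : IsOpen s) (hx : x ∈ s) :
    EvSmooth f x :=
  (hs.mem_nhds hx : s ∈ 𝓝 x) |> fun h' => Filter.mem_of_superset h' fun _ hy =>
    h.contDiffAt (hs.mem_nhds hy)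

theorem const (c : F) : EvSmooth (fun _ : E => c) x := of_contDiff contDiff_const

theorem id' : EvSmooth (fun y : E => y) x := of_contDiff contDiff_id

theorem clm (L : E →L[ℝ] F) : EvSmooth (fun y => L y) x := of_contDiff L.contDiff

theorem congr (h : EvSmooth f x) (hfg : g =ᶠ[𝓝 x] f) : EvSmooth g x := by
  filter_upwards [h, eventually_eventually_nhds.2 hfg] with y hy hy'
  exact hy.congr_of_eventuallyEq hy'

theorem comp {f : F → G} {g : E → F} {x : E} (hf : EvSmooth f (g x)) (hg : EvSmooth g x) :
    EvSmooth (fun y => f (g y)) x := by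
  filter_upwards [hg, hg.continuousAt.eventually hf] with y hy hy'
  exact hy'.comp y hy

theorem prodMk {f : E → F} {g : E → G} (hf : EvSmooth f x) (hg : EvSmooth g x) :
    EvSmooth (fun y => (f y, g y)) x := by
  filter_upwards [hf, hg] with y hy hy'
  exact hy.prodMk hy'

theorem add (hf : EvSmooth f x) (hg : EvSmooth g x) : EvSmooth (fun y => f y + g y) x := by
  filter_upwards [hf, hg] with y hy hy'
  exact hy.add hy'

theorem sub (hf : EvSmooth f x) (hg : EvSmooth g x) : EvSmooth (fun y => f y - g y) x := by
  filter_upwards [hf, hg] with y hy hy'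
  exact hy.sub hy'

theorem neg (hf : EvSmooth f x) : EvSmooth (fun y => - f y) x := by
  filter_upwards [hf] with y hy
  exact hy.neg

theorem smul {c : E → ℝ} (hc : EvSmooth c x) (hf : EvSmooth f x) :
    EvSmooth (fun y => c y • f y) x := by
  filter_upwards [hf, hc] with y hy hy'
  exact hy'.smul hy

theorem mul {c d : E → ℝ} (hc : EvSmooth c x) (hd : EvSmooth d x) :
    EvSmooth (fun y => c y * d y) x := hc.smul hd

theorem inv {c : E → ℝ} (hc : EvSmooth c x) (h0 : c x ≠ 0) : EvSmooth (fun y => (c y)⁻¹) x := by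
  filter_upwards [hc, hc.continuousAt.eventually_ne h0] with y hy hy'
  exact hy.inv hy'

theorem fst {f : E → F × G} (hf : EvSmooth f x) : EvSmooth (fun y => (f y).1) x := by
  filter_upwards [hf] with y hy
  exact hy.fst

theorem snd {f : E → F × G} (hf : EvSmooth f x) : EvSmooth (fun y => (f y).2) x := by
  filter_upwards [hf] with y hy
  exact hy.snd

theorem clm_apply {f : E → F →L[ℝ] G} {g : E → F} (hf : EvSmooth f x) (hg : EvSmooth g x) :
    EvSmooth (fun y => f y (g y)) x := by
  filter_upwards [hf, hg] with y hy hy'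
  exact hy.clm_apply hy'

theorem clm_comp {f : E → G →L[ℝ] H} {g : E → F →L[ℝ] G} (hf : EvSmooth f x) (hg : EvSmooth g x) :
    EvSmooth (fun y => (f y).comp (g y)) x := by
  filter_upwards [hf, hg] with y hy hy'
  exact hy.clm_comp hy'

theorem fderiv (hf : EvSmooth f x) : EvSmooth (fderiv ℝ f) x := by
  filter_upwards [hf] with y hy
  exact hy.fderiv_right (by simp)

theorem pi {ι : Type*} [Fintype ι] {f : E → ι → F} (hf : ∀ i, EvSmooth (fun y => f y i) x) :
    EvSmooth f x := by
  filter_upwards [eventually_all.2 hf] with y hy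
  exact contDiffAt_pi.2 hy

theorem apply {ι : Type*} [Fintype ι] {f : E → ι → F} (hf : EvSmooth f x) (i : ι) :
    EvSmooth (fun y => f y i) x := by
  filter_upwards [hf] with y hy
  exact contDiffAt_pi.1 hy i

end EvSmooth

/-- A map which is smooth near `x` with an invertible differential at `x` has a local inverse,
smooth near the image of `x`. -/
theorem EvSmooth.exists_local_inverse [CompleteSpace E] {f : E → F} {x : E} (hf : EvSmooth f x)
    (f' : E ≃L[ℝ] F) (hf' : HasFDerivAt f (f' : E →L[ℝ] F) x) :
    ∃ g : F → E, EvSmooth g (f x) ∧ g (f x) = x ∧ (∀ᶠ y in 𝓝 x, g (f y) = y) ∧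
      ∀ᶠ z in 𝓝 (f x), f (g z) = z := by
  have hs : HasStrictFDerivAt f (f' : E →L[ℝ] F) x := by
    have := hf.contDiffAt.hasStrictFDerivAt' hf' (by simp)
    exact this
  set e := hs.toOpenPartialHomeomorph f with he
  have hx : x ∈ e.source := hs.mem_toOpenPartialHomeomorph_source
  have hfx : f x ∈ e.target := hs.image_mem_toOpenPartialHomeomorph_target
  have hcoe : (e : E → F) = f := hs.toOpenPartialHomeomorph_coe
  have hex : e.symm (f x) = x := by
    have := e.left_inv hx
    rwa [hcoe] at this
  refine ⟨e.symm, ?_, hex, ?_, ?_⟩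
  · have hcont : ContinuousAt e.symm (f x) := e.continuousAt_symm hfx
    -- Invertible operators form an open set, so the inverse is smooth at every point near `f x`,
    -- not only at `f x`.
    have hinv : ∀ᶠ y in 𝓝 x, _root_.fderiv ℝ f y ∈ range ((↑) : (E ≃L[ℝ] F) → E →L[ℝ] F) := by
      have h1 : ContinuousAt (_root_.fderiv ℝ f) x := hf.fderiv.continuousAt
      have h2 : range ((↑) : (E ≃L[ℝ] F) → E →L[ℝ] F) ∈ 𝓝 (_root_.fderiv ℝ f x) := by
        rw [hf'.fderiv]; exact f'.nhds
      exact h1 h2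
    have hc : Tendsto e.symm (𝓝 (f x)) (𝓝 x) := by
      rw [← hex] at hcont ⊢
      simpa [ContinuousAt, hex] using hcont
    filter_upwards [e.open_target.mem_nhds hfx, hc.eventually hf, hc.eventually hinv] with z hz h1 h2
    obtain ⟨L, hL⟩ := h2
    refine e.contDiffAt_symm (f₀' := L) hz ?_ ?_
    · rw [hcoe, hL]; exact (h1.differentiableAt (by simp)).hasFDerivAt
    · rw [hcoe]; exact h1
  · filter_upwards [e.open_source.mem_nhds hx] with y hy
    have := e.left_inv hy
    rwa [hcoe] at this
  · filter_upwards [e.open_target.mem_nhds hfx] with y hy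
    have := e.right_inv hy
    rwa [hcoe] at this

end Germs


/-! ### Smoothness of superposition operators on spaces of continuous maps -/

section Nemytskii

variable {F G : Type*} [NormedAddCommGroup F] [NormedSpace ℝ F]
  [NormedAddCommGroup G] [NormedSpace ℝ G] {K : Type*} [TopologicalSpace K] [CompactSpace K]

/-- The superposition operator `γ ↦ X ∘ γ` on continuous maps. -/
def superpose (K : Type*) [TopologicalSpace K] (X : F → G) (hX : Continuous X) (γ : C(K, F)) :
    C(K, G) := ⟨fun t => X (γ t), hX.comp γ.continuous⟩

/-- Pointwise application of a family of linear maps, as a bounded bilinear map. -/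
noncomputable def pointwiseApply (K : Type*) [TopologicalSpace K] [CompactSpace K] (F G : Type*)
    [NormedAddCommGroup F] [NormedSpace ℝ F] [NormedAddCommGroup G] [NormedSpace ℝ G] :
    C(K, F →L[ℝ] G) →L[ℝ] C(K, F) →L[ℝ] C(K, G) :=
  LinearMap.mkContinuous₂
    (LinearMap.mk₂ ℝ (fun (A : C(K, F →L[ℝ] G)) (η : C(K, F)) =>
        (⟨fun t => A t (η t), A.continuous.clm_apply η.continuous⟩ : C(K, G)))
      (fun _ _ _ => by ext; simp) (fun _ _ _ => by ext; simp)
      (fun _ _ _ => by ext; simp) (fun _ _ _ => by ext; simp)) 1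
    (fun A η => by
      rw [one_mul]
      refine (ContinuousMap.norm_le _ (by positivity)).2 fun t => ?_
      exact ((A t).le_opNorm _).trans (mul_le_mul (A.norm_coe_le_norm t) (η.norm_coe_le_norm t)
        (norm_nonneg _) (norm_nonneg A)))

omit [NormedSpace ℝ F] [NormedSpace ℝ G] [CompactSpace K] in
theorem continuous_superpose (X : F → G) (hX : Continuous X) :
    Continuous (superpose K X hX) :=
  ContinuousMap.continuous_postcomp (⟨X, hX⟩ : C(F, G))

/-- Composition with `fderiv ℝ X` is continuous into the space of continuous maps, so on a small
ball it controls `fderiv ℝ X` along all the segments from `γ t` to `γ t + η t` at once. The mean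
value inequality for each `t` then gives an error uniform in `t`. -/
theorem hasFDerivAt_superpose {X : F → G} (hX : ContDiff ℝ 1 X) (γ : C(K, F)) :
    HasFDerivAt (superpose K X hX.continuous)
      (pointwiseApply K F G (superpose K (fderiv ℝ X) (hX.continuous_fderiv (by simp)) γ)) γ := by
  rw [hasFDerivAt_iff_isLittleO_nhds_zero, Asymptotics.isLittleO_iff]
  intro ε hε
  have hc := (continuous_superpose (K := K) (fderiv ℝ X) (hX.continuous_fderiv (by simp))).tendsto γ
  have h1 : ∀ᶠ η : C(K, F) in 𝓝 γ, dist (superpose K (fderiv ℝ X) (hX.continuous_fderiv (by simp)) η)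
      (superpose K (fderiv ℝ X) (hX.continuous_fderiv (by simp)) γ) < ε :=
    hc (Metric.ball_mem_nhds _ hε)
  obtain ⟨δ, hδ, hδε⟩ := Metric.eventually_nhds_iff_ball.1 h1
  filter_upwards [Metric.ball_mem_nhds (0 : C(K, F)) hδ] with η hη
  refine (ContinuousMap.norm_le _ (by positivity)).2 fun t => ?_
  have hseg : ∀ z ∈ segment ℝ (γ t) (γ t + η t),
      ‖fderiv ℝ X z - fderiv ℝ X (γ t)‖ ≤ ε := by
    intro z hz
    obtain ⟨s, ⟨hs0, hs1⟩, rfl⟩ := (segment_eq_image' ℝ (γ t) (γ t + η t)) ▸ hz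
    have hmem : γ + s • η ∈ Metric.ball γ δ := by
      rw [Metric.mem_ball, dist_eq_norm, add_sub_cancel_left, norm_smul, Real.norm_eq_abs,
        abs_of_nonneg hs0]
      have : ‖η‖ < δ := by simpa using hη
      nlinarith [norm_nonneg η]
    have := (hδε _ hmem).le
    have h3 := (ContinuousMap.dist_apply_le_dist t).trans this
    rw [dist_eq_norm] at h3
    simpa [superpose] using h3
  have := (convex_segment (γ t) (γ t + η t)).norm_image_sub_le_of_norm_hasFDerivWithin_le'
    (f := X) (f' := fderiv ℝ X) (φ := fderiv ℝ X (γ t)) (C := ε)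
    (fun z _ => ((hX.differentiable (by simp)) z).hasFDerivAt.hasFDerivWithinAt) hseg
    (left_mem_segment ℝ _ _) (right_mem_segment ℝ _ _)
  rw [add_sub_cancel_left] at this
  calc _ = ‖X (γ t + η t) - X (γ t) - fderiv ℝ X (γ t) (η t)‖ := rfl
    _ ≤ ε * ‖η t‖ := this
    _ ≤ ε * ‖η‖ := by gcongr; exact η.norm_coe_le_norm t

/-- The derivative is superposition by `fderiv ℝ X` followed by a bounded bilinear operation, so
smoothness follows by induction on the order with the target varying. `F` and `G` share a universe
so that the induction hypothesis applies to `F →L[ℝ] G`. -/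
theorem contDiff_superpose {F G : Type u} [NormedAddCommGroup F] [NormedSpace ℝ F]
    [NormedAddCommGroup G] [NormedSpace ℝ G] {X : F → G} (hX : ContDiff ℝ ∞ X) :
    ContDiff ℝ ∞ (superpose K X hX.continuous) := by
  rw [contDiff_infty]
  intro n
  induction n generalizing G with
  | zero => exact contDiff_zero.2 (continuous_superpose X hX.continuous)
  | succ n ih =>
    rw [Nat.cast_add, Nat.cast_one]
    refine contDiff_succ_iff_hasFDerivAt.2 ⟨_, ?_, hasFDerivAt_superpose (hX.of_le (by simp))⟩
    exact (pointwiseApply K F G).contDiff.comp (ih ((contDiff_infty_iff_fderiv.1 hX).2))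

end Nemytskii

/-! ### Smooth local flows -/

section Flow

variable {F : Type*} [NormedAddCommGroup F] [NormedSpace ℝ F]

/-- Multiplication by a bump function. The integral operator on curves needs a vector field that is
smooth everywhere. -/
theorem EvSmooth.exists_contDiff_eventuallyEq {G : Type*} [NormedAddCommGroup G] [NormedSpace ℝ G]
    [FiniteDimensional ℝ F] {X : F → G} {x₀ : F} (hX : EvSmooth X x₀) :
    ∃ Y : F → G, ContDiff ℝ ∞ Y ∧ Y =ᶠ[𝓝 x₀] X := by
  obtain ⟨r, hr, hr'⟩ := Metric.eventually_nhds_iff_ball.1 hX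
  let f : ContDiffBump x₀ := ⟨r / 4, r / 2, by positivity, by linarith⟩
  refine ⟨fun x => f x • X x, ?_, ?_⟩
  · rw [contDiff_iff_contDiffAt]
    intro x
    by_cases hx : x ∈ Metric.ball x₀ r
    · exact f.contDiff.contDiffAt.smul (hr' x hx)
    · have hx' : x ∉ tsupport f := by
        rw [f.tsupport_eq]
        intro h
        exact hx (Metric.closedBall_subset_ball (by change r / 2 < r; linarith) h)
      have : (fun x => f x • X x) =ᶠ[𝓝 x] fun _ => 0 := by
        filter_upwards [(isClosed_tsupport f).isOpen_compl.mem_nhds hx'] with y hy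
        rw [image_eq_zero_of_notMem_tsupport hy, zero_smul]
      exact contDiffAt_const.congr_of_eventuallyEq this
  · filter_upwards [f.eventuallyEq_one] with y hy
    rw [hy]; simp

/-- The operator `γ ↦ (t ↦ ∫₀ᵗ γ)` on continuous curves on `[-1, 1]`. -/
noncomputable def integralOp (F : Type*) [NormedAddCommGroup F] [NormedSpace ℝ F] :
    C(Icc (-1 : ℝ) 1, F) →L[ℝ] C(Icc (-1 : ℝ) 1, F) :=
  LinearMap.mkContinuous
    { toFun := fun γ => ⟨fun t => ∫ s in (0 : ℝ)..t, IccExtend (by norm_num) γ s, by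
        have hc : Continuous (IccExtend (show (-1 : ℝ) ≤ 1 by norm_num) γ) :=
          γ.continuous.Icc_extend'
        exact (intervalIntegral.continuous_primitive (fun a b => hc.intervalIntegrable a b) 0).comp
          continuous_subtype_val⟩
      map_add' := fun γ η => by
        ext t
        have hc : Continuous (IccExtend (show (-1 : ℝ) ≤ 1 by norm_num) γ) :=
          γ.continuous.Icc_extend'
        have hd : Continuous (IccExtend (show (-1 : ℝ) ≤ 1 by norm_num) η) :=
          η.continuous.Icc_extend'
        exact intervalIntegral.integral_add (hc.intervalIntegrable _ _) (hd.intervalIntegrable _ _)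
      map_smul' := fun c γ => by
        ext t
        exact intervalIntegral.integral_smul c _ } 1
    (fun γ => by
      rw [one_mul]
      refine (ContinuousMap.norm_le _ (norm_nonneg γ)).2 fun t => ?_
      refine (intervalIntegral.norm_integral_le_of_norm_le_const (C := ‖γ‖) ?_).trans ?_
      · intro s _
        exact γ.norm_coe_le_norm _
      · have h1 : |(t : ℝ) - 0| ≤ 1 := by rw [sub_zero, abs_le]; exact t.2
        nlinarith [norm_nonneg γ])

theorem integralOp_apply (γ : C(Icc (-1 : ℝ) 1, F)) (t : Icc (-1 : ℝ) 1) :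
    integralOp F γ t = ∫ s in (0 : ℝ)..t, IccExtend (by norm_num) γ s := rfl

/-- The fixed points of `γ ↦ x + s ∫₀ᵗ X(γ)`, for `γ` near a constant curve and `s` small,
depend smoothly on `x` and `s`. -/
theorem exists_smooth_fixed_curves [CompleteSpace F] {X : F → F} (hX : ContDiff ℝ ∞ X) (x₀ : F) :
    ∃ Γ : F × ℝ → C(Icc (-1 : ℝ) 1, F), EvSmooth Γ (x₀, 0) ∧
      Γ (x₀, 0) = ContinuousMap.const _ x₀ ∧
      (∀ᶠ p in 𝓝 (x₀, (0 : ℝ)), Γ p = ContinuousMap.const _ p.1 +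
        p.2 • integralOp F (superpose _ X hX.continuous (Γ p))) ∧
      ∀ᶠ q in 𝓝 ((x₀, (0 : ℝ)), ContinuousMap.const (Icc (-1 : ℝ) 1) x₀),
        q.2 = ContinuousMap.const _ q.1.1 +
          q.1.2 • integralOp F (superpose _ X hX.continuous q.2) → Γ q.1 = q.2 := by
  let cst : F →L[ℝ] C(Icc (-1 : ℝ) 1, F) := ContinuousLinearMap.const ℝ (Icc (-1 : ℝ) 1)
  let C₀ := ContinuousMap.const (Icc (-1 : ℝ) 1) x₀
  let N : C(Icc (-1 : ℝ) 1, F) → C(Icc (-1 : ℝ) 1, F) :=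
    fun γ => integralOp F (superpose _ X hX.continuous γ)
  have hN : ContDiff ℝ ∞ N := (integralOp F).contDiff.comp (contDiff_superpose hX)
  -- The fixed point equation says that the last component of `Θ` vanishes. At `s = 0` the
  -- differential is triangular with identity diagonal blocks, so `Θ` has a local inverse; evaluated
  -- at `(x, s, 0)` it gives the curve, and its injectivity gives uniqueness.
  let Θ : (F × ℝ) × C(Icc (-1 : ℝ) 1, F) → (F × ℝ) × C(Icc (-1 : ℝ) 1, F) :=
    fun q => (q.1, q.2 - cst q.1.1 - q.1.2 • N q.2)
  have hΘ : ContDiff ℝ ∞ Θ := by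
    refine contDiff_fst.prodMk
      ((contDiff_snd.sub (cst.contDiff.comp (contDiff_fst.comp contDiff_fst))).sub ?_)
    exact (contDiff_snd.comp contDiff_fst).smul (hN.comp contDiff_snd)
  let B : (F × ℝ) →L[ℝ] C(Icc (-1 : ℝ) 1, F) :=
    -(cst.comp (ContinuousLinearMap.fst ℝ F ℝ)) -
      (ContinuousLinearMap.snd ℝ F ℝ).smulRight (N C₀)
  let A := ContinuousLinearEquiv.skewProd (ContinuousLinearEquiv.refl ℝ (F × ℝ))
    (ContinuousLinearEquiv.refl ℝ C(Icc (-1 : ℝ) 1, F)) B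
  have hΘ' : HasFDerivAt Θ (A : (F × ℝ) × C(Icc (-1 : ℝ) 1, F) →L[ℝ] _) ((x₀, 0), C₀) := by
    have hN' : HasFDerivAt (fun q : (F × ℝ) × C(Icc (-1 : ℝ) 1, F) => N q.2)
        ((fderiv ℝ N C₀).comp (ContinuousLinearMap.snd ℝ _ _)) ((x₀, 0), C₀) :=
      HasFDerivAt.comp (g := N) (f := Prod.snd) _
        (hN.differentiable (by simp) C₀).hasFDerivAt hasFDerivAt_snd
    have e1 : HasFDerivAt (fun q : (F × ℝ) × C(Icc (-1 : ℝ) 1, F) => q.1.2 • N q.2) _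
        ((x₀, 0), C₀) :=
      ((hasFDerivAt_snd (p := (x₀, (0 : ℝ)))).comp (((x₀, 0), C₀) : (F × ℝ) × C(Icc (-1 : ℝ) 1, F))
        hasFDerivAt_fst).fun_smul hN'
    have e2 : HasFDerivAt (fun q : (F × ℝ) × C(Icc (-1 : ℝ) 1, F) => cst q.1.1) _
        ((x₀, 0), C₀) :=
      cst.hasFDerivAt.comp (((x₀, 0), C₀) : (F × ℝ) × C(Icc (-1 : ℝ) 1, F))
        ((hasFDerivAt_fst (p := (x₀, (0 : ℝ)))).comp
          (((x₀, 0), C₀) : (F × ℝ) × C(Icc (-1 : ℝ) 1, F)) hasFDerivAt_fst)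
    have e3 := HasFDerivAt.prodMk (hasFDerivAt_fst (𝕜 := ℝ)
      (p := (((x₀, 0), C₀) : (F × ℝ) × C(Icc (-1 : ℝ) 1, F))))
      ((hasFDerivAt_snd.fun_sub e2).fun_sub e1)
    refine e3.congr_fderiv ?_
    ext q <;> simp [A, B, cst]
  obtain ⟨g, hg, hgx, hgl, hgr⟩ := (EvSmooth.of_contDiff hΘ).exists_local_inverse A hΘ'
  have hbase : Θ ((x₀, 0), C₀) = ((x₀, 0), 0) := by
    simp only [Θ, zero_smul, sub_zero]
    congr 1
    ext; simp [C₀, cst]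
  rw [hbase] at hg hgx hgr
  have hcomp : EvSmooth (fun p : F × ℝ => g (p, 0)) (x₀, 0) :=
    EvSmooth.comp (f := g) (g := fun p : F × ℝ => (p, 0)) hg (EvSmooth.id'.prodMk (EvSmooth.const _))
  refine ⟨fun p => (g (p, 0)).2, hcomp.snd, by change (g ((x₀, 0), 0)).2 = _; rw [hgx], ?_, ?_⟩
  · have ht : Tendsto (fun p : F × ℝ => (p, (0 : C(Icc (-1 : ℝ) 1, F)))) (𝓝 (x₀, 0))
        (𝓝 ((x₀, 0), 0)) := by
      exact (Continuous.prodMk continuous_id continuous_const).tendsto' _ _ rfl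
    filter_upwards [ht.eventually hgr] with p hp
    have h1 : (g (p, 0)).1 = p := congrArg Prod.fst hp
    have h2 : (g (p, 0)).2 - cst (g (p, 0)).1.1 - (g (p, 0)).1.2 • N (g (p, 0)).2 = 0 :=
      congrArg Prod.snd hp
    rw [h1, sub_sub, sub_eq_zero] at h2
    exact h2
  · filter_upwards [hgl] with q hq hq2
    have : Θ q = (q.1, 0) := by
      simp only [Θ]
      congr 1
      rw [sub_sub, sub_eq_zero]
      exact hq2
    rw [← this, hq]

/-- Smooth dependence of the local flow of a smooth vector field on time and initial value. -/
theorem exists_smooth_flow [FiniteDimensional ℝ F] {X : F → F} {x₀ : F} (hX : EvSmooth X x₀) :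
    ∃ Fl : ℝ × F → F, EvSmooth Fl (0, x₀) ∧ (∀ᶠ x in 𝓝 x₀, Fl (0, x) = x) ∧
      ∀ᶠ p in 𝓝 ((0 : ℝ), x₀), HasDerivAt (fun s => Fl (s, p.2)) (X (Fl p)) p.1 := by
  have := FiniteDimensional.complete ℝ F
  obtain ⟨Y, hY, hYX⟩ := hX.exists_contDiff_eventuallyEq
  obtain ⟨Γ, hΓ, hΓ0, hΓeq, hΓuniq⟩ := exists_smooth_fixed_curves hY x₀
  let one : Icc (-1 : ℝ) 1 := ⟨1, by norm_num, le_rfl⟩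
  let ev : C(Icc (-1 : ℝ) 1, F) →L[ℝ] F := ContinuousMap.evalCLM ℝ one
  -- `Γ (x, s)` is the integral curve from `x` with time rescaled by `s`; its value at parameter 1
  -- is therefore the flow at time `s`.
  let Fl : ℝ × F → F := fun p => Γ (p.2, p.1) one
  have hswap : EvSmooth (fun p : ℝ × F => (p.2, p.1)) (0, x₀) :=
    EvSmooth.of_contDiff (contDiff_snd.prodMk contDiff_fst)
  have hFl : EvSmooth Fl (0, x₀) :=
    EvSmooth.comp (f := fun γ => ev γ) (g := fun p : ℝ × F => Γ (p.2, p.1)) (EvSmooth.clm ev)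
      (EvSmooth.comp (f := Γ) (g := fun p : ℝ × F => (p.2, p.1)) hΓ hswap)
  have hFl0 : Fl (0, x₀) = x₀ := by simp only [Fl, hΓ0]; rfl
  refine ⟨Fl, hFl, ?_, ?_⟩
  · have ht : Tendsto (fun x : F => (x, (0 : ℝ))) (𝓝 x₀) (𝓝 (x₀, 0)) :=
      (Continuous.prodMk continuous_id continuous_const).tendsto' _ _ rfl
    filter_upwards [ht.eventually hΓeq] with x hx
    simp only [Fl]
    rw [hx]; simp
  -- scaling of time
  have hscale : ∀ᶠ p in 𝓝 (x₀, (0 : ℝ)), ∀ t : Icc (-1 : ℝ) 1, Γ p t = Fl (p.2 * t, p.1) := by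
    obtain ⟨U, hU, V', hV', hUV'⟩ := mem_nhds_prod_iff.1 hΓuniq
    obtain ⟨V, hV, hVV⟩ := Metric.mem_nhds_iff.1 hV'
    have hUV := (prod_mono_right hVV).trans hUV'
    have hV' : ∀ᶠ p in 𝓝 (x₀, (0 : ℝ)), Γ p ∈ Metric.ball (ContinuousMap.const _ x₀) V := by
      have := hΓ.continuousAt
      rw [ContinuousAt, hΓ0] at this
      exact this (Metric.ball_mem_nhds _ hV)
    obtain ⟨r, hr, hrU⟩ := Metric.mem_nhds_iff.1 hU
    filter_upwards [hV', hΓeq, Metric.ball_mem_nhds _ hr] with p hp hpe hpr t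
    have hb : |(t : ℝ)| ≤ 1 := abs_le.2 t.2
    -- The curve `t' ↦ Γ p (t t')` solves the fixed point equation with `p.2` replaced by `p.2 * t`.
    -- Local uniqueness identifies it with `Γ (p.1, p.2 * t)`, and evaluation at `t' = 1` gives the
    -- claim.
    let m : C(Icc (-1 : ℝ) 1, Icc (-1 : ℝ) 1) := ⟨fun t' => ⟨t * t', by
      rw [mem_Icc, ← abs_le, abs_mul]
      exact mul_le_one₀ hb (abs_nonneg _) (abs_le.2 t'.2)⟩, by fun_prop⟩
    have hq : (((p.1, p.2 * t), (Γ p).comp m) : (F × ℝ) × C(Icc (-1 : ℝ) 1, F)) ∈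
        U ×ˢ Metric.ball (ContinuousMap.const (Icc (-1 : ℝ) 1) x₀) V := by
      refine ⟨hrU ?_, ?_⟩
      · rw [Metric.mem_ball, Prod.dist_eq, max_lt_iff] at hpr ⊢
        refine ⟨hpr.1, ?_⟩
        have h2 := hpr.2
        rw [Real.dist_eq, sub_zero] at h2 ⊢
        rw [abs_mul]
        nlinarith [abs_nonneg p.2, abs_nonneg (t : ℝ)]
      · rw [Metric.mem_ball] at hp ⊢
        refine lt_of_le_of_lt ((ContinuousMap.dist_le dist_nonneg).2 fun t' => ?_) hp
        exact ContinuousMap.dist_apply_le_dist (f := Γ p)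
          (g := ContinuousMap.const (Icc (-1 : ℝ) 1) x₀) (m t')
    have := hUV hq ?_
    · have h3 := congrArg (fun γ : C(Icc (-1 : ℝ) 1, F) => γ one) this
      simp only [Fl]
      refine Eq.trans ?_ h3.symm
      change Γ p t = Γ p (m one)
      congr 1
      ext; simp [m, one]
    · ext t'
      have h4 := congrArg (fun γ : C(Icc (-1 : ℝ) 1, F) => γ (m t')) hpe
      refine h4.trans ?_
      simp only [ContinuousMap.add_apply, ContinuousMap.smul_apply, ContinuousMap.const_apply,
        integralOp_apply]
      congr 1
      rw [mul_smul]
      congr 1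
      have h5 := intervalIntegral.smul_integral_comp_mul_left
        (a := 0) (b := (t' : ℝ)) (c := (t : ℝ)) (f := IccExtend (show (-1 : ℝ) ≤ 1 by norm_num)
          (superpose (Icc (-1 : ℝ) 1) Y hY.continuous (Γ p)))
      rw [mul_zero] at h5
      rw [show ((m t' : Icc (-1 : ℝ) 1) : ℝ) = t * t' from rfl, ← h5]
      congr 1
      refine intervalIntegral.integral_congr fun s hs => ?_
      have hs' : s ∈ Icc (-1 : ℝ) 1 := by
        have := t'.2
        rcases le_total 0 (t' : ℝ) with h | h
        · rw [uIcc_of_le h] at hs; exact ⟨by linarith [hs.1], hs.2.trans this.2⟩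
        · rw [uIcc_of_ge h] at hs; exact ⟨this.1.trans hs.1, by linarith [hs.2]⟩
      have hs'' : (t : ℝ) * s ∈ Icc (-1 : ℝ) 1 := (m ⟨s, hs'⟩).2
      rw [IccExtend_of_mem _ _ hs']
      change IccExtend _ _ ((t : ℝ) * s) = _
      rw [IccExtend_of_mem _ _ hs'']
      rfl
  -- the differential equation
  have hev : ∀ᶠ p in 𝓝 ((0 : ℝ), x₀), X (Fl p) = Y (Fl p) := by
    have hc := hFl.continuousAt
    rw [ContinuousAt, hFl0] at hc
    filter_upwards [hc.eventually hYX] with p hp using hp.symm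
  obtain ⟨r, hr, hrs⟩ := Metric.eventually_nhds_iff_ball.1 (hscale.and hΓeq)
  filter_upwards [hev, Metric.ball_mem_nhds _ (half_pos hr)] with p hp hpr
  rw [hp]
  rw [Metric.mem_ball, Prod.dist_eq, max_lt_iff, Real.dist_eq, sub_zero] at hpr
  -- All times `|s| < r / 2` are read off one curve, `Γ (p.2, r / 2)`, at the parameter `s / (r /
  -- 2)`. The differential equation is then the fundamental theorem of calculus for that curve.
  have hmem : ((p.2, r / 2) : F × ℝ) ∈ Metric.ball (x₀, (0 : ℝ)) r := by
    rw [Metric.mem_ball, Prod.dist_eq, max_lt_iff, Real.dist_eq, sub_zero, abs_of_pos (by linarith)]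
    exact ⟨by dsimp only; linarith [hpr.2], by linarith⟩
  obtain ⟨h1, h2⟩ := hrs _ hmem
  set γ := Γ (p.2, r / 2)
  have hc : Continuous (IccExtend (show (-1 : ℝ) ≤ 1 by norm_num)
    (superpose (Icc (-1 : ℝ) 1) Y hY.continuous γ)) := ContinuousMap.continuous _ |>.Icc_extend'
  let u : ℝ → F := fun t => p.2 + (r / 2) • ∫ s in (0 : ℝ)..t,
    IccExtend (show (-1 : ℝ) ≤ 1 by norm_num) (superpose (Icc (-1 : ℝ) 1) Y hY.continuous γ) s
  have hu : ∀ t, HasDerivAt u ((r / 2) • IccExtend (show (-1 : ℝ) ≤ 1 by norm_num)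
      (superpose (Icc (-1 : ℝ) 1) Y hY.continuous γ) t) t := fun t =>
    ((hc.integral_hasStrictDerivAt 0 t).hasDerivAt.const_smul (r / 2)).const_add p.2
  have hus : ∀ s, |s| < r / 2 → Fl (s, p.2) = u (s / (r / 2)) ∧
      IccExtend (show (-1 : ℝ) ≤ 1 by norm_num)
        (superpose (Icc (-1 : ℝ) 1) Y hY.continuous γ) (s / (r / 2)) = Y (Fl (s, p.2)) := by
    intro s hs
    have hs' : s / (r / 2) ∈ Icc (-1 : ℝ) 1 := by
      rw [mem_Icc, ← abs_le, abs_div, abs_of_pos (half_pos hr)]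
      exact (div_le_one (half_pos hr)).2 hs.le
    have h3 := h1 ⟨s / (r / 2), hs'⟩
    simp only at h3
    rw [mul_div_cancel₀ _ (half_pos hr).ne'] at h3
    constructor
    · rw [← h3]
      exact congrArg (fun γ : C(Icc (-1 : ℝ) 1, F) => γ ⟨s / (r / 2), hs'⟩) h2
    · rw [IccExtend_of_mem _ _ hs', ← h3]
      rfl
  have hd : HasDerivAt (fun s => u (s / (r / 2))) (Y (Fl (p.1, p.2))) p.1 := by
    have h6 := (hu (p.1 / (r / 2))).scomp p.1 ((hasDerivAt_id p.1).div_const (r / 2))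
    rw [(hus p.1 hpr.1).2, smul_smul, one_div, inv_mul_cancel₀ (half_pos hr).ne', one_smul] at h6
    exact h6
  refine hd.congr_of_eventuallyEq ?_
  filter_upwards [(isOpen_lt continuous_abs continuous_const).mem_nhds hpr.1] with s hs
  exact (hus s hs).1

end Flow

/-! ### Exterior derivatives of one-forms and the flow box theorem -/

section FlowBox

variable {E F G : Type*} [NormedAddCommGroup E] [NormedSpace ℝ E]
  [NormedAddCommGroup F] [NormedSpace ℝ F] [NormedAddCommGroup G] [NormedSpace ℝ G]

/-- The exterior derivative of the one-form `θ`, at `y`, on the vectors `a` and `b`. -/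
noncomputable def ed (θ : F → F →L[ℝ] ℝ) (y a b : F) : ℝ := fderiv ℝ θ y a b - fderiv ℝ θ y b a

theorem ed_swap (θ : F → F →L[ℝ] ℝ) (y a b : F) : ed θ y a b = - ed θ y b a := by
  simp [ed]

theorem ed_self (θ : F → F →L[ℝ] ℝ) (y a : F) : ed θ y a a = 0 := by
  simp [ed]

theorem Filter.EventuallyEq.ed_eq {θ η : F → F →L[ℝ] ℝ} {y : F} (h : θ =ᶠ[𝓝 y] η) (a b : F) :
    ed θ y a b = ed η y a b := by
  simp only [ed, h.fderiv_eq]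

theorem ed_pullback {Φ : G → F} {θ : F → F →L[ℝ] ℝ} {p : G} (hΦ : EvSmooth Φ p)
    (hθ : EvSmooth θ (Φ p)) (a b : G) :
    ed (fun q => (θ (Φ q)).comp (fderiv ℝ Φ q)) p a b =
      ed θ (Φ p) (fderiv ℝ Φ p a) (fderiv ℝ Φ p b) := by
  have h1 : HasFDerivAt (fun q => θ (Φ q)) ((fderiv ℝ θ (Φ p)).comp (fderiv ℝ Φ p)) p :=
    hθ.differentiableAt.hasFDerivAt.comp p hΦ.differentiableAt.hasFDerivAt
  have h2 := hΦ.fderiv.differentiableAt.hasFDerivAt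
  have h3 := (h1.clm_comp h2).fderiv
  have hs := hΦ.contDiffAt.isSymmSndFDerivAt (by
    rw [minSmoothness_of_isRCLikeNormedField]
    exact WithTop.coe_le_coe.2 le_top)
  have hsab := hs.eq a b
  simp only [ed, h3, add_apply, ContinuousLinearMap.comp_apply,
    ContinuousLinearMap.compL_apply, ContinuousLinearMap.flip_apply, hsab]
  ring

theorem EvSmooth.pullback {Φ : G → F} {θ : F → F →L[ℝ] ℝ} {p : G} (hΦ : EvSmooth Φ p)
    (hθ : EvSmooth θ (Φ p)) : EvSmooth (fun q => (θ (Φ q)).comp (_root_.fderiv ℝ Φ q)) p :=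
  (EvSmooth.comp hθ hΦ).clm_comp hΦ.fderiv

/-- A one-form on `ℝ × G` which is killed by `∂_s`, as is its exterior derivative, does not depend
on `s`. -/
theorem eventually_eq_of_ed_eq_zero {η : ℝ × G → (ℝ × G) →L[ℝ] ℝ} {u : G} (hη : EvSmooth η (0, u))
    (hη1 : ∀ᶠ p in 𝓝 ((0 : ℝ), u), η p (1, 0) = 0)
    (hη2 : ∀ᶠ p in 𝓝 ((0 : ℝ), u), ∀ q, ed η p (1, 0) q = 0) :
    ∀ᶠ p in 𝓝 ((0 : ℝ), u), ∀ v, η p (0, v) = η (0, p.2) (0, v) := by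
  -- In `dη(∂_s, v)` the term that differentiates `η(∂_s)` in the direction `v` vanishes, which
  -- leaves the `s`-derivative of `η(v)`.
  have hη2' : ∀ᶠ p in 𝓝 ((0 : ℝ), u), ∀ v, fderiv ℝ η p (1, 0) (0, v) = 0 := by
    filter_upwards [eventually_eventually_nhds.2 hη1, hη.eventually_differentiableAt, hη2]
      with p h1 h2 h3 v
    have h8 : HasFDerivAt (fun p => η p (1, 0)) ((fderiv ℝ η p).flip (1, 0)) p := by
      have := h2.hasFDerivAt.clm_apply (hasFDerivAt_const ((1, 0) : ℝ × G) p)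
      simpa using this
    have h9 : HasFDerivAt (fun p => η p (1, 0)) (0 : (ℝ × G) →L[ℝ] ℝ) p :=
      (hasFDerivAt_const (0 : ℝ) p).congr_of_eventuallyEq h1
    have h10 := congrArg (fun L : (ℝ × G) →L[ℝ] ℝ => L (0, v)) (h8.unique h9)
    simp only [ContinuousLinearMap.flip_apply, zero_apply] at h10
    have h11 := h3 (0, v)
    rw [ed, h10, sub_zero] at h11
    exact h11
  obtain ⟨r, hr, hr'⟩ := Metric.eventually_nhds_iff_ball.1
    (hη2'.and hη.eventually_differentiableAt)
  filter_upwards [Metric.ball_mem_nhds _ hr] with p hp v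
  rw [Metric.mem_ball, Prod.dist_eq, max_lt_iff] at hp
  have hmem : ∀ s ∈ Metric.ball (0 : ℝ) r, ((s, p.2) : ℝ × G) ∈ Metric.ball ((0 : ℝ), u) r := by
    intro s hs
    rw [Metric.mem_ball, Prod.dist_eq, max_lt_iff]
    exact ⟨hs, hp.2⟩
  have hder : ∀ s ∈ Metric.ball (0 : ℝ) r,
      HasDerivAt (fun s : ℝ => η (s, p.2) (0, v)) 0 s := by
    intro s hs
    obtain ⟨h1, h2⟩ := hr' _ (hmem s hs)
    have h3 : HasDerivAt (fun s : ℝ => ((s, p.2) : ℝ × G)) (1, 0) s :=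
      (hasDerivAt_id s).prodMk (hasDerivAt_const _ _)
    have h4 := ((ContinuousLinearMap.apply ℝ ℝ ((0 : ℝ), v)).hasFDerivAt
      (x := η (s, p.2))).comp_hasDerivAt s (h2.hasFDerivAt.comp_hasDerivAt s h3)
    have h5 := h1 v
    rw [ContinuousLinearMap.apply_apply, h5] at h4
    exact h4
  have := Metric.isOpen_ball.eqOn_of_deriv_eq (𝕜 := ℝ) (convex_ball (0 : ℝ) r).isPreconnected
    (f := fun s : ℝ => η (s, p.2) (0, v)) (g := fun _ => η (0, p.2) (0, v))
    (fun s hs => (hder s hs).differentiableAt.differentiableWithinAt)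
    (differentiableOn_const _) (fun s hs => by simp [(hder s hs).deriv])
    (Metric.mem_ball_self hr) rfl
  exact this (x := p.1) hp.1

/-- The flow box theorem for a vector field `X` and a linear slice `j` through `u` transverse to it:
the functions `a` (time) and `Z` (position in the slice), and the fact that a one-form `θ` with
`θ(X) = 0` and `dθ(X, ·) = 0` is pulled back by `Z` from its restriction to the slice. -/
theorem exists_flow_box [FiniteDimensional ℝ F] [FiniteDimensional ℝ G] {X : F → F} {j : G →L[ℝ] F}
    {u : G} (hX : EvSmooth X (j u))
    (hbij : Function.Bijective fun p : ℝ × G => p.1 • X (j u) + j p.2) :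
    ∃ (a : F → ℝ) (Z : F → G), EvSmooth a (j u) ∧ EvSmooth Z (j u) ∧ Z (j u) = u ∧
      (∀ᶠ y in 𝓝 (j u), fderiv ℝ a y (X y) = 1 ∧ fderiv ℝ Z y (X y) = 0) ∧
      (∀ᶠ h in 𝓝 u, a (j h) = 0 ∧ Z (j h) = h) ∧
      ∀ θ : F → F →L[ℝ] ℝ, EvSmooth θ (j u) → (∀ᶠ y in 𝓝 (j u), θ y (X y) = 0) →
        (∀ᶠ y in 𝓝 (j u), ∀ b, ed θ y (X y) b = 0) →
        ∀ᶠ y in 𝓝 (j u), ∀ b, θ y b = θ (j (Z y)) (j (fderiv ℝ Z y b)) := by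
  have := FiniteDimensional.complete ℝ G
  obtain ⟨Fl, hFl, hFl0, hFlX⟩ := exists_smooth_flow hX
  -- The slice is moved by the flow. At `(0, u)` the differential is `(s, h) ↦ s • X + j h`,
  -- invertible by transversality, and `a`, `Z` are the two components of the local inverse.
  let Φ : ℝ × G → F := fun p => Fl (p.1, j p.2)
  let ι : ℝ × G → ℝ × F := fun p => (p.1, j p.2)
  have hιc : ContDiff ℝ ∞ ι := contDiff_fst.prodMk (j.contDiff.comp contDiff_snd)
  have hΦ : EvSmooth Φ (0, u) := EvSmooth.comp (f := Fl) (g := ι) hFl (EvSmooth.of_contDiff hιc)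
  have hΦ0 : ∀ᶠ h in 𝓝 u, Φ (0, h) = j h := j.continuous.continuousAt.eventually hFl0
  have hΦu : Φ (0, u) = j u := hΦ0.self_of_nhds
  have hΦX : ∀ᶠ p in 𝓝 ((0 : ℝ), u), fderiv ℝ Φ p (1, 0) = X (Φ p) := by
    filter_upwards [hιc.continuous.continuousAt.eventually hFlX, hΦ.eventually_differentiableAt]
      with p hp hd
    have h1 : HasDerivAt (fun s : ℝ => Φ (s, p.2)) (fderiv ℝ Φ p (1, 0)) p.1 := by
      have h2 : HasDerivAt (fun s : ℝ => ((s, p.2) : ℝ × G)) (1, 0) p.1 :=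
        (hasDerivAt_id p.1).prodMk (hasDerivAt_const _ _)
      exact hd.hasFDerivAt.comp_hasDerivAt p.1 h2
    exact h1.unique hp
  have hΦv : ∀ᶠ h in 𝓝 u, ∀ v, fderiv ℝ Φ (0, h) (0, v) = j v := by
    have ht : Tendsto (fun h : G => ((0 : ℝ), h)) (𝓝 u) (𝓝 (0, u)) :=
      (Continuous.prodMk continuous_const continuous_id).tendsto' _ _ rfl
    filter_upwards [eventually_eventually_nhds.2 hΦ0, ht.eventually hΦ.eventually_differentiableAt]
      with h hh hd v
    have h1 : HasFDerivAt (fun h : G => Φ (0, h))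
        ((fderiv ℝ Φ (0, h)).comp (ContinuousLinearMap.inr ℝ ℝ G)) h :=
      hd.hasFDerivAt.comp h (hasFDerivAt_prodMk_right (0 : ℝ) h)
    have h2 : HasFDerivAt (fun h : G => Φ (0, h)) j h := j.hasFDerivAt.congr_of_eventuallyEq hh
    simpa using congrArg (fun L : G →L[ℝ] F => L v) (h1.unique h2)
  let A₀ : (ℝ × G) →L[ℝ] F :=
    (ContinuousLinearMap.fst ℝ ℝ G).smulRight (X (j u)) + j.comp (ContinuousLinearMap.snd ℝ ℝ G)
  let A : (ℝ × G) ≃L[ℝ] F :=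
    (LinearEquiv.ofBijective A₀.toLinearMap hbij).toContinuousLinearEquiv
  have hA : fderiv ℝ Φ (0, u) = (A : (ℝ × G) →L[ℝ] F) := by
    ext v
    · have := hΦX.self_of_nhds
      rw [hΦu] at this
      simpa [A, A₀] using this
    · simpa [A, A₀] using hΦv.self_of_nhds v
  obtain ⟨ψ, hψ, hψu, hψl, hψr⟩ :=
    hΦ.exists_local_inverse A (hA ▸ hΦ.differentiableAt.hasFDerivAt)
  rw [hΦu] at hψ hψu hψr
  have hψt : Tendsto ψ (𝓝 (j u)) (𝓝 (0, u)) := by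
    have := hψ.continuousAt
    rwa [ContinuousAt, hψu] at this
  have hψd : ∀ᶠ p in 𝓝 ((0 : ℝ), u), ∀ q, fderiv ℝ ψ (Φ p) (fderiv ℝ Φ p q) = q := by
    have hc := hΦ.continuousAt
    rw [ContinuousAt, hΦu] at hc
    filter_upwards [eventually_eventually_nhds.2 hψl, hΦ.eventually_differentiableAt,
      hc.eventually hψ.eventually_differentiableAt] with p hp h1 h2 q
    have h3 : HasFDerivAt (fun p => ψ (Φ p)) _ p := h2.hasFDerivAt.comp p h1.hasFDerivAt
    have h4 : HasFDerivAt (fun p => ψ (Φ p)) (ContinuousLinearMap.id ℝ (ℝ × G)) p :=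
      (hasFDerivAt_id p).congr_of_eventuallyEq hp
    exact congrArg (fun L : (ℝ × G) →L[ℝ] (ℝ × G) => L q) (h3.unique h4)
  have hψd' : ∀ᶠ y in 𝓝 (j u), ∀ b, fderiv ℝ Φ (ψ y) (fderiv ℝ ψ y b) = b := by
    filter_upwards [eventually_eventually_nhds.2 hψr, hψ.eventually_differentiableAt,
      hψt.eventually hΦ.eventually_differentiableAt] with p hp h1 h2 q
    have h3 : HasFDerivAt (fun p => Φ (ψ p)) _ p := h2.hasFDerivAt.comp p h1.hasFDerivAt
    have h4 : HasFDerivAt (fun p => Φ (ψ p)) (ContinuousLinearMap.id ℝ F) p :=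
      (hasFDerivAt_id p).congr_of_eventuallyEq hp
    exact congrArg (fun L : F →L[ℝ] F => L q) (h3.unique h4)
  have hcomp : ∀ᶠ y in 𝓝 (j u), ∀ b, fderiv ℝ (fun y => (ψ y).1) y b = (fderiv ℝ ψ y b).1 ∧
      fderiv ℝ (fun y => (ψ y).2) y b = (fderiv ℝ ψ y b).2 := by
    filter_upwards [hψ.eventually_differentiableAt] with y hy b
    exact ⟨by rw [hy.hasFDerivAt.fst.fderiv]; rfl, by rw [hy.hasFDerivAt.snd.fderiv]; rfl⟩
  refine ⟨fun y => (ψ y).1, fun y => (ψ y).2, hψ.fst, hψ.snd, by simp [hψu], ?_, ?_, ?_⟩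
  · filter_upwards [hcomp, hψr, hψt.eventually hΦX, hψt.eventually hψd] with y h1 h2 h3 h4
    have h5 := h4 (1, 0)
    rw [h3, h2] at h5
    rw [(h1 _).1, (h1 _).2, h5]
    exact ⟨rfl, rfl⟩
  · have ht : Tendsto (fun h : G => ((0 : ℝ), h)) (𝓝 u) (𝓝 (0, u)) :=
      (Continuous.prodMk continuous_const continuous_id).tendsto' _ _ rfl
    filter_upwards [ht.eventually hψl, hΦ0] with h h1 h2
    rw [h2] at h1
    rw [h1]
    exact ⟨rfl, rfl⟩
  · intro θ hθ hθX hdθ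
    have hc := hΦ.continuousAt
    rw [ContinuousAt, hΦu] at hc
    let η : ℝ × G → (ℝ × G) →L[ℝ] ℝ := fun p => (θ (Φ p)).comp (fderiv ℝ Φ p)
    have hη : EvSmooth η (0, u) := hΦ.pullback (by rwa [hΦu])
    have hη1 : ∀ᶠ p in 𝓝 ((0 : ℝ), u), η p (1, 0) = 0 := by
      filter_upwards [hΦX, hc.eventually hθX] with p h1 h2
      simp only [η, ContinuousLinearMap.comp_apply]
      rw [h1, h2]
    have hη2 : ∀ᶠ p in 𝓝 ((0 : ℝ), u), ∀ q, ed η p (1, 0) q = 0 := by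
      filter_upwards [hΦ.eventually, hc.eventually hθ.eventually, hΦX, hc.eventually hdθ]
        with p h3 h4 h5 h6 q
      have h7 := ed_pullback h3 h4 (1, 0) q
      rw [h5, h6] at h7
      exact h7
    have hη3 := eventually_eq_of_ed_eq_zero hη hη1 hη2
    filter_upwards [hcomp, hψr, hψt.eventually hη3, hψt.eventually hη1, hψd',
      (continuousAt_snd.tendsto.comp hψt).eventually hΦ0,
      (continuousAt_snd.tendsto.comp hψt).eventually hΦv] with y h1 h2 h3 h4 h5 h6 h7 b
    have h8 : θ y b = η (ψ y) (fderiv ℝ ψ y b) := by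
      simp only [η, ContinuousLinearMap.comp_apply]
      rw [h2, h5]
    have h9 : fderiv ℝ ψ y b = (fderiv ℝ ψ y b).1 • ((1 : ℝ), (0 : G)) +
        ((0 : ℝ), (fderiv ℝ ψ y b).2) := by
      ext <;> simp
    rw [h8, h9, map_add, map_smul, h4, smul_zero, zero_add, h3, (h1 b).2]
    simp only [η, ContinuousLinearMap.comp_apply]
    simp only [Function.comp_apply] at h6 h7
    rw [h6, h7]

end FlowBox

/-! ### Liouville germs and symplectic reduction by a homogeneous function -/

section Reduction

variable {F G : Type*} [NormedAddCommGroup F] [NormedSpace ℝ F]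
  [NormedAddCommGroup G] [NormedSpace ℝ G]

/-- `θ` is, near `u`, a one-form with nondegenerate exterior derivative, of which the Euler field
`y ↦ y` is the Liouville field. -/
structure LiouvilleGerm (θ : F → F →L[ℝ] ℝ) (u : F) : Prop where
  smooth : EvSmooth θ u
  euler : ∀ᶠ y in 𝓝 u, ∀ b, ed θ y y b = θ y b
  nondeg : ∀ a, (∀ b, ed θ u a b = 0) → a = 0

/-- The bilinear map of the exterior derivative. -/
noncomputable def edMap (θ : F → F →L[ℝ] ℝ) (y : F) : F →L[ℝ] F →L[ℝ] ℝ :=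
  fderiv ℝ θ y - (fderiv ℝ θ y).flip

theorem edMap_apply (θ : F → F →L[ℝ] ℝ) (y a b : F) : edMap θ y a b = ed θ y a b := rfl

theorem EvSmooth.edMap {θ : F → F →L[ℝ] ℝ} {u : F} (h : EvSmooth θ u) : EvSmooth (edMap θ) u :=
  h.fderiv.sub (EvSmooth.comp
    (f := fun L => (ContinuousLinearMap.flipₗᵢ ℝ F F ℝ).toContinuousLinearEquiv L)
    (EvSmooth.of_contDiff (ContinuousLinearEquiv.contDiff _)) h.fderiv)

theorem ed_sub_smul {θ : F → F →L[ℝ] ℝ} {p q : F → ℝ} {y : F} (hθ : EvSmooth θ y)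
    (hp : EvSmooth p y) (hq : EvSmooth q y) (a b : F) :
    ed (fun y => θ y - p y • fderiv ℝ q y) y a b =
      ed θ y a b - (fderiv ℝ p y a * fderiv ℝ q y b - fderiv ℝ p y b * fderiv ℝ q y a) := by
  have h1 := hθ.differentiableAt.hasFDerivAt.fun_sub
    (hp.differentiableAt.hasFDerivAt.fun_smul hq.fderiv.differentiableAt.hasFDerivAt)
  have hs := (hq.contDiffAt.isSymmSndFDerivAt (by
    rw [minSmoothness_of_isRCLikeNormedField]
    exact WithTop.coe_le_coe.2 le_top)).eq a b
  simp only [ed, h1.fderiv, sub_apply, add_apply, smul_apply, smul_eq_mul,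
    ContinuousLinearMap.smulRight_apply, hs]
  ring

namespace LiouvilleGerm

variable {θ : F → F →L[ℝ] ℝ} {u : F}

theorem form_ne_zero (hθ : LiouvilleGerm θ u) (hu : u ≠ 0) : θ u ≠ 0 := fun h =>
  hu (hθ.nondeg u fun b => by rw [hθ.euler.self_of_nhds, h]; rfl)

variable [FiniteDimensional ℝ F]

theorem exists_edMap_eq (hθ : LiouvilleGerm θ u) :
    ∃ A : F ≃L[ℝ] (F →L[ℝ] ℝ), edMap θ u = (A : F →L[ℝ] F →L[ℝ] ℝ) := by
  have hinj : Function.Injective (edMap θ u).toLinearMap := by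
    rw [← LinearMap.ker_eq_bot, LinearMap.ker_eq_bot']
    intro a ha
    refine hθ.nondeg a fun b => ?_
    exact congrArg (fun L : F →L[ℝ] ℝ => L b) ha
  have hfr : Module.finrank ℝ F = Module.finrank ℝ (F →L[ℝ] ℝ) := by
    rw [← Subspace.dual_finrank_eq (K := ℝ) (V := F)]
    exact (LinearMap.toContinuousLinearMap (𝕜 := ℝ) (E := F) (F' := ℝ)).finrank_eq
  refine ⟨(LinearMap.linearEquivOfInjective _ hinj hfr).toContinuousLinearEquiv, ?_⟩
  ext a b
  rfl

/-- A smooth one-form becomes a smooth vector field through the inverse of dθ: inversion is smooth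
on the open set of invertible operators, and dθ at `u` is invertible because it is injective between
spaces of equal dimension. -/
theorem exists_sharp (hθ : LiouvilleGerm θ u) {lam : F → F →L[ℝ] ℝ} (hl : EvSmooth lam u) :
    ∃ X : F → F, EvSmooth X u ∧ ∀ᶠ y in 𝓝 u, ∀ b, ed θ y (X y) b = lam y b := by
  have := FiniteDimensional.complete ℝ F
  obtain ⟨A, hA⟩ := hθ.exists_edMap_eq
  have hs := hθ.smooth.edMap
  have hinv : ∀ᶠ y in 𝓝 u, ∃ B : F ≃L[ℝ] (F →L[ℝ] ℝ), edMap θ y = (B : F →L[ℝ] F →L[ℝ] ℝ) := by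
    have h2 : range ((↑) : (F ≃L[ℝ] (F →L[ℝ] ℝ)) → F →L[ℝ] F →L[ℝ] ℝ) ∈ 𝓝 (edMap θ u) := by
      rw [hA]; exact A.nhds
    filter_upwards [hs.continuousAt h2] with y ⟨B, hB⟩ using ⟨B, hB.symm⟩
  refine ⟨fun y => (edMap θ y).inverse (lam y), ?_, ?_⟩
  · refine EvSmooth.clm_apply ?_ hl
    filter_upwards [hs, hinv] with y hy hB
    obtain ⟨B, hB⟩ := hB
    have := contDiffAt_map_inverse (𝕜 := ℝ) (n := ∞) B
    rw [← hB] at this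
    exact this.comp y hy
  · filter_upwards [hinv] with y hB b
    obtain ⟨B, hB⟩ := hB
    rw [← edMap_apply, hB, ContinuousLinearMap.inverse_equiv]
    simp

theorem eventually_nondeg (hθ : LiouvilleGerm θ u) :
    ∀ᶠ y in 𝓝 u, ∀ a, (∀ b, ed θ y a b = 0) → a = 0 := by
  obtain ⟨A, hA⟩ := hθ.exists_edMap_eq
  have h2 : range ((↑) : (F ≃L[ℝ] (F →L[ℝ] ℝ)) → F →L[ℝ] F →L[ℝ] ℝ) ∈ 𝓝 (edMap θ u) := by
    rw [hA]; exact A.nhds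
  filter_upwards [hθ.smooth.edMap.continuousAt h2] with y ⟨B, hB⟩ a ha
  refine B.injective ?_
  rw [map_zero]
  ext b
  have := ha b
  rw [← edMap_apply, ← hB] at this
  exact this

end LiouvilleGerm

/-- The slice is the kernel of a functional nonzero at `x` and zero at `u`. That it contains `u`,
not only a translate of a hyperplane through `u`, makes the Euler field tangent to it, so the Euler
relation survives restriction. -/
theorem exists_slice [FiniteDimensional ℝ F] {x u : F} (h : x ∉ Submodule.span ℝ {u}) :
    ∃ G : Submodule ℝ F, u ∈ G ∧ Module.finrank ℝ G + 1 = Module.finrank ℝ F ∧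
      Function.Bijective fun p : ℝ × G => p.1 • x + (p.2 : F) := by
  obtain ⟨k, hk, hk'⟩ := Submodule.exists_le_ker_of_notMem h
  have hu : k u = 0 := hk' (Submodule.mem_span_singleton_self u)
  refine ⟨LinearMap.ker k, hu, ?_, ?_, ?_⟩
  · have h1 := LinearMap.finrank_range_add_finrank_ker k
    have h2 : LinearMap.range k = ⊤ := by
      refine LinearMap.range_eq_top.2 fun c => ⟨(c / k x) • x, ?_⟩
      simp [hk]
    rw [h2, finrank_top, Module.finrank_self] at h1
    omega
  · rintro ⟨s, h⟩ ⟨s', h'⟩ he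
    simp only at he
    have h1 := congrArg k he
    simp only [map_add, map_smul, smul_eq_mul, LinearMap.map_coe_ker, add_zero] at h1
    have h2 : s = s' := mul_right_cancel₀ hk h1
    subst h2
    simpa using he
  · intro y
    refine ⟨(k y / k x, ⟨y - (k y / k x) • x, ?_⟩), ?_⟩
    · simp [hk]
    · simp

/-- Symplectic reduction of a Liouville germ by a function `p`, homogeneous of degree one:
`θ = p dq + Y^*(θ|_G)` for a subspace `G` of codimension two. -/
theorem LiouvilleGerm.exists_reduction [FiniteDimensional ℝ F] {θ : F → F →L[ℝ] ℝ} {u : F}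
    (hθ : LiouvilleGerm θ u) {p : F → ℝ} (hp : EvSmooth p u)
    (hpe : ∀ᶠ y in 𝓝 u, fderiv ℝ p y y = p y) (hp0 : p u = 0)
    (hind : ∀ c : ℝ, fderiv ℝ p u ≠ c • θ u) (hu : u ≠ 0) :
    ∃ (G₁ : Submodule ℝ F) (G : Submodule ℝ G₁) (v : G) (q : F → ℝ) (Y : F → G),
      Module.finrank ℝ G + 2 = Module.finrank ℝ F ∧ ((v : G₁) : F) = u ∧
      EvSmooth q u ∧ EvSmooth Y u ∧ Y u = v ∧
      ∀ᶠ y in 𝓝 u, ∀ b, θ y b =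
        p y * fderiv ℝ q y b + θ ((Y y : G₁) : F) ((fderiv ℝ Y y b : G₁) : F) := by
  obtain ⟨X, hX, hXp⟩ := hθ.exists_sharp hp.fderiv.neg
  have hXp' : ∀ᶠ y in 𝓝 u, ∀ b, ed θ y (X y) b = - fderiv ℝ p y b := hXp
  have hθu := hθ.form_ne_zero hu
  -- If `X u = c u`, then `dθ(u, ·) = θ u` turns the definition of `X` into `dp = -c θ`, which
  -- `hind` excludes.
  have hXu : X u ∉ Submodule.span ℝ {u} := by
    intro h
    obtain ⟨c, hc⟩ := Submodule.mem_span_singleton.1 h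
    refine hind (-c) ?_
    ext b
    have h1 := hXp'.self_of_nhds b
    rw [← hc, ← edMap_apply, map_smul, smul_apply, edMap_apply, hθ.euler.self_of_nhds] at h1
    simp only [smul_apply, smul_eq_mul] at h1 ⊢
    linarith
  obtain ⟨G₁, huG, hG₁, hbij⟩ := exists_slice hXu
  let j : G₁ →L[ℝ] F := G₁.subtypeL
  let v₁ : G₁ := ⟨u, huG⟩
  have hjv : j v₁ = u := rfl
  obtain ⟨q, Z, hq, hZ, hZu, hqZX, hqZj, hred⟩ := exists_flow_box (j := j) (u := v₁) hX hbij
  rw [hjv] at hq hZ hZu hqZX hred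
  have hθX : ∀ᶠ y in 𝓝 u, θ y (X y) = p y := by
    filter_upwards [hθ.euler, hXp', hpe] with y h1 h2 h3
    rw [← h1, ed_swap, h2, neg_neg, h3]
  have hpX : ∀ᶠ y in 𝓝 u, fderiv ℝ p y (X y) = 0 := by
    filter_upwards [hXp'] with y h2
    have := h2 (X y)
    rw [ed_self] at this
    linarith
  -- Since `θ(X) = dp(y) = p`, `dq(X) = 1` and `dp(X) = 0`, the form `θ - p dq` and its exterior
  -- derivative are both killed by `X`. It therefore descends along the flow of `X` to the slice.
  let η : F → F →L[ℝ] ℝ := fun y => θ y - p y • fderiv ℝ q y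
  have hη : EvSmooth η u := hθ.smooth.sub (hp.smul hq.fderiv)
  have hedη : ∀ᶠ y in 𝓝 u, ∀ a b, ed η y a b =
      ed θ y a b - (fderiv ℝ p y a * fderiv ℝ q y b - fderiv ℝ p y b * fderiv ℝ q y a) := by
    filter_upwards [hθ.smooth.eventually, hp.eventually, hq.eventually] with y h1 h2 h3 a b
    exact ed_sub_smul h1 h2 h3 a b
  have hηX : ∀ᶠ y in 𝓝 u, η y (X y) = 0 := by
    filter_upwards [hθX, hqZX] with y h1 h2
    simp only [η, sub_apply, smul_apply, h1, h2.1, smul_eq_mul]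
    ring
  have hηX' : ∀ᶠ y in 𝓝 u, ∀ b, ed η y (X y) b = 0 := by
    filter_upwards [hedη, hXp', hpX, hqZX] with y h1 h2 h3 h4 b
    rw [h1, h2, h3, h4.1]
    ring
  have hredη := hred η hη hηX hηX'
  -- the restriction to the hypersurface
  let θ₁ : G₁ → G₁ →L[ℝ] ℝ := fun z => (θ (j z)).comp j
  have hθ₁ : EvSmooth θ₁ v₁ :=
    (EvSmooth.comp (f := θ) hθ.smooth (EvSmooth.clm j)).clm_comp (EvSmooth.const j)
  have hjt : Tendsto j (𝓝 v₁) (𝓝 u) := j.continuous.continuousAt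
  have hZt : Tendsto Z (𝓝 u) (𝓝 v₁) := by
    have := hZ.continuousAt
    rwa [ContinuousAt, hZu] at this
  have hdj : ∀ᶠ z in 𝓝 v₁, ∀ h, fderiv ℝ q (j z) (j h) = 0 ∧ fderiv ℝ Z (j z) (j h) = h := by
    filter_upwards [eventually_eventually_nhds.2 hqZj, hjt.eventually hq.eventually_differentiableAt,
      hjt.eventually hZ.eventually_differentiableAt] with z h1 h2 h3 h
    have h4 : HasFDerivAt (fun z => q (j z)) _ z := h2.hasFDerivAt.comp z j.hasFDerivAt
    have h5 : HasFDerivAt (fun z => q (j z)) (0 : G₁ →L[ℝ] ℝ) z :=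
      (hasFDerivAt_const (0 : ℝ) z).congr_of_eventuallyEq (h1.mono fun _ h => h.1)
    have h6 : HasFDerivAt (fun z => Z (j z)) _ z := h3.hasFDerivAt.comp z j.hasFDerivAt
    have h7 : HasFDerivAt (fun z => Z (j z)) (ContinuousLinearMap.id ℝ G₁) z :=
      (hasFDerivAt_id z).congr_of_eventuallyEq (h1.mono fun _ h => h.2)
    exact ⟨congrArg (fun L : G₁ →L[ℝ] ℝ => L h) (h4.unique h5),
      congrArg (fun L : G₁ →L[ℝ] G₁ => L h) (h6.unique h7)⟩
  have hηθ₁ : ∀ᶠ y in 𝓝 u, ∀ b, η y b = θ₁ (Z y) (fderiv ℝ Z y b) := by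
    filter_upwards [hredη, hZt.eventually hdj] with y h1 h2 b
    rw [h1]
    simp only [η, θ₁, sub_apply, smul_apply, (h2 _).1, ContinuousLinearMap.comp_apply]
    simp
  have hedθ₁ : ∀ᶠ y in 𝓝 u, ∀ a b, ed η y a b =
      ed θ₁ (Z y) (fderiv ℝ Z y a) (fderiv ℝ Z y b) := by
    filter_upwards [eventually_eventually_nhds.2 hηθ₁, hZ.eventually,
      hZt.eventually hθ₁.eventually] with y h1 h2 h3 a b
    rw [← ed_pullback h2 h3]
    refine Filter.EventuallyEq.ed_eq ?_ a b
    filter_upwards [h1] with y' hy'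
    ext b
    exact hy' b
  have hEuler₁ : ∀ᶠ z in 𝓝 v₁, ∀ b, ed θ₁ z z b = θ₁ z b := by
    filter_upwards [(EvSmooth.clm j).eventually, hjt.eventually hθ.smooth.eventually,
      hjt.eventually hθ.euler] with z h1 h2 h3 b
    have := ed_pullback h1 h2 z b
    simp only [ContinuousLinearMap.fderiv] at this
    rw [h3] at this
    exact this
  -- the kernel of the restriction
  obtain ⟨Q, hQ, hQq⟩ := hθ.exists_sharp hq.fderiv.neg
  have hQq' : ∀ᶠ y in 𝓝 u, ∀ b, ed θ y (Q y) b = - fderiv ℝ q y b := hQq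
  have hpQ : ∀ᶠ y in 𝓝 u, fderiv ℝ p y (Q y) = -1 := by
    filter_upwards [hXp', hQq', hqZX] with y h1 h2 h3
    have h4 := h1 (Q y)
    rw [ed_swap, h2, h3.1] at h4
    linarith
  -- The slice has one dimension too many for a symplectic form, and the kernel of dθ₁ is spanned by
  -- the projection of the field `Q` with `dθ(Q, ·) = -dq`: the terms `-dq` and `dp(Q) dq` cancel in
  -- `dη(Q, ·)`, because `dp(Q) = -1` and `dq(Q) = 0`. The Euler relation gives `θ₁(K) = 0` as well,
  -- so a second flow box applies.
  let K : G₁ → G₁ := fun z => fderiv ℝ Z (j z) (Q (j z))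
  have hK : EvSmooth K v₁ :=
    (EvSmooth.comp (f := fderiv ℝ Z) hZ.fderiv (EvSmooth.clm j)).clm_apply
      (EvSmooth.comp (f := Q) hQ (EvSmooth.clm j))
  have hK1 : ∀ᶠ z in 𝓝 v₁, ∀ b, ed θ₁ z (K z) b = 0 := by
    filter_upwards [hjt.eventually hedθ₁, hjt.eventually hedη, hjt.eventually hQq',
      hjt.eventually hpQ, hdj, hqZj] with z h1 h2 h3 h4 h5 h6 b
    have h7 := h1 (Q (j z)) (j b)
    have h8 := h3 (Q (j z))
    rw [ed_self] at h8
    have h9 : fderiv ℝ q (j z) (Q (j z)) = 0 := by linarith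
    rw [h6.2, (h5 b).2, h2, h3, h4, (h5 b).1, h9] at h7
    change _ = ed θ₁ z (K z) b at h7
    rw [← h7]
    ring
  have hK0 : ∀ᶠ z in 𝓝 v₁, θ₁ z (K z) = 0 := by
    filter_upwards [hK1, hEuler₁] with z h1 h2
    rw [← h2, ed_swap, h1, neg_zero]
  have hKu : K v₁ ∉ Submodule.span ℝ {v₁} := by
    intro h
    obtain ⟨c, hc⟩ := Submodule.mem_span_singleton.1 h
    -- If `c = 0`, then `Q u` is a multiple of `X u`, against `dp(Q) = -1` and `dp(X) = 0`. If `c ≠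
    -- 0`, the Euler vector lies in the kernel of dθ₁, so θ₁ and η vanish at the base point; since
    -- `p u = 0` this forces `θ u = 0`.
    rcases eq_or_ne c 0 with rfl | hc0
    · rw [zero_smul] at hc
      obtain ⟨⟨s, h⟩, hsh⟩ := hbij.2 (Q u)
      simp only at hsh
      have h1 : K v₁ = fderiv ℝ Z u (s • X u + j h) := by
        simp only [K, hjv]
        rw [← hsh]; rfl
      have h2 := (hdj.self_of_nhds h).2
      rw [hjv] at h2
      rw [map_add, map_smul, hqZX.self_of_nhds.2, smul_zero, zero_add, h2, ← hc] at h1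
      rw [← h1] at hsh
      have h3 := hpQ.self_of_nhds
      rw [← hsh] at h3
      have h4 : fderiv ℝ p u (s • X u) = -1 := by
        convert h3 using 2
        exact (add_zero _).symm
      rw [map_smul, hpX.self_of_nhds] at h4
      simp at h4
    · refine hθu ?_
      have h1 : ∀ b, θ₁ v₁ b = 0 := by
        intro b
        have h2 := hK1.self_of_nhds b
        rw [← hc, ← edMap_apply, map_smul, smul_apply, edMap_apply, hEuler₁.self_of_nhds,
          smul_eq_mul] at h2
        exact (mul_eq_zero.1 h2).resolve_left hc0
      ext b
      have h3 := hηθ₁.self_of_nhds b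
      rw [hZu, h1] at h3
      simpa [η, hp0] using h3
  obtain ⟨G, hvG, hG, hbij₂⟩ := exists_slice hKu
  let j₂ : G →L[ℝ] G₁ := G.subtypeL
  let v : G := ⟨v₁, hvG⟩
  obtain ⟨q₂, Z₂, -, hZ₂, hZ₂u, -, -, hred₂⟩ := exists_flow_box (j := j₂) (u := v) hK hbij₂
  have hjv₂ : j₂ v = v₁ := rfl
  rw [hjv₂] at hZ₂ hZ₂u hred₂
  have hr₂ := hred₂ θ₁ hθ₁ hK0 hK1
  have hZ₂' : EvSmooth Z₂ (Z u) := by rwa [hZu]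
  refine ⟨G₁, G, v, q, fun y => Z₂ (Z y), by omega, rfl, hq, EvSmooth.comp hZ₂' hZ, by
    change Z₂ (Z u) = v
    rw [hZu, hZ₂u], ?_⟩
  filter_upwards [hηθ₁, hZt.eventually hr₂, hZ.eventually_differentiableAt,
    hZt.eventually hZ₂.eventually_differentiableAt] with y h1 h2 h3 h4 b
  have h5 : HasFDerivAt (fun y => Z₂ (Z y)) _ y := h4.hasFDerivAt.comp y h3.hasFDerivAt
  have h6 := h1 b
  rw [h2] at h6
  rw [h5.fderiv]
  simp only [η, sub_apply, smul_apply, smul_eq_mul] at h6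
  simp only [ContinuousLinearMap.comp_apply]
  have h7 : θ y b = p y * fderiv ℝ q y b +
    θ₁ (j₂ (Z₂ (Z y))) (j₂ (fderiv ℝ Z₂ (Z y) (fderiv ℝ Z y b))) := by linarith
  exact h7

/-- Symplectic reduction of a Liouville germ by a function `p`, homogeneous of degree one: the
reduced form is again a Liouville germ, and the reduction map is homogeneous. -/
theorem LiouvilleGerm.exists_reduced_germ [FiniteDimensional ℝ F] {θ : F → F →L[ℝ] ℝ} {u : F}
    (hθ : LiouvilleGerm θ u) {p : F → ℝ} (hp : EvSmooth p u)
    (hpe : ∀ᶠ y in 𝓝 u, fderiv ℝ p y y = p y) (hp0 : p u = 0)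
    (hind : ∀ c : ℝ, fderiv ℝ p u ≠ c • θ u) (hu : u ≠ 0) :
    ∃ (G₁ : Submodule ℝ F) (G : Submodule ℝ G₁) (v : G) (θ' : G → G →L[ℝ] ℝ) (q : F → ℝ)
      (Y : F → G), Module.finrank ℝ G + 2 = Module.finrank ℝ F ∧ v ≠ 0 ∧ LiouvilleGerm θ' v ∧
      EvSmooth q u ∧ EvSmooth Y u ∧ Y u = v ∧
      (∀ᶠ y in 𝓝 u, ∀ b, θ y b = p y * fderiv ℝ q y b + θ' (Y y) (fderiv ℝ Y y b)) ∧
      (∀ᶠ y in 𝓝 u, ∀ a b, ed θ y a b = fderiv ℝ p y a * fderiv ℝ q y b -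
        fderiv ℝ p y b * fderiv ℝ q y a + ed θ' (Y y) (fderiv ℝ Y y a) (fderiv ℝ Y y b)) ∧
      (∀ᶠ y in 𝓝 u, fderiv ℝ Y y y = Y y) ∧
      ∀ᶠ y in 𝓝 u, ∀ a, (∀ b, ed θ y a b = - fderiv ℝ p y b) →
        fderiv ℝ q y a = 1 ∧ fderiv ℝ Y y a = 0 := by
  obtain ⟨G₁, G, v, q, Y, hfr, hv, hq, hY, hYu, heq⟩ := hθ.exists_reduction hp hpe hp0 hind hu
  let J : G →L[ℝ] F := G₁.subtypeL.comp G.subtypeL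
  have hJv : J v = u := hv
  let θ' : G → G →L[ℝ] ℝ := fun z => (θ (J z)).comp J
  have hJt : Tendsto J (𝓝 v) (𝓝 u) := by
    have := J.continuous.continuousAt (x := v)
    rwa [ContinuousAt, hJv] at this
  have hYt : Tendsto Y (𝓝 u) (𝓝 v) := by
    have := hY.continuousAt
    rwa [ContinuousAt, hYu] at this
  have hθ' : EvSmooth θ' v :=
    (EvSmooth.comp (f := θ) (by rw [hJv]; exact hθ.smooth) (EvSmooth.clm J)).clm_comp
      (EvSmooth.const J)
  have heq' : ∀ᶠ y in 𝓝 u, ∀ b, θ y b = p y * fderiv ℝ q y b + θ' (Y y) (fderiv ℝ Y y b) := heq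
  have hed : ∀ᶠ y in 𝓝 u, ∀ a b, ed θ y a b = fderiv ℝ p y a * fderiv ℝ q y b -
        fderiv ℝ p y b * fderiv ℝ q y a + ed θ' (Y y) (fderiv ℝ Y y a) (fderiv ℝ Y y b) := by
    filter_upwards [eventually_eventually_nhds.2 heq', hY.eventually, hYt.eventually hθ'.eventually,
      hθ.smooth.eventually, hp.eventually, hq.eventually] with y h1 h2 h3 h4 h5 h6 a b
    have h7 := ed_sub_smul h4 h5 h6 a b
    have h8 := ed_pullback h2 h3 a b
    have h9 : (fun y => θ y - p y • fderiv ℝ q y) =ᶠ[𝓝 y]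
        fun y => (θ' (Y y)).comp (fderiv ℝ Y y) := by
      filter_upwards [h1] with z hz
      ext b
      simp [hz b]
    rw [h9.ed_eq, h8] at h7
    linarith
  -- The formula for dθ shows that a vector killed by dp, dq and dY is in the kernel of dθ. Thus
  -- `(dp, dq, dY)` is injective, and the dimensions agree.
  have hsurj' : ∀ᶠ y in 𝓝 u, ∀ (t : ℝ) (w : G), ∃ b, fderiv ℝ p y b = 0 ∧ fderiv ℝ q y b = t ∧
      fderiv ℝ Y y b = w := by
    filter_upwards [hed, hθ.eventually_nondeg] with y h1 h2 t w
    let M : F →ₗ[ℝ] (ℝ × ℝ) × G :=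
      (((fderiv ℝ p y).prod (fderiv ℝ q y)).prod (fderiv ℝ Y y)).toLinearMap
    have hM : Function.Injective M := by
      rw [← LinearMap.ker_eq_bot, LinearMap.ker_eq_bot']
      intro a ha
      have ha1 : fderiv ℝ p y a = 0 := congrArg (fun z : (ℝ × ℝ) × G => z.1.1) ha
      have ha2 : fderiv ℝ q y a = 0 := congrArg (fun z : (ℝ × ℝ) × G => z.1.2) ha
      have ha3 : fderiv ℝ Y y a = 0 := congrArg (fun z : (ℝ × ℝ) × G => z.2) ha
      refine h2 a fun b => ?_
      rw [h1, ha1, ha2, ha3, ← edMap_apply, map_zero]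
      simp
    have hs : Function.Surjective M := by
      refine (LinearMap.injective_iff_surjective_of_finrank_eq_finrank ?_).1 hM
      simp only [Module.finrank_prod, Module.finrank_self]
      omega
    obtain ⟨b, hb⟩ := hs ((0, t), w)
    exact ⟨b, congrArg (fun z : (ℝ × ℝ) × G => z.1.1) hb,
      congrArg (fun z : (ℝ × ℝ) × G => z.1.2) hb, congrArg (fun z : (ℝ × ℝ) × G => z.2) hb⟩
  have hsurj := hsurj'.mono fun y hy => hy 0
  have hgerm : LiouvilleGerm θ' v := by
    refine ⟨hθ', ?_, ?_⟩
    · filter_upwards [(EvSmooth.clm J).eventually, hJt.eventually hθ.smooth.eventually,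
        hJt.eventually hθ.euler] with z h1 h2 h3 b
      have := ed_pullback h1 h2 z b
      simp only [ContinuousLinearMap.fderiv] at this
      rw [h3] at this
      exact this
    · intro a ha
      obtain ⟨c, hc1, hc2, hc3⟩ := hsurj.self_of_nhds a
      have : c = 0 := hθ.nondeg c fun b => by
        rw [hed.self_of_nhds, hc1, hc2, hc3, hYu, ha]
        ring
      rw [← hc3, this, map_zero]
  refine ⟨G₁, G, v, θ', q, Y, hfr, ?_, hgerm, hq, hY, hYu, heq', hed, ?_, ?_⟩
  · rintro rfl
    exact hu (by rw [← hJv, map_zero])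
  · filter_upwards [hed, hsurj, hθ.euler, heq', hYt.eventually hgerm.eventually_nondeg,
      hYt.eventually hgerm.euler] with y h1 h2 h3 h4 h5 h6
    rw [← sub_eq_zero]
    refine h5 _ fun w => ?_
    obtain ⟨b, hb1, hb2, hb3⟩ := h2 w
    have h7 := h3 b
    rw [h1, h4, hb1, hb2, hb3, ← h6] at h7
    rw [← edMap_apply, map_sub, sub_apply, edMap_apply, edMap_apply]
    linarith
  · filter_upwards [hed, hsurj', hθ.eventually_nondeg] with y h1 h2 h3 a ha
    -- The vector with `dp = 0`, `dq = 1`, `dY = 0` satisfies the equation that defines `a`, so it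
    -- is `a` by nondegeneracy.
    obtain ⟨c, hc1, hc2, hc3⟩ := h2 1 0
    have hac : a = c := by
      rw [← sub_eq_zero]
      refine h3 _ fun b => ?_
      rw [← edMap_apply, map_sub, sub_apply, edMap_apply, edMap_apply, ha, h1, hc1, hc2, hc3,
        ← edMap_apply, map_zero, zero_apply]
      ring
    rw [hac]
    exact ⟨hc2, hc3⟩

end Reduction

/-! ### The homogeneous Darboux theorem -/

section Darboux

/-- In dimension greater than 2 the kernel of `lam` contains a vector outside the line of `u`; a
functional nonzero there and zero at `u` is not a multiple of `lam`. It serves as the linear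
function `p` of a reduction step. -/
theorem exists_functional_of_finrank {F : Type*} [NormedAddCommGroup F] [NormedSpace ℝ F]
    [FiniteDimensional ℝ F] (lam : F →L[ℝ] ℝ) (u : F) (h : 2 < Module.finrank ℝ F) :
    ∃ p : F →L[ℝ] ℝ, p u = 0 ∧ ∀ c : ℝ, p ≠ c • lam := by
  have h1 : ¬ LinearMap.ker lam.toLinearMap ≤ Submodule.span ℝ {u} := by
    intro hle
    have h2 := Submodule.finrank_mono hle
    have h3 := LinearMap.finrank_range_add_finrank_ker lam.toLinearMap
    have h4 := Submodule.finrank_le (LinearMap.range lam.toLinearMap)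
    have h5 := finrank_span_le_card (R := ℝ) ({u} : Set F)
    rw [Module.finrank_self] at h4
    simp at h5
    omega
  obtain ⟨w, hw, hw'⟩ := SetLike.not_le_iff_exists.1 h1
  obtain ⟨k, hk, hk'⟩ := Submodule.exists_le_ker_of_notMem hw'
  refine ⟨LinearMap.toContinuousLinearMap k, hk' (Submodule.mem_span_singleton_self u), ?_⟩
  intro c hc
  have h6 := congrArg (fun L : F →L[ℝ] ℝ => L w) hc
  have h7 : lam w = 0 := hw
  simp [h7, hk] at h6

/-- A Liouville germ in dimension two. -/
theorem LiouvilleGerm.exists_coordinates_of_finrank_eq_two {F : Type*} [NormedAddCommGroup F]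
    [NormedSpace ℝ F] [FiniteDimensional ℝ F] (hF : Module.finrank ℝ F = 2)
    {θ : F → F →L[ℝ] ℝ} {u : F} (hθ : LiouvilleGerm θ u) (hu : u ≠ 0) :
    ∃ x ξ : F → ℝ, EvSmooth x u ∧ EvSmooth ξ u ∧ ξ u = 1 ∧
      ∀ᶠ y in 𝓝 u, ∀ b, θ y b = ξ y * fderiv ℝ x y b := by
  have hθy : ∀ᶠ y in 𝓝 u, θ y y = 0 := by
    filter_upwards [hθ.euler] with y hy
    rw [← hy, ed_self]
  obtain ⟨w, hw⟩ : ∃ w, θ u w = 1 := by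
    obtain ⟨w, hw⟩ := DFunLike.ne_iff.1 (hθ.form_ne_zero hu)
    rw [zero_apply] at hw
    exact ⟨(θ u w)⁻¹ • w, by simp [hw]⟩
  have hli : LinearIndependent ℝ ![u, w] := by
    rw [LinearIndependent.pair_iff]
    intro s t hst
    have h1 := congrArg (θ u) hst
    simp only [map_add, map_smul, hθy.self_of_nhds, hw, smul_eq_mul, mul_zero, zero_add, mul_one,
      map_zero] at h1
    subst h1
    rw [zero_smul, add_zero] at hst
    exact ⟨(smul_eq_zero.1 hst).resolve_right hu, rfl⟩
  let B := basisOfLinearIndependentOfCardEqFinrank hli (by simp [hF])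
  have hB : ⇑B = ![u, w] := coe_basisOfLinearIndependentOfCardEqFinrank hli _
  let e₁ : F →L[ℝ] ℝ := LinearMap.toContinuousLinearMap (B.coord 0)
  let e₂ : F →L[ℝ] ℝ := LinearMap.toContinuousLinearMap (B.coord 1)
  have hdec : ∀ y, y = e₁ y • u + e₂ y • w := by
    intro y
    have h1 := B.sum_repr y
    rw [Fin.sum_univ_two, hB] at h1
    exact h1.symm
  have he₁u : e₁ u = 1 := by
    have : B.coord 0 (B 0) = 1 := by simp
    rw [hB] at this
    exact this
  have hne : ∀ᶠ y in 𝓝 u, e₁ y ≠ 0 :=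
    e₁.continuous.continuousAt.eventually_ne (by rw [he₁u]; exact one_ne_zero)
  have hs₁ : EvSmooth (fun y => e₁ y) u := EvSmooth.clm e₁
  have hs₂ : EvSmooth (fun y => e₂ y) u := EvSmooth.clm e₂
  -- In the plane, `θ(y) = 0` on the Euler field makes θ a multiple of `e₁ de₂ - e₂ de₁ = e₁²
  -- d(e₂/e₁)`; evaluation on `w` gives the factor `e₁ θ(w)`.
  refine ⟨fun y => e₂ y * (e₁ y)⁻¹, fun y => e₁ y * θ y w,
    hs₂.mul (hs₁.inv (by rw [he₁u]; exact one_ne_zero)),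
    hs₁.mul (hθ.smooth.clm_apply (EvSmooth.const w)), by simp [he₁u, hw], ?_⟩
  filter_upwards [hne, hθy] with y h1 h2 b
  have h3 : HasFDerivAt (fun y => e₂ y * (e₁ y)⁻¹) _ y :=
    e₂.hasFDerivAt.fun_mul ((hasDerivAt_inv h1).comp_hasFDerivAt y e₁.hasFDerivAt)
  rw [h3.fderiv]
  nth_rewrite 2 [hdec y] at h2
  nth_rewrite 1 [hdec b]
  simp only [map_add, map_smul, smul_eq_mul, add_apply, smul_apply] at h2 ⊢
  field_simp
  linear_combination (e₁ b) * h2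

/-- A Liouville germ is `∑ ξ_i dx_i` in suitable coordinates. -/
theorem LiouvilleGerm.exists_darboux (m : ℕ) :
    ∀ {F : Type u} [NormedAddCommGroup F] [NormedSpace ℝ F] [FiniteDimensional ℝ F],
      Module.finrank ℝ F = 2 * (m + 1) → ∀ {θ : F → F →L[ℝ] ℝ} {u : F}, LiouvilleGerm θ u → u ≠ 0 →
      ∃ x ξ : Fin (m + 1) → F → ℝ, (∀ i, EvSmooth (x i) u) ∧ (∀ i, EvSmooth (ξ i) u) ∧
        (∀ i, ξ i u = if (i : ℕ) = 0 then 1 else 0) ∧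
        ∀ᶠ y in 𝓝 u, ∀ b, θ y b = ∑ i, ξ i y * fderiv ℝ (x i) y b := by
  induction m with
  | zero =>
    intro F _ _ _ hF θ u hθ hu
    obtain ⟨x, ξ, hx, hξ, hξu, h⟩ := hθ.exists_coordinates_of_finrank_eq_two hF hu
    refine ⟨fun _ => x, fun _ => ξ, fun _ => hx, fun _ => hξ, fun i => by simp [hξu], ?_⟩
    filter_upwards [h] with y hy b
    simp [hy]
  | succ m ih =>
    intro F _ _ _ hF θ u hθ hu
    obtain ⟨p, hpu, hp⟩ := exists_functional_of_finrank (θ u) u (by omega)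
    obtain ⟨G₁, G, v, θ', q, Y, hfr, hv, hθ', hq, hY, hYu, heq, -⟩ :=
      hθ.exists_reduced_germ (p := fun y => p y) (EvSmooth.clm p)
        (Eventually.of_forall fun y => by simp) hpu (fun c => by
          rw [ContinuousLinearMap.fderiv]; exact hp c) hu
    obtain ⟨x, ξ, hx, hξ, hξu, hxξ⟩ := ih (by omega) hθ' hv
    have hYt : Tendsto Y (𝓝 u) (𝓝 v) := by
      have := hY.continuousAt
      rwa [ContinuousAt, hYu] at this
    -- The new pair `(q, p)` goes last: `p` vanishes at `u`, and the single coordinate `ξ` with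
    -- value 1 stays the one coming from dimension two, at index 0.
    refine ⟨Fin.snoc (α := fun _ => F → ℝ) (fun i y => x i (Y y)) q,
      Fin.snoc (α := fun _ => F → ℝ) (fun i y => ξ i (Y y)) fun y => p y, ?_, ?_, ?_, ?_⟩
    · intro i
      refine Fin.lastCases ?_ (fun i => ?_) i
      · simpa using hq
      · simp only [Fin.snoc_castSucc]
        exact EvSmooth.comp (by rw [hYu]; exact hx i) hY
    · intro i
      refine Fin.lastCases ?_ (fun i => ?_) i
      · simpa using EvSmooth.clm p
      · simp only [Fin.snoc_castSucc]
        exact EvSmooth.comp (by rw [hYu]; exact hξ i) hY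
    · intro i
      refine Fin.lastCases ?_ (fun i => ?_) i
      · simp [hpu]
      · simp only [Fin.snoc_castSucc, hYu, hξu, Fin.val_castSucc]
    · have hxd : ∀ᶠ z in 𝓝 v, ∀ i, DifferentiableAt ℝ (x i) z :=
        eventually_all.2 fun i => (hx i).eventually_differentiableAt
      filter_upwards [heq, hYt.eventually hxξ, hYt.eventually hxd, hY.eventually_differentiableAt]
        with y h1 h2 h3 h4 b
      rw [h1, h2, Fin.sum_univ_castSucc (n := m + 1), add_comm]
      simp only [Fin.snoc_castSucc, Fin.snoc_last]
      congr 1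
      refine Finset.sum_congr rfl fun i _ => ?_
      have h5 : HasFDerivAt (fun y => x i (Y y)) _ y :=
        (h3 i).hasFDerivAt.comp y h4.hasFDerivAt
      rw [h5.fderiv]
      rfl

/-- A Liouville germ in dimension `2m` is `∑ ξ_i dx_i` in suitable coordinates. -/
theorem LiouvilleGerm.exists_darboux' {F : Type u} [NormedAddCommGroup F] [NormedSpace ℝ F]
    [FiniteDimensional ℝ F] (m : ℕ) (hm : m ≠ 0) (hF : Module.finrank ℝ F = 2 * m)
    {θ : F → F →L[ℝ] ℝ} {u : F} (hθ : LiouvilleGerm θ u) (hu : u ≠ 0) :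
    ∃ x ξ : Fin m → F → ℝ, (∀ i, EvSmooth (x i) u) ∧ (∀ i, EvSmooth (ξ i) u) ∧
      (∀ i, ξ i u = if (i : ℕ) = 0 then 1 else 0) ∧
      ∀ᶠ y in 𝓝 u, ∀ b, θ y b = ∑ i, ξ i y * fderiv ℝ (x i) y b := by
  obtain ⟨k, rfl⟩ := Nat.exists_eq_succ_of_ne_zero hm
  exact LiouvilleGerm.exists_darboux k hF hθ hu

end Darboux

/-! ### Euler relations, local homogeneity and homogeneous extension -/

section Homogeneity

variable {E F G : Type*} [NormedAddCommGroup E] [NormedSpace ℝ E]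
  [NormedAddCommGroup F] [NormedSpace ℝ F] [NormedAddCommGroup G] [NormedSpace ℝ G]

theorem tendsto_smul_one (u : F) : Tendsto (fun p : ℝ × F => p.1 • p.2) (𝓝 (1, u)) (𝓝 u) :=
  (continuous_fst.smul continuous_snd).tendsto' _ _ (one_smul ℝ u)

omit [NormedSpace ℝ F] in
/-- Integration of a property of the differential along rays. -/
theorem eventually_smul_eq {u : F} {h : ℝ × F → G} {h' : ℝ × F → G}
    (hd : ∀ᶠ p in 𝓝 ((1 : ℝ), u), HasDerivAt (fun s => h (s, p.2)) 0 p.1)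
    (h1 : ∀ y, h (1, y) = h' (1, y)) (hconst : ∀ s y, h' (s, y) = h' (1, y)) :
    ∀ᶠ p in 𝓝 ((1 : ℝ), u), h p = h' p := by
  obtain ⟨r, hr, hr'⟩ := Metric.eventually_nhds_iff_ball.1 hd
  filter_upwards [Metric.ball_mem_nhds _ hr] with p hp
  rw [Metric.mem_ball, Prod.dist_eq, max_lt_iff] at hp
  have hder : ∀ s ∈ Metric.ball (1 : ℝ) r, HasDerivAt (fun s : ℝ => h (s, p.2)) 0 s := by
    intro s hs
    refine hr' (s, p.2) ?_
    rw [Metric.mem_ball, Prod.dist_eq, max_lt_iff]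
    exact ⟨hs, hp.2⟩
  have := Metric.isOpen_ball.eqOn_of_deriv_eq (𝕜 := ℝ) (convex_ball (1 : ℝ) r).isPreconnected
    (f := fun s : ℝ => h (s, p.2)) (g := fun _ => h' (1, p.2))
    (fun s hs => (hder s hs).differentiableAt.differentiableWithinAt)
    (differentiableOn_const _) (fun s hs => by simp [(hder s hs).deriv])
    (Metric.mem_ball_self hr) (h1 _)
  have h2 := this (x := p.1) hp.1
  simp only at h2
  rw [← hconst p.1] at h2
  exact h2

theorem hasDerivAt_comp_smul {f : F → G} {s : ℝ} {y : F} (hf : DifferentiableAt ℝ f (s • y)) :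
    HasDerivAt (fun s : ℝ => f (s • y)) (fderiv ℝ f (s • y) y) s := by
  have h1 : HasDerivAt (fun s : ℝ => s • y) y s := by
    simpa using (hasDerivAt_id s).smul_const y
  exact hf.hasFDerivAt.comp_hasDerivAt s h1

/-- Functions which are constant along the Euler field are locally homogeneous of degree zero. -/
theorem eventually_smul_of_euler_zero {f : F → G} {u : F} (hf : EvSmooth f u)
    (he : ∀ᶠ y in 𝓝 u, fderiv ℝ f y y = 0) :
    ∀ᶠ p in 𝓝 ((1 : ℝ), u), f (p.1 • p.2) = f p.2 := by
  have hne : ∀ᶠ p in 𝓝 ((1 : ℝ), u), p.1 ≠ 0 := continuousAt_fst.eventually_ne one_ne_zero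
  refine eventually_smul_eq (h := fun p => f (p.1 • p.2)) (h' := fun p => f p.2) ?_
    (fun y => by simp) fun s y => rfl
  filter_upwards [(tendsto_smul_one u).eventually hf.eventually_differentiableAt,
    (tendsto_smul_one u).eventually he, hne] with p h1 h2 h3
  have h4 := hasDerivAt_comp_smul h1
  rw [map_smul, smul_eq_zero_iff_right h3] at h2
  rwa [h2] at h4

/-- The Euler relation of degree one implies local homogeneity of degree one. -/
theorem eventually_smul_of_euler_one {f : F → G} {u : F} (hf : EvSmooth f u)
    (he : ∀ᶠ y in 𝓝 u, fderiv ℝ f y y = f y) :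
    ∀ᶠ p in 𝓝 ((1 : ℝ), u), f (p.1 • p.2) = p.1 • f p.2 := by
  have hne : ∀ᶠ p in 𝓝 ((1 : ℝ), u), p.1 ≠ 0 := continuousAt_fst.eventually_ne one_ne_zero
  have := eventually_smul_eq (u := u) (h := fun p => p.1⁻¹ • f (p.1 • p.2))
    (h' := fun p => f p.2) ?_ (fun y => by simp) fun s y => rfl
  · filter_upwards [this, hne] with p h1 h2
    rw [← h1, smul_inv_smul₀ h2]
  · filter_upwards [(tendsto_smul_one u).eventually hf.eventually_differentiableAt,
      (tendsto_smul_one u).eventually he, hne] with p h1 h2 h3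
    have h4 := (hasDerivAt_inv h3).fun_smul (hasDerivAt_comp_smul h1)
    convert h4 using 1
    rw [← h2, map_smul]
    match_scalars
    field_simp
    ring

/-- Local homogeneity of degree one implies the Euler relation. -/
theorem euler_one_of_eventually_smul {f : F → G} {u : F} (hf : DifferentiableAt ℝ f u)
    (h : ∀ᶠ c in 𝓝 (1 : ℝ), f (c • u) = c • f u) : fderiv ℝ f u u = f u := by
  have h1 : HasDerivAt (fun s : ℝ => f (s • u)) (fderiv ℝ f ((1 : ℝ) • u) u) 1 :=
    hasDerivAt_comp_smul (by rwa [one_smul])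
  have h2 : HasDerivAt (fun s : ℝ => s • f u) (f u) 1 := by
    simpa using (hasDerivAt_id (1 : ℝ)).smul_const (f u)
  rw [one_smul] at h1
  exact h1.unique (h2.congr_of_eventuallyEq h)

omit [NormedSpace ℝ F] in
theorem eventually_slice_of_prod {P : ℝ × F → Prop} {u : F} (h : ∀ᶠ p in 𝓝 ((1 : ℝ), u), P p) :
    ∀ᶠ y in 𝓝 u, ∀ᶠ c in 𝓝 (1 : ℝ), P (c, y) := by
  have ht : Tendsto (fun y : F => ((1 : ℝ), y)) (𝓝 u) (𝓝 (1, u)) :=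
    (Continuous.prodMk continuous_const continuous_id).tendsto' _ _ rfl
  filter_upwards [ht.eventually (eventually_eventually_nhds.2 h)] with y hy
  have ht' : Tendsto (fun c : ℝ => (c, y)) (𝓝 1) (𝓝 (1, y)) :=
    (Continuous.prodMk continuous_id continuous_const).tendsto' _ _ rfl
  exact ht'.eventually hy

/-- The differential of a locally homogeneous map of degree one is homogeneous of degree zero. -/
theorem eventually_fderiv_smul {f : F → G} {u : F}
    (h : ∀ᶠ p in 𝓝 ((1 : ℝ), u), f (p.1 • p.2) = p.1 • f p.2) :
    ∀ᶠ p in 𝓝 ((1 : ℝ), u), fderiv ℝ f (p.1 • p.2) = fderiv ℝ f p.2 := by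
  have hne : ∀ᶠ p in 𝓝 ((1 : ℝ), u), p.1 ≠ 0 := continuousAt_fst.eventually_ne one_ne_zero
  filter_upwards [eventually_eventually_nhds.2 h, hne] with p h1 h2
  have ht : Tendsto (fun y : F => (p.1, y)) (𝓝 p.2) (𝓝 p) :=
    (Continuous.prodMk continuous_const continuous_id).tendsto' _ _ rfl
  have h3 : (fun y => f (p.1 • y)) =ᶠ[𝓝 p.2] fun y => p.1 • f y := ht.eventually h1
  have h4 := h3.fderiv_eq (𝕜 := ℝ)
  rw [show (fun y => p.1 • f y) = p.1 • f from rfl, fderiv_const_smul_field,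
    fderiv_comp_smul] at h4
  exact smul_right_injective (F →L[ℝ] G) h2 h4

/-- The extension of `f`, homogeneous of degree one, from the hyperplane `ℓ = 1`. -/
noncomputable def homExt (ℓ : F →L[ℝ] ℝ) (f : F → G) (y : F) : G := ℓ y • f ((ℓ y)⁻¹ • y)

variable {ℓ : F →L[ℝ] ℝ} {f : F → G} {u : F}

theorem homExt_apply_of_eq_one (h : ℓ u = 1) : homExt ℓ f u = f u := by simp [homExt, h]

omit [NormedSpace ℝ E] in
theorem tendsto_normalize {H : E → ℝ} {e : E} (hH : ContinuousAt H e) (h : H e = 1) :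
    Tendsto (fun y => ((H y)⁻¹, y)) (𝓝 e) (𝓝 (1, e)) := by
  have h1 : Tendsto (fun y => (H y)⁻¹) (𝓝 e) (𝓝 1) := by
    have := hH.inv₀ (by rw [h]; exact one_ne_zero)
    rwa [ContinuousAt, Pi.inv_apply, h, inv_one] at this
  exact h1.prodMk_nhds tendsto_id

theorem tendsto_normalize_smul {H : E → ℝ} {e : E} (hH : ContinuousAt H e) (h : H e = 1) :
    Tendsto (fun y => (H y)⁻¹ • y) (𝓝 e) (𝓝 e) :=
  (tendsto_smul_one e).comp (tendsto_normalize hH h)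

theorem EvSmooth.normalize (h : ℓ u = 1) : EvSmooth (fun y => (ℓ y)⁻¹ • y) u :=
  ((EvSmooth.clm ℓ).inv (by rw [h]; exact one_ne_zero)).smul EvSmooth.id'

theorem EvSmooth.homExt (hf : EvSmooth f u) (h : ℓ u = 1) : EvSmooth (homExt ℓ f) u := by
  refine (EvSmooth.clm ℓ).smul (EvSmooth.comp (f := f) ?_ (EvSmooth.normalize h))
  simpa [h] using hf

theorem fderiv_homExt {y : F} (hf : DifferentiableAt ℝ f ((ℓ y)⁻¹ • y)) (h : ℓ y ≠ 0) (v : F) :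
    fderiv ℝ (homExt ℓ f) y v = ℓ v • f ((ℓ y)⁻¹ • y) +
      fderiv ℝ f ((ℓ y)⁻¹ • y) (v - ℓ v • (ℓ y)⁻¹ • y) := by
  have h1 : HasFDerivAt (fun y => (ℓ y)⁻¹ • y) _ y :=
    ((hasDerivAt_inv h).comp_hasFDerivAt y ℓ.hasFDerivAt).fun_smul (hasFDerivAt_id y)
  have h2 : HasFDerivAt (homExt ℓ f) _ y :=
    ℓ.hasFDerivAt.fun_smul (HasFDerivAt.comp (g := f) y hf.hasFDerivAt h1)
  rw [h2.fderiv]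
  simp only [add_apply, smul_apply, ContinuousLinearMap.comp_apply,
    ContinuousLinearMap.smulRight_apply, ContinuousLinearMap.id_apply, Function.comp_apply,
    map_sub, map_smul, map_add, smul_eq_mul]
  match_scalars <;> field_simp

theorem euler_homExt (hf : EvSmooth f u) (h : ℓ u = 1) :
    ∀ᶠ y in 𝓝 u, fderiv ℝ (homExt ℓ f) y y = homExt ℓ f y := by
  have hne : ∀ᶠ y in 𝓝 u, ℓ y ≠ 0 :=
    ℓ.continuous.continuousAt.eventually_ne (by rw [h]; exact one_ne_zero)
  filter_upwards [hne, (tendsto_normalize_smul ℓ.continuous.continuousAt h).eventually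
    hf.eventually_differentiableAt] with y h1 h2
  rw [fderiv_homExt h2 h1, smul_inv_smul₀ h1, sub_self, map_zero, add_zero]
  rfl

/-- Replacing `f` by its homogeneous extension changes its differential at `u` only through the
value and the radial derivative there. A function vanishing at `u` along with its radial derivative
can thus be made homogeneous without altering its differential at `u`. -/
theorem fderiv_homExt_of_eq_zero (hf : EvSmooth f u) (h : ℓ u = 1) (h0 : f u = 0)
    (h1 : fderiv ℝ f u u = 0) : fderiv ℝ (homExt ℓ f) u = fderiv ℝ f u := by
  ext v
  rw [fderiv_homExt (by simpa [h] using hf.differentiableAt) (by rw [h]; exact one_ne_zero)]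
  simp [h, h0, h1]

theorem exists_functional_eq_one [FiniteDimensional ℝ F] {u : F} (hu : u ≠ 0) :
    ∃ ℓ : F →L[ℝ] ℝ, ℓ u = 1 := SeparatingDual.exists_eq_one hu

/-- Homogeneous extension preserves vanishing on the image of a homogeneous set. -/
theorem eventually_homExt_comp_eq_zero {S : E → Prop} {P : E → F} {e : E} {f : F → G}
    (hP : ContinuousAt P e) (hPh : ∀ᶠ p in 𝓝 ((1 : ℝ), e), P (p.1 • p.2) = p.1 • P p.2)
    (hS : ∀ᶠ p in 𝓝 ((1 : ℝ), e), S p.2 → S (p.1 • p.2)) (hℓ : ℓ (P e) = 1)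
    (hf : ∀ᶠ y in 𝓝 e, S y → f (P y) = 0) :
    ∀ᶠ y in 𝓝 e, S y → homExt ℓ f (P y) = 0 := by
  have hc : ContinuousAt (fun y => ℓ (P y)) e := ℓ.continuous.continuousAt.comp hP
  filter_upwards [(tendsto_normalize hc hℓ).eventually hPh,
    (tendsto_normalize hc hℓ).eventually hS,
    (tendsto_normalize_smul hc hℓ).eventually hf] with y h1 h2 h3 hy
  rw [homExt, ← h1, h3 (h2 hy), smul_zero]

/-- Homogeneous extension preserves vanishing of the differential on the image of a homogeneous
set. -/
theorem eventually_fderiv_homExt_comp_eq_zero {S : E → Prop} {P : E → F} {e : E} {f : F → G}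
    (hP : EvSmooth P e) (hPh : ∀ᶠ p in 𝓝 ((1 : ℝ), e), P (p.1 • p.2) = p.1 • P p.2)
    (hS : ∀ᶠ p in 𝓝 ((1 : ℝ), e), S p.2 → S (p.1 • p.2)) (hℓ : ℓ (P e) = 1)
    (hfs : EvSmooth f (P e))
    (hf : ∀ᶠ y in 𝓝 e, S y → f (P y) = 0 ∧ ∀ v, fderiv ℝ f (P y) (fderiv ℝ P y v) = 0) :
    ∀ᶠ y in 𝓝 e, S y → ∀ v, fderiv ℝ (homExt ℓ f) (P y) (fderiv ℝ P y v) = 0 := by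
  have hc : ContinuousAt (fun y => ℓ (P y)) e := ℓ.continuous.continuousAt.comp hP.continuousAt
  have ht := tendsto_normalize hc hℓ
  have ht' := tendsto_normalize_smul hc hℓ
  have heuler : ∀ᶠ y in 𝓝 e, fderiv ℝ P y y = P y := by
    filter_upwards [hP.eventually_differentiableAt, eventually_slice_of_prod hPh] with y h1 h2
    exact euler_one_of_eventually_smul h1 h2
  filter_upwards [ht.eventually hPh, ht.eventually (eventually_fderiv_smul hPh), ht.eventually hS,
    ht'.eventually hf, ht'.eventually (hP.continuousAt.eventually hfs.eventually_differentiableAt),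
    hc.eventually_ne (by rw [hℓ]; exact one_ne_zero), ht'.eventually heuler]
    with y h1 h2 h3 h4 h5 h6 h7 hy v
  obtain ⟨h8, h9⟩ := h4 (h3 hy)
  rw [h1] at h5 h7 h8 h9
  rw [fderiv_homExt h5 h6, h8, smul_zero, zero_add, map_sub, map_smul]
  rw [h2] at h7 h9
  -- The radial correction in `fderiv_homExt` points along `P` of the normalized point, which by the
  -- Euler relation is the image under dP of that point itself, so it is killed too.
  have h10 := h9 ((ℓ (P y))⁻¹ • y)
  rw [h7] at h10
  rw [h9, h10]
  simp

end Homogeneity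

/-! ### Retractions onto immersed submanifolds -/

section Retraction

variable {E F C : Type*} [NormedAddCommGroup E] [NormedSpace ℝ E] [FiniteDimensional ℝ E]
  [NormedAddCommGroup F] [NormedSpace ℝ F] [FiniteDimensional ℝ F]
  [NormedAddCommGroup C] [NormedSpace ℝ C] [FiniteDimensional ℝ C]

/-- If `P` is immersive on the submanifold `{χ = 0}`, then there is a map `R` into it which inverts
`P` on it. -/
theorem exists_retraction {P : E → F} {χ : E → C} {e : E} (hP : EvSmooth P e) (hχ : EvSmooth χ e)
    (h0 : χ e = 0) (hinj : ∀ v, fderiv ℝ χ e v = 0 → fderiv ℝ P e v = 0 → v = 0)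
    (hsurj : Function.Surjective (fderiv ℝ χ e)) :
    ∃ R : F → E, EvSmooth R (P e) ∧ R (P e) = e ∧ (∀ᶠ z in 𝓝 (P e), χ (R z) = 0) ∧
      ∀ᶠ y in 𝓝 e, χ y = 0 → R (P y) = y ∧
        ∀ v, fderiv ℝ χ y v = 0 → fderiv ℝ R (P y) (fderiv ℝ P y v) = v := by
  have := FiniteDimensional.complete ℝ E
  let T : Submodule ℝ E := LinearMap.ker (fderiv ℝ χ e).toLinearMap
  obtain ⟨π₀, hπ₀⟩ := LinearMap.exists_leftInverse_of_injective
    ((fderiv ℝ P e).toLinearMap.comp T.subtype) (by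
      rw [LinearMap.ker_eq_bot']
      intro v hv
      exact Subtype.ext (hinj v v.2 hv))
  let π : F →L[ℝ] T := LinearMap.toContinuousLinearMap π₀
  have hπ : ∀ v : T, π (fderiv ℝ P e v) = v := fun v =>
    congrArg (fun L : T →ₗ[ℝ] T => L v) hπ₀
  -- With `π` a left inverse of dP on the tangent space `T` of `{χ = 0}`, the map `(π ∘ P, χ)` is a
  -- local diffeomorphism. Its inverse at `(π z, 0)` depends on `z` only and lies on `{χ = 0}`.
  let N : E → T × C := fun y => (π (P y), χ y)
  have hN : EvSmooth N e := (EvSmooth.comp (EvSmooth.clm π) hP).prodMk hχ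
  have hN' : ∀ᶠ y in 𝓝 e, fderiv ℝ N y = (π.comp (fderiv ℝ P y)).prod (fderiv ℝ χ y) := by
    filter_upwards [hP.eventually_differentiableAt, hχ.eventually_differentiableAt] with y h1 h2
    exact ((π.hasFDerivAt.comp y h1.hasFDerivAt).prodMk h2.hasFDerivAt).fderiv
  have hNinj : Function.Injective (fderiv ℝ N e).toLinearMap := by
    rw [← LinearMap.ker_eq_bot, LinearMap.ker_eq_bot']
    intro v hv
    have hv' : fderiv ℝ N e v = 0 := hv
    rw [hN'.self_of_nhds] at hv'
    have h1 : π (fderiv ℝ P e v) = 0 := congrArg Prod.fst hv'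
    have h2 : fderiv ℝ χ e v = 0 := congrArg Prod.snd hv'
    have h3 := hπ ⟨v, h2⟩
    rw [h1] at h3
    exact (congrArg Subtype.val h3).symm
  have hfr : Module.finrank ℝ E = Module.finrank ℝ (T × C) := by
    have h1 := LinearMap.finrank_range_add_finrank_ker (fderiv ℝ χ e).toLinearMap
    rw [LinearMap.range_eq_top.2 hsurj, finrank_top] at h1
    rw [Module.finrank_prod]
    change _ + Module.finrank ℝ T = _ at h1
    omega
  let A : E ≃L[ℝ] (T × C) :=
    (LinearMap.linearEquivOfInjective _ hNinj hfr).toContinuousLinearEquiv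
  have hA : HasFDerivAt N (A : E →L[ℝ] T × C) e := hN.differentiableAt.hasFDerivAt
  obtain ⟨M, hM, hMe, hMl, hMr⟩ := hN.exists_local_inverse A hA
  have hNe : N e = (π (P e), 0) := by simp [N, h0]
  rw [hNe] at hM hMe hMr
  have hι : EvSmooth (fun z : F => ((π z, 0) : T × C)) (P e) :=
    (EvSmooth.clm π).prodMk (EvSmooth.const 0)
  have hR : EvSmooth (fun z : F => M (π z, 0)) (P e) := EvSmooth.comp hM hι
  refine ⟨fun z => M (π z, 0), hR, hMe, ?_, ?_⟩
  · filter_upwards [hι.continuousAt.eventually hMr] with z hz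
    exact congrArg Prod.snd hz
  · have hNt : Tendsto N (𝓝 e) (𝓝 (π (P e), 0)) := by
      have := hN.continuousAt
      rwa [ContinuousAt, hNe] at this
    filter_upwards [eventually_eventually_nhds.2 hMl, hN', hN.eventually_differentiableAt,
      hNt.eventually hM.eventually_differentiableAt,
      hP.continuousAt.eventually hR.eventually_differentiableAt] with y h1 h2 h3 h4 h5 hy
    have hNy : N y = (π (P y), 0) := by simp [N, hy]
    refine ⟨by rw [← hNy]; exact h1.self_of_nhds, fun v hv => ?_⟩
    have h6 : HasFDerivAt (fun y => M (N y)) _ y := h4.hasFDerivAt.comp y h3.hasFDerivAt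
    have h7 : HasFDerivAt (fun y => M (N y)) (ContinuousLinearMap.id ℝ E) y :=
      (hasFDerivAt_id y).congr_of_eventuallyEq h1
    have h8 := congrArg (fun L : E →L[ℝ] E => L v) (h6.unique h7)
    simp only [ContinuousLinearMap.comp_apply, ContinuousLinearMap.id_apply, h2,
      ContinuousLinearMap.prod_apply, hv, hNy] at h8
    rw [hNy] at h4
    have h9 : HasFDerivAt (fun z : F => M (π z, 0)) _ (P y) :=
      HasFDerivAt.comp (g := M) (f := fun z : F => ((π z, 0) : T × C)) (P y) h4.hasFDerivAt
        (π.hasFDerivAt.prodMk (hasFDerivAt_const (0 : C) (P y)))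
    rw [h9.fderiv]
    exact h8

end Retraction

/-! ### Consequences of the Darboux form -/

section DarbouxCoordinates

variable {F : Type*} [NormedAddCommGroup F] [NormedSpace ℝ F] {n : ℕ}
  {θ : F → F →L[ℝ] ℝ} {u : F} {x ξ : Fin n → F → ℝ}

theorem eventually_ed_eq_sum (hx : ∀ i, EvSmooth (x i) u) (hξ : ∀ i, EvSmooth (ξ i) u)
    (h : ∀ᶠ y in 𝓝 u, ∀ b, θ y b = ∑ i, ξ i y * fderiv ℝ (x i) y b) :
    ∀ᶠ y in 𝓝 u, ∀ a b, ed θ y a b = ∑ i, (fderiv ℝ (ξ i) y a * fderiv ℝ (x i) y b -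
      fderiv ℝ (ξ i) y b * fderiv ℝ (x i) y a) := by
  filter_upwards [eventually_eventually_nhds.2 h, eventually_all.2 fun i => (hx i).eventually,
    eventually_all.2 fun i => (hξ i).eventually] with y h1 h2 h3 a b
  have h4 : θ =ᶠ[𝓝 y] fun y => ∑ i, ξ i y • fderiv ℝ (x i) y := by
    filter_upwards [h1] with z hz
    ext b
    simp [hz b]
  rw [h4.ed_eq]
  have h5 : HasFDerivAt (fun y => ∑ i, ξ i y • fderiv ℝ (x i) y) _ y :=
    HasFDerivAt.fun_sum fun i _ => (h3 i).differentiableAt.hasFDerivAt.fun_smul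
      (h2 i).fderiv.differentiableAt.hasFDerivAt
  rw [ed, h5.fderiv, sum_apply, sum_apply,
    sum_apply, sum_apply, ← Finset.sum_sub_distrib]
  refine Finset.sum_congr rfl fun i _ => ?_
  have hs := ((h2 i).contDiffAt.isSymmSndFDerivAt (by
    rw [minSmoothness_of_isRCLikeNormedField]
    exact WithTop.coe_le_coe.2 le_top)).eq a b
  simp only [add_apply, smul_apply, smul_eq_mul, ContinuousLinearMap.smulRight_apply, hs]
  ring

variable [FiniteDimensional ℝ F]

theorem eventually_darboux_surjective (hF : Module.finrank ℝ F = 2 * n) (hθ : LiouvilleGerm θ u)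
    (hx : ∀ i, EvSmooth (x i) u) (hξ : ∀ i, EvSmooth (ξ i) u)
    (h : ∀ᶠ y in 𝓝 u, ∀ b, θ y b = ∑ i, ξ i y * fderiv ℝ (x i) y b) :
    ∀ᶠ y in 𝓝 u, ∀ s t : Fin n → ℝ, ∃ b, ∀ i, fderiv ℝ (x i) y b = s i ∧
      fderiv ℝ (ξ i) y b = t i := by
  filter_upwards [eventually_ed_eq_sum hx hξ h, hθ.eventually_nondeg] with y h1 h2 s t
  let M : F →ₗ[ℝ] (Fin n → ℝ) × (Fin n → ℝ) :=
    ((ContinuousLinearMap.pi fun i => fderiv ℝ (x i) y).prod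
      (ContinuousLinearMap.pi fun i => fderiv ℝ (ξ i) y)).toLinearMap
  have hM : Function.Injective M := by
    rw [← LinearMap.ker_eq_bot, LinearMap.ker_eq_bot']
    intro a ha
    have ha1 : ∀ i, fderiv ℝ (x i) y a = 0 := fun i => congrFun (congrArg Prod.fst ha) i
    have ha2 : ∀ i, fderiv ℝ (ξ i) y a = 0 := fun i => congrFun (congrArg Prod.snd ha) i
    refine h2 a fun b => ?_
    rw [h1]
    simp [ha1, ha2]
  obtain ⟨b, hb⟩ := (LinearMap.injective_iff_surjective_of_finrank_eq_finrank (by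
    simp only [Module.finrank_prod, Module.finrank_fin_fun, hF]; omega)).1 hM (s, t)
  exact ⟨b, fun i => ⟨congrFun (congrArg Prod.fst hb) i, congrFun (congrArg Prod.snd hb) i⟩⟩

/-- Homogeneity of Darboux coordinates is automatic: pairing `dθ(y, ·) = θ` with the vectors dual to
the dξ_i gives the relations for x_i, and with those dual to the dx_i the relations for ξ_i. -/
theorem eventually_darboux_euler (hF : Module.finrank ℝ F = 2 * n) (hθ : LiouvilleGerm θ u)
    (hx : ∀ i, EvSmooth (x i) u) (hξ : ∀ i, EvSmooth (ξ i) u)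
    (h : ∀ᶠ y in 𝓝 u, ∀ b, θ y b = ∑ i, ξ i y * fderiv ℝ (x i) y b) :
    ∀ᶠ y in 𝓝 u, ∀ i, fderiv ℝ (x i) y y = 0 ∧ fderiv ℝ (ξ i) y y = ξ i y := by
  filter_upwards [eventually_ed_eq_sum hx hξ h, eventually_darboux_surjective hF hθ hx hξ h, h,
    hθ.euler] with y h1 h2 h3 h4 i
  obtain ⟨b, hb⟩ := h2 0 (Pi.single i 1)
  obtain ⟨c, hc⟩ := h2 (Pi.single i 1) 0
  have hb' := h4 b
  have hc' := h4 c
  rw [h1, h3] at hb' hc'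
  simp only [fun j => (hb j).1, fun j => (hb j).2, Pi.zero_apply, mul_zero, zero_sub,
    Pi.single_apply, ite_mul, one_mul, zero_mul, Finset.sum_neg_distrib, Finset.sum_const_zero,
    Finset.sum_ite_eq', Finset.mem_univ, if_true, neg_eq_zero] at hb'
  simp only [fun j => (hc j).1, fun j => (hc j).2, Pi.zero_apply, zero_mul, sub_zero,
    Pi.single_apply, mul_ite, mul_one, mul_zero,
    Finset.sum_ite_eq', Finset.mem_univ, if_true] at hc'
  exact ⟨hb', hc'⟩

end DarbouxCoordinates

/-! ### Critical germs of cross caps -/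

section CrossCap

variable {E F M C : Type*} [NormedAddCommGroup E] [NormedSpace ℝ E] [FiniteDimensional ℝ E]
  [NormedAddCommGroup F] [NormedSpace ℝ F] [FiniteDimensional ℝ F]
  [NormedAddCommGroup M] [NormedSpace ℝ M] [FiniteDimensional ℝ M]
  [NormedAddCommGroup C] [NormedSpace ℝ C] [FiniteDimensional ℝ C]

/-- The map `χ` cuts out the critical set of `g` near the critical point `e`, transversally to the
kernel of `dg`, and the conormal space of `g` at `e` is spanned by differentials of functions which
vanish to second order on the critical set when pulled back by `g`. -/
structure CriticalGerm (g : E → F) (χ : E → C) (e : E) : Prop where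
  smooth : EvSmooth χ e
  eq_zero : χ e = 0
  surjective : Function.Surjective (fderiv ℝ χ e)
  transverse : ∀ v, fderiv ℝ χ e v = 0 → fderiv ℝ g e v = 0 → v = 0
  eq_zero_iff : ∀ᶠ y in 𝓝 e, χ y = 0 ↔ ¬ Function.Injective (fderiv ℝ g y)
  exists_conormal : ∀ lam : F →L[ℝ] ℝ, (∀ v, lam (fderiv ℝ g e v) = 0) →
    ∃ p : F → ℝ, EvSmooth p (g e) ∧ fderiv ℝ p (g e) = lam ∧
      ∀ᶠ y in 𝓝 e, χ y = 0 → p (g y) = 0 ∧ ∀ v, fderiv ℝ p (g y) (fderiv ℝ g y v) = 0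

omit [FiniteDimensional ℝ F] in
theorem eventually_bijective_fderiv [CompleteSpace E] {φ : E → F} {e : E} (hφ : EvSmooth φ e)
    (h : Function.Bijective (fderiv ℝ φ e)) : ∀ᶠ y in 𝓝 e, Function.Bijective (fderiv ℝ φ y) := by
  let A : E ≃L[ℝ] F :=
    (LinearEquiv.ofBijective (fderiv ℝ φ e).toLinearMap h).toContinuousLinearEquiv
  have hA : fderiv ℝ φ e = (A : E →L[ℝ] F) := rfl
  have h2 : range ((↑) : (E ≃L[ℝ] F) → E →L[ℝ] F) ∈ 𝓝 (fderiv ℝ φ e) := by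
    rw [hA]; exact A.nhds
  filter_upwards [hφ.fderiv.continuousAt h2] with y ⟨B, hB⟩
  rw [← hB]
  exact B.bijective

-- In the normal form, a vector is in the kernel of dg exactly when it is `s ∂` with `∂` the last
-- direction and `s χ = 0`. So the critical set is `{χ = 0}`, and it is transverse to the kernel
-- because `∂χ ≠ 0`. For the conormal functions, `Γ` is compared with its value after the last
-- coordinate is replaced by that of the retraction onto the critical set: along the critical set
-- the two arguments agree, their differentials differ only in the last direction, and `∂Γ = χ`
-- vanishes.
omit [FiniteDimensional ℝ M] in
theorem CriticalGerm.of_normal_form {g : E → F} {e : E} (hg : EvSmooth g e)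
    {φ : E → M × ℝ} {ψ : F → M × C} {Γ χ : M × ℝ → C}
    (hφ : EvSmooth φ e) (hφb : Function.Bijective (fderiv ℝ φ e))
    (hψ : EvSmooth ψ (g e)) (hψb : Function.Bijective (fderiv ℝ ψ (g e)))
    (hΓ : EvSmooth Γ (φ e)) (hloc : ∀ᶠ y in 𝓝 e, ψ (g y) = ((φ y).1, Γ (φ y)))
    (hχ : ∀ᶠ p in 𝓝 (φ e), χ p = fderiv ℝ Γ p (0, 1))
    (h2 : fderiv ℝ χ (φ e) (0, 1) ≠ 0) (hs : Function.Surjective (fderiv ℝ χ (φ e)))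
    (hcrit : ¬ Function.Injective (fderiv ℝ g e)) :
    CriticalGerm g (fun y => χ (φ y)) e := by
  have := FiniteDimensional.complete ℝ E
  have := FiniteDimensional.complete ℝ F
  have hχs : EvSmooth χ (φ e) := (hΓ.fderiv.clm_apply (EvSmooth.const (0, 1))).congr hχ
  have hχφ : EvSmooth (fun y => χ (φ y)) e := EvSmooth.comp hχs hφ
  have hdχ : ∀ v, fderiv ℝ (fun y => χ (φ y)) e v = fderiv ℝ χ (φ e) (fderiv ℝ φ e v) := by
    intro v
    have : HasFDerivAt (fun y => χ (φ y)) _ e :=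
      hχs.differentiableAt.hasFDerivAt.comp e hφ.differentiableAt.hasFDerivAt
    rw [this.fderiv]
    rfl
  have hdψ : ∀ᶠ y in 𝓝 e, ∀ v, fderiv ℝ ψ (g y) (fderiv ℝ g y v) =
      ((fderiv ℝ φ y v).1, fderiv ℝ Γ (φ y) (fderiv ℝ φ y v)) := by
    filter_upwards [eventually_eventually_nhds.2 hloc, hg.eventually_differentiableAt,
      hφ.eventually_differentiableAt, hg.continuousAt.eventually hψ.eventually_differentiableAt,
      hφ.continuousAt.eventually hΓ.eventually_differentiableAt] with y h1 h2 h3 h4 h5 v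
    have h6 : HasFDerivAt (fun y => ψ (g y)) _ y := h4.hasFDerivAt.comp y h2.hasFDerivAt
    have h7 : HasFDerivAt (fun y => ((φ y).1, Γ (φ y))) _ y :=
      h3.hasFDerivAt.fst.prodMk (h5.hasFDerivAt.comp y h3.hasFDerivAt)
    exact congrArg (fun L : E →L[ℝ] M × C => L v) (h6.unique (h7.congr_of_eventuallyEq h1))
  have hφb' := eventually_bijective_fderiv hφ hφb
  have hψb' := hg.continuousAt.eventually (eventually_bijective_fderiv hψ hψb)
  have hχφ' := hφ.continuousAt.eventually hχ
  -- the kernel of `dg`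
  have hker : ∀ᶠ y in 𝓝 e, ∀ v, fderiv ℝ g y v = 0 ↔
      (fderiv ℝ φ y v).1 = 0 ∧ (fderiv ℝ φ y v).2 • χ (φ y) = 0 := by
    filter_upwards [hdψ, hψb', hχφ'] with y h1 h3 h4 v
    have h5 := h1 v
    have h6 : fderiv ℝ g y v = 0 ↔ fderiv ℝ ψ (g y) (fderiv ℝ g y v) = 0 :=
      ⟨fun h => by rw [h, map_zero], fun h => h3.1 (by rw [h, map_zero])⟩
    rw [h6, h5, Prod.mk_eq_zero]
    refine and_congr_right fun h7 => ?_
    have h8 : fderiv ℝ φ y v = (fderiv ℝ φ y v).2 • ((0 : M), (1 : ℝ)) := by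
      ext <;> simp [h7]
    rw [h8, map_smul, ← h4]
    simp
  have hiff : ∀ᶠ y in 𝓝 e, χ (φ y) = 0 ↔ ¬ Function.Injective (fderiv ℝ g y) := by
    filter_upwards [hker, hφb'] with y h1 h3
    constructor
    · intro h4 h5
      obtain ⟨v, hv⟩ := h3.2 (0, 1)
      have h6 : fderiv ℝ g y v = 0 := by rw [h1, hv, h4]; simp
      rw [h5 (h6.trans (map_zero _).symm), map_zero] at hv
      simpa using congrArg Prod.snd hv
    · intro h4
      by_contra h5
      refine h4 ((injective_iff_map_eq_zero _).2 fun v hv => ?_)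
      rw [h1] at hv
      refine h3.1 ?_
      rw [map_zero]
      exact Prod.ext hv.1 ((smul_eq_zero.1 hv.2).resolve_right h5)
  have h0 : χ (φ e) = 0 := hiff.self_of_nhds.2 hcrit
  have hsurj : Function.Surjective (fderiv ℝ (fun y => χ (φ y)) e) := by
    intro c
    obtain ⟨w, hw⟩ := hs c
    obtain ⟨v, hv⟩ := hφb.2 w
    exact ⟨v, by rw [hdχ, hv, hw]⟩
  have htrans : ∀ v, fderiv ℝ (fun y => χ (φ y)) e v = 0 → fderiv ℝ g e v = 0 → v = 0 := by
    intro v hv1 hv2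
    rw [hker.self_of_nhds] at hv2
    refine hφb.1 ?_
    rw [map_zero]
    have h8 : fderiv ℝ φ e v = (fderiv ℝ φ e v).2 • ((0 : M), (1 : ℝ)) := by
      ext <;> simp [hv2.1]
    rw [hdχ, h8, map_smul] at hv1
    exact Prod.ext hv2.1 ((smul_eq_zero.1 hv1).resolve_right h2)
  refine ⟨hχφ, h0, hsurj, htrans, hiff, ?_⟩
  intro lam hlam
  obtain ⟨R, hR, hRe, -, hRχ⟩ := exists_retraction hg hχφ h0 htrans hsurj
  let B : F ≃L[ℝ] M × C :=
    (LinearEquiv.ofBijective (fderiv ℝ ψ (g e)).toLinearMap hψb).toContinuousLinearEquiv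
  have hB : ∀ b, B b = fderiv ℝ ψ (g e) b := fun b => rfl
  -- At `e` the image of dg is, in the coordinates `ψ`, the graph of the derivative of `Γ` in the
  -- `M` directions. A conormal covector is thus determined by its restriction `μ` to the factor
  -- `C`.
  let μ : C →L[ℝ] ℝ := (lam.comp (B.symm : M × C →L[ℝ] F)).comp (ContinuousLinearMap.inr ℝ M C)
  have hμ : ∀ m c, lam (B.symm (m, c)) = μ (c - fderiv ℝ Γ (φ e) (m, 0)) := by
    intro m c
    obtain ⟨v, hv⟩ := hφb.2 (m, 0)
    have h3 := hdψ.self_of_nhds v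
    rw [hv, ← hB] at h3
    have h4 := hlam v
    rw [← B.symm_apply_apply (fderiv ℝ g e v), h3] at h4
    have h5 : ((m, c) : M × C) = (m, fderiv ℝ Γ (φ e) (m, 0)) +
        (0, c - fderiv ℝ Γ (φ e) (m, 0)) := by ext <;> simp
    rw [h5, map_add, map_add, h4, zero_add]
    rfl
  have hφR : EvSmooth φ (R (g e)) := by rwa [hRe]
  have hk : EvSmooth (fun y => (((ψ y).1, (φ (R y)).2) : M × ℝ)) (g e) :=
    hψ.fst.prodMk (EvSmooth.comp hφR hR).snd
  have hψg := hloc.self_of_nhds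
  have hke : (((ψ (g e)).1, (φ (R (g e))).2) : M × ℝ) = φ e := by rw [hψg, hRe]
  have hp : EvSmooth (fun y => μ ((ψ y).2 - Γ ((ψ y).1, (φ (R y)).2))) (g e) :=
    EvSmooth.comp (EvSmooth.clm μ) (hψ.snd.sub
      (EvSmooth.comp (f := Γ) (g := fun y => (((ψ y).1, (φ (R y)).2) : M × ℝ)) (by rwa [hke]) hk))
  refine ⟨fun y => μ ((ψ y).2 - Γ ((ψ y).1, (φ (R y)).2)), hp, ?_, ?_⟩
  · ext b
    have h3 : HasFDerivAt (fun y => (((ψ y).1, (φ (R y)).2) : M × ℝ)) _ (g e) :=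
      hψ.differentiableAt.hasFDerivAt.fst.prodMk
        (EvSmooth.comp hφR hR).differentiableAt.hasFDerivAt.snd
    have h4 : HasFDerivAt Γ (fderiv ℝ Γ (φ e)) ((ψ (g e)).1, (φ (R (g e))).2) := by
      rw [hke]; exact hΓ.differentiableAt.hasFDerivAt
    have h5 : HasFDerivAt (fun y => μ ((ψ y).2 - Γ ((ψ y).1, (φ (R y)).2))) _ (g e) :=
      μ.hasFDerivAt.comp (g e) (hψ.differentiableAt.hasFDerivAt.snd.fun_sub
        (HasFDerivAt.comp (g := Γ) (g e) h4 h3))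
    rw [h5.fderiv]
    have h6 : ∀ (m : M) (s : ℝ), fderiv ℝ Γ (φ e) (m, s) = fderiv ℝ Γ (φ e) (m, 0) := by
      intro m s
      have h7 : ((m, s) : M × ℝ) = (m, 0) + s • ((0 : M), (1 : ℝ)) := by ext <;> simp
      rw [h7, map_add, map_smul, ← hχ.self_of_nhds, h0, smul_zero, add_zero]
    have h8 := hμ (fderiv ℝ ψ (g e) b).1 (fderiv ℝ ψ (g e) b).2
    rw [Prod.mk.eta, ← hB, B.symm_apply_apply, hB] at h8
    rw [h8]
    simp only [ContinuousLinearMap.comp_apply, sub_apply, ContinuousLinearMap.prod_apply,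
      ContinuousLinearMap.coe_fst', ContinuousLinearMap.coe_snd']
    rw [h6]
  · have hgφ : ∀ᶠ y in 𝓝 e, DifferentiableAt ℝ (fun y => φ (R (g y))) y :=
      (EvSmooth.comp (f := fun y => φ (R y)) (EvSmooth.comp hφR hR) hg).eventually_differentiableAt
    filter_upwards [hRχ, eventually_eventually_nhds.2 hloc, hg.eventually_differentiableAt,
      hφ.eventually_differentiableAt, hφ.continuousAt.eventually hΓ.eventually_differentiableAt,
      hg.continuousAt.eventually hp.eventually_differentiableAt, hgφ, hχφ']
      with y h1 h3 h4 h5 h6 h7 h8 h9 hy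
    obtain ⟨h10, -⟩ := h1 hy
    have h11 := h3.self_of_nhds
    refine ⟨by simp [h11, h10], fun v => ?_⟩
    have h12 : HasFDerivAt (fun y => μ ((ψ (g y)).2 - Γ ((ψ (g y)).1, (φ (R (g y))).2))) _ y :=
      HasFDerivAt.comp (g := fun y => μ ((ψ y).2 - Γ ((ψ y).1, (φ (R y)).2))) y
        h7.hasFDerivAt h4.hasFDerivAt
    have h13 : HasFDerivAt Γ (fderiv ℝ Γ (φ y)) ((φ y).1, (φ (R (g y))).2) := by
      rw [h10]; exact h6.hasFDerivAt
    have h14 : HasFDerivAt (fun y => μ (Γ (φ y) - Γ ((φ y).1, (φ (R (g y))).2))) _ y :=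
      μ.hasFDerivAt.comp y ((h6.hasFDerivAt.comp y h5.hasFDerivAt).fun_sub
        (HasFDerivAt.comp (g := Γ) (f := fun y => (((φ y).1, (φ (R (g y))).2) : M × ℝ)) y h13
          (h5.hasFDerivAt.fst.prodMk h8.hasFDerivAt.snd)))
    have h15 := congrArg (fun L : E →L[ℝ] ℝ => L v) (h12.unique
      (h14.congr_of_eventuallyEq (h3.mono fun z hz => by simp only [hz])))
    simp only [ContinuousLinearMap.comp_apply, sub_apply] at h15
    rw [h15, ← map_sub]
    -- The first components cancel, and on the remaining multiple of the last direction the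
    -- derivative of `Γ` is `χ (φ y) = 0`.
    have h16 : fderiv ℝ φ y v - ((((ContinuousLinearMap.fst ℝ M ℝ).comp (fderiv ℝ φ y)).prod
        ((ContinuousLinearMap.snd ℝ M ℝ).comp (fderiv ℝ (fun y => φ (R (g y))) y))) v) =
        ((fderiv ℝ φ y v).2 - (fderiv ℝ (fun y => φ (R (g y))) y v).2) • ((0 : M), (1 : ℝ)) := by
      ext <;> simp
    rw [h16, map_smul, ← h9, hy, smul_zero, map_zero]

end CrossCap

/-! ### Functions vanishing to second order on the critical set -/

section Conormal

variable {E F C : Type*} [NormedAddCommGroup E] [NormedSpace ℝ E] [FiniteDimensional ℝ E]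
  [NormedAddCommGroup F] [NormedSpace ℝ F] [FiniteDimensional ℝ F]
  [NormedAddCommGroup C] [NormedSpace ℝ C] [FiniteDimensional ℝ C]
  {g : E → F} {e : E} {χ : E → C}

-- The critical set is defined through dg, which is homogeneous of degree zero. The function `χ`
-- itself need not be homogeneous; only its zero set is conic.
omit [FiniteDimensional ℝ E] [FiniteDimensional ℝ F] [FiniteDimensional ℝ C] in
theorem CriticalGerm.eventually_smul (hχ : CriticalGerm g χ e)
    (hgh : ∀ᶠ p in 𝓝 ((1 : ℝ), e), g (p.1 • p.2) = p.1 • g p.2) :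
    ∀ᶠ p in 𝓝 ((1 : ℝ), e), χ p.2 = 0 → χ (p.1 • p.2) = 0 := by
  filter_upwards [(tendsto_smul_one e).eventually hχ.eq_zero_iff,
    continuousAt_snd.eventually hχ.eq_zero_iff, eventually_fderiv_smul hgh] with p h1 h2 h3
  rw [h1, h2, h3]
  exact id

omit [FiniteDimensional ℝ E] [FiniteDimensional ℝ F] [FiniteDimensional ℝ C] in
theorem CriticalGerm.fderiv_self (hχ : CriticalGerm g χ e)
    (hgh : ∀ᶠ p in 𝓝 ((1 : ℝ), e), g (p.1 • p.2) = p.1 • g p.2) : fderiv ℝ χ e e = 0 := by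
  have h1 := (eventually_slice_of_prod (hχ.eventually_smul hgh)).self_of_nhds
  have h2 := hasDerivAt_comp_smul (f := χ) (s := 1) (y := e)
    (by rw [one_smul]; exact hχ.smooth.differentiableAt)
  rw [one_smul] at h2
  refine h2.unique ((hasDerivAt_const (1 : ℝ) (0 : C)).congr_of_eventuallyEq ?_)
  filter_upwards [h1] with c hc using hc hχ.eq_zero

omit [FiniteDimensional ℝ E] [FiniteDimensional ℝ F] in
theorem euler_of_homogeneous (hg : EvSmooth g e)
    (hgh : ∀ᶠ p in 𝓝 ((1 : ℝ), e), g (p.1 • p.2) = p.1 • g p.2) :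
    ∀ᶠ y in 𝓝 e, fderiv ℝ g y y = g y := by
  filter_upwards [hg.eventually_differentiableAt, eventually_slice_of_prod hgh] with y h1 h2
  exact euler_one_of_eventually_smul h1 h2

omit [FiniteDimensional ℝ F] in
/-- A function vanishing on the critical set of `g`, and killed by a field `X` tangent to the image
of `dg` and not tangent to the image of the critical set, is killed by the image of `dg`. -/
theorem CriticalGerm.eventually_conormal (hχ : CriticalGerm g χ e) (hg : EvSmooth g e)
    (hC : Module.finrank ℝ C = 2) {X : F → F} (hX : EvSmooth X (g e))
    (hXe : ∀ v, fderiv ℝ χ e v = 0 → fderiv ℝ g e v ≠ X (g e))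
    (hXg : ∀ᶠ y in 𝓝 e, χ y = 0 → ∃ k, fderiv ℝ g y k = X (g y)) {f : F → ℝ}
    (hf : EvSmooth f (g e)) (hfX : ∀ᶠ y in 𝓝 (g e), fderiv ℝ f y (X y) = 0)
    (hf0 : ∀ᶠ y in 𝓝 e, χ y = 0 → f (g y) = 0) :
    ∀ᶠ y in 𝓝 e, χ y = 0 → ∀ v, fderiv ℝ f (g y) (fderiv ℝ g y v) = 0 := by
  -- `(v, s) ↦ (dg v + s X, dχ v)` is injective exactly when dg is injective on `ker dχ` and `X` is
  -- outside its image. Written as one operator, this condition is visibly open.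
  let J : E → (E × ℝ) →L[ℝ] (F × C) := fun y =>
    (ContinuousLinearMap.inl ℝ F C).comp ((fderiv ℝ g y).comp (ContinuousLinearMap.fst ℝ E ℝ) +
      ContinuousLinearMap.smulRightL ℝ (E × ℝ) F (ContinuousLinearMap.snd ℝ E ℝ) (X (g y))) +
    (ContinuousLinearMap.inr ℝ F C).comp ((fderiv ℝ χ y).comp (ContinuousLinearMap.fst ℝ E ℝ))
  have hJs : EvSmooth J e := by
    have h1 : EvSmooth (fun y => X (g y)) e := EvSmooth.comp hX hg
    exact ((EvSmooth.const _).clm_comp ((hg.fderiv.clm_comp (EvSmooth.const _)).add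
      (EvSmooth.comp (EvSmooth.clm (ContinuousLinearMap.smulRightL ℝ (E × ℝ) F
        (ContinuousLinearMap.snd ℝ E ℝ))) h1))).add
      ((EvSmooth.const _).clm_comp (hχ.smooth.fderiv.clm_comp (EvSmooth.const _)))
  have hJ : ∀ y p, J y p = (fderiv ℝ g y p.1 + p.2 • X (g y), fderiv ℝ χ y p.1) := by
    intro y p
    ext <;> simp [J]
  have hJe : Function.Injective (J e) := by
    refine (injective_iff_map_eq_zero _).2 fun p hp => ?_
    rw [hJ, Prod.mk_eq_zero] at hp
    have h1 : p.2 = 0 := by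
      by_contra h
      refine hXe (-(p.2⁻¹) • p.1) (by rw [map_smul, hp.2, smul_zero]) ?_
      rw [map_smul, eq_neg_of_add_eq_zero_left hp.1, neg_smul, smul_neg, neg_neg,
        inv_smul_smul₀ h]
    rw [h1, zero_smul, add_zero] at hp
    exact Prod.ext (hχ.transverse _ hp.2 hp.1) h1
  have hJinj : ∀ᶠ y in 𝓝 e, Function.Injective (J y) :=
    hJs.continuousAt.eventually (ContinuousLinearMap.isOpen_injective.mem_nhds hJe)
  -- With `P` the identity, `R` is a retraction onto the critical set. Since `f ∘ g ∘ R` vanishes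
  -- identically, the differential of `f ∘ g` kills `ker dχ` at critical points.
  obtain ⟨R, hR, hRe, hRχ, hRy⟩ := exists_retraction (P := fun y : E => y) EvSmooth.id' hχ.smooth
    hχ.eq_zero (fun v _ hv => by simpa using hv) hχ.surjective
  have hRt : Tendsto R (𝓝 e) (𝓝 e) := by
    have := hR.continuousAt
    rwa [ContinuousAt, hRe] at this
  have hψ : EvSmooth (fun y => f (g y)) e := EvSmooth.comp hf hg
  have hψR : ∀ᶠ y in 𝓝 e, f (g (R y)) = 0 := by
    filter_upwards [hRt.eventually hf0, hRχ] with y h1 h2 using h1 h2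
  filter_upwards [hJinj, hRy, eventually_eventually_nhds.2 hψR, hR.eventually_differentiableAt,
    hψ.eventually_differentiableAt, hg.eventually_differentiableAt,
    hg.continuousAt.eventually hf.eventually_differentiableAt, hXg,
    hg.continuousAt.eventually hfX, hχ.eq_zero_iff] with y h1 h2 h3 h4 h5 h6 h7 h8 h9 h10 hy v
  obtain ⟨hRy, hRv⟩ := h2 hy
  have hd : ∀ v, fderiv ℝ (fun y => f (g y)) y v = fderiv ℝ f (g y) (fderiv ℝ g y v) := by
    intro v
    have : HasFDerivAt (fun y => f (g y)) _ y := h7.hasFDerivAt.comp y h6.hasFDerivAt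
    rw [this.fderiv]; rfl
  have hkerχ : ∀ v, fderiv ℝ χ y v = 0 → fderiv ℝ f (g y) (fderiv ℝ g y v) = 0 := by
    intro v hv
    have h11 : HasFDerivAt (fun y => f (g y)) (fderiv ℝ (fun y => f (g y)) y) (R y) := by
      rw [hRy]; exact h5.hasFDerivAt
    have h12 : HasFDerivAt (fun y => f (g (R y))) _ y :=
      HasFDerivAt.comp (g := fun y => f (g y)) y h11 h4.hasFDerivAt
    have h13 := congrArg (fun L : E →L[ℝ] ℝ => L v)
      (h12.unique ((hasFDerivAt_const (0 : ℝ) y).congr_of_eventuallyEq h3))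
    have h14 := hRv v hv
    simp only [fderiv_fun_id, ContinuousLinearMap.id_apply] at h14
    simp only [ContinuousLinearMap.comp_apply, h14, zero_apply] at h13
    rw [← hd, h13]
  obtain ⟨k, hk⟩ := h8 hy
  obtain ⟨z, hz, hz0⟩ : ∃ z, fderiv ℝ g y z = 0 ∧ z ≠ 0 := by
    by_contra! h
    exact h10.1 hy ((injective_iff_map_eq_zero _).2 h)
  -- Because `C` has dimension two, the kernel vector `z` of dg and the preimage `k` of `X` span a
  -- complement of `ker dχ`. The differential of `f ∘ g` vanishes on each of the three pieces.
  let L : (ℝ × ℝ) →ₗ[ℝ] C := (fderiv ℝ χ y).toLinearMap.comp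
    ((LinearMap.fst ℝ ℝ ℝ).smulRight z + (LinearMap.snd ℝ ℝ ℝ).smulRight k)
  have hL : ∀ c, L c = fderiv ℝ χ y (c.1 • z + c.2 • k) := fun c => rfl
  have hLinj : Function.Injective L := by
    refine (injective_iff_map_eq_zero _).2 fun c hc => ?_
    rw [hL] at hc
    have h11 : J y (c.1 • z + c.2 • k, -c.2) = 0 := by
      rw [hJ]
      simp only
      rw [hc, map_add, map_smul, map_smul, hz, hk, smul_zero, zero_add, neg_smul, add_neg_cancel]
      rfl
    have h12 := h1 (h11.trans (map_zero _).symm)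
    have h13 : c.2 = 0 := neg_eq_zero.1 (congrArg Prod.snd h12)
    have h14 : c.1 • z + c.2 • k = 0 := congrArg Prod.fst h12
    rw [h13, zero_smul, add_zero] at h14
    exact Prod.ext ((smul_eq_zero.1 h14).resolve_right hz0) h13
  obtain ⟨c, hc⟩ := (LinearMap.injective_iff_surjective_of_finrank_eq_finrank (by
    rw [hC]; simp)).1 hLinj (fderiv ℝ χ y v)
  have h15 := hkerχ (v - (c.1 • z + c.2 • k)) (by rw [map_sub, ← hL, hc, sub_self])
  rw [map_sub, map_add, map_smul, map_smul, hz, hk, map_sub, smul_zero, zero_add, map_smul, h9,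
    smul_zero, sub_zero] at h15
  exact h15

/-- A function homogeneous of degree one which vanishes on the image of `{χ = 0}` by a homogeneous
map `P` into a space of larger dimension than `{χ = 0}`, immersive on `{χ = 0}`. -/
theorem exists_homogeneous_defining_function {P : E → F} (hP : EvSmooth P e)
    (hχ : EvSmooth χ e) (hχ0 : χ e = 0) (hsurj : Function.Surjective (fderiv ℝ χ e))
    (hinj : ∀ v, fderiv ℝ χ e v = 0 → fderiv ℝ P e v = 0 → v = 0)
    (hPh : ∀ᶠ p in 𝓝 ((1 : ℝ), e), P (p.1 • p.2) = p.1 • P p.2)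
    (hχh : ∀ᶠ p in 𝓝 ((1 : ℝ), e), χ p.2 = 0 → χ (p.1 • p.2) = 0)
    (hχe : fderiv ℝ χ e e = 0)
    (hdim : Module.finrank ℝ E < Module.finrank ℝ F + Module.finrank ℝ C) (hPe : P e ≠ 0) :
    ∃ p : F → ℝ, EvSmooth p (P e) ∧ (∀ᶠ y in 𝓝 (P e), fderiv ℝ p y y = p y) ∧ p (P e) = 0 ∧
      fderiv ℝ p (P e) ≠ 0 ∧ (∀ v, fderiv ℝ χ e v = 0 → fderiv ℝ p (P e) (fderiv ℝ P e v) = 0) ∧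
      ∀ᶠ y in 𝓝 e, χ y = 0 → p (P y) = 0 := by
  obtain ⟨R, hR, hRe, hRχ, hRy⟩ := exists_retraction hP hχ hχ0 hinj hsurj
  have hPR : EvSmooth (fun z => P (R z)) (P e) := EvSmooth.comp (by rwa [hRe]) hR
  -- `D` vanishes on the image of `{χ = 0}`. Were its differential zero at `P e`, dP would map `ker
  -- dχ` onto `F`, contrary to the dimensions; hence some component `μ ∘ D` is a defining function.
  let D : F → F := fun z => z - P (R z)
  have hD : EvSmooth D (P e) := EvSmooth.id'.sub hPR
  have hdD : ∀ z, fderiv ℝ D (P e) z = z - fderiv ℝ P e (fderiv ℝ R (P e) z) := by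
    intro z
    have h1 : HasFDerivAt P (fderiv ℝ P e) (R (P e)) := by
      rw [hRe]; exact hP.differentiableAt.hasFDerivAt
    have h2 : HasFDerivAt D _ (P e) :=
      (hasFDerivAt_id (P e)).fun_sub (HasFDerivAt.comp (g := P) (P e) h1
        hR.differentiableAt.hasFDerivAt)
    rw [h2.fderiv]; rfl
  have hdχR : ∀ z, fderiv ℝ χ e (fderiv ℝ R (P e) z) = 0 := by
    intro z
    have h1 : HasFDerivAt χ (fderiv ℝ χ e) (R (P e)) := by
      rw [hRe]; exact hχ.differentiableAt.hasFDerivAt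
    have h2 : HasFDerivAt (fun z => χ (R z)) _ (P e) :=
      HasFDerivAt.comp (g := χ) (P e) h1 hR.differentiableAt.hasFDerivAt
    exact congrArg (fun L : F →L[ℝ] C => L z)
      (h2.unique ((hasFDerivAt_const (0 : C) (P e)).congr_of_eventuallyEq hRχ))
  obtain ⟨z₀, hz₀⟩ : ∃ z, fderiv ℝ D (P e) z ≠ 0 := by
    by_contra! h
    let T : Submodule ℝ E := LinearMap.ker (fderiv ℝ χ e).toLinearMap
    have h1 : Function.Surjective ((fderiv ℝ P e).toLinearMap.comp T.subtype) := by
      intro z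
      refine ⟨⟨fderiv ℝ R (P e) z, hdχR z⟩, ?_⟩
      have := h z
      rw [hdD, sub_eq_zero] at this
      exact this.symm
    have h2 := LinearMap.finrank_le_finrank_of_surjective h1
    have h3 := LinearMap.finrank_range_add_finrank_ker (fderiv ℝ χ e).toLinearMap
    rw [LinearMap.range_eq_top.2 hsurj, finrank_top] at h3
    change _ + Module.finrank ℝ T = _ at h3
    omega
  obtain ⟨μ, hμ⟩ := SeparatingDual.exists_ne_zero (R := ℝ) hz₀
  obtain ⟨ℓ, hℓ⟩ := exists_functional_eq_one hPe
  have hf : EvSmooth (fun z => μ (D z)) (P e) := EvSmooth.comp (EvSmooth.clm μ) hD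
  have hdf : ∀ z, fderiv ℝ (fun z => μ (D z)) (P e) z = μ (fderiv ℝ D (P e) z) := by
    intro z
    have : HasFDerivAt (fun z => μ (D z)) _ (P e) :=
      μ.hasFDerivAt.comp (P e) hD.differentiableAt.hasFDerivAt
    rw [this.fderiv]; rfl
  have hf0 : μ (D (P e)) = 0 := by simp [D, hRe]
  have hdfP : ∀ v, fderiv ℝ χ e v = 0 →
      fderiv ℝ (fun z => μ (D z)) (P e) (fderiv ℝ P e v) = 0 := by
    intro v hv
    rw [hdf, hdD, (hRy.self_of_nhds hχ0).2 v hv, sub_self, map_zero]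
  have hPee : fderiv ℝ P e e = P e := (euler_of_homogeneous hP hPh).self_of_nhds
  have hdfe : fderiv ℝ (fun z => μ (D z)) (P e) (P e) = 0 := by
    have := hdfP e hχe
    rwa [hPee] at this
  have hdp := fderiv_homExt_of_eq_zero hf hℓ hf0 hdfe
  refine ⟨homExt ℓ fun z => μ (D z), hf.homExt hℓ, euler_homExt hf hℓ, by
    rw [homExt_apply_of_eq_one hℓ, hf0], ?_, ?_, ?_⟩
  · rw [hdp]
    intro h
    refine hμ ?_
    rw [← hdf, h]; rfl
  · rw [hdp]; exact hdfP
  · refine eventually_homExt_comp_eq_zero (S := fun y => χ y = 0) hP.continuousAt hPh hχh hℓ ?_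
    filter_upwards [hRy] with y hy hy0
    simp [D, (hy hy0).1]

end Conormal

/-! ### Splitting the indices as n - 2 leading ones and the last two -/

section Indices

variable {n : ℕ} {α : Type*}

theorem eq_idxHead_or (hn : 3 ≤ n) (i : Fin n) :
    (∃ j, i = idxHead j) ∨ i = idxPen hn ∨ i = idxLast hn := by
  rcases lt_or_ge (i : ℕ) (n - 2) with h | h
  · exact Or.inl ⟨⟨i, h⟩, rfl⟩
  · rcases Nat.eq_or_lt_of_le h with h' | h'
    · exact Or.inr (Or.inl (Fin.ext h'.symm))
    · refine Or.inr (Or.inr (Fin.ext ?_))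
      have := i.2
      change (i : ℕ) = n - 1
      omega

theorem sum_idx {M : Type*} [AddCommMonoid M] (hn : 3 ≤ n) (f : Fin n → M) :
    ∑ i, f i = ∑ j, f (idxHead j) + f (idxPen hn) + f (idxLast hn) := by
  obtain ⟨k, rfl⟩ := Nat.exists_eq_add_of_le' hn
  rw [Fin.sum_univ_castSucc, Fin.sum_univ_castSucc]
  rfl

/-- The family with the given entries at the indices `1, …, n - 2`, at `n - 1` and at `n`. -/
def idxGlue (n : ℕ) (a : Fin (n - 2) → α) (b c : α) (i : Fin n) : α :=
  if h : (i : ℕ) < n - 2 then a ⟨i, h⟩ else if (i : ℕ) = n - 2 then b else c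

theorem idxGlue_head (a : Fin (n - 2) → α) (b c : α) (j : Fin (n - 2)) :
    idxGlue n a b c (idxHead j) = a j := dif_pos j.2

theorem idxGlue_pen (hn : 3 ≤ n) (a : Fin (n - 2) → α) (b c : α) :
    idxGlue n a b c (idxPen hn) = b := by
  simp [idxGlue, idxPen]

theorem idxGlue_last (hn : 3 ≤ n) (a : Fin (n - 2) → α) (b c : α) :
    idxGlue n a b c (idxLast hn) = c := by
  have h1 : ¬ n - 1 < n - 2 := by omega
  have h2 : n - 1 ≠ n - 2 := by omega
  simp [idxGlue, idxLast, h1, h2]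

end Indices

/-! ### Canonical coordinates adapted to the critical set -/

section Adapted

/-- A conormal covector kills `g e`, which is the image of `e` under dg. The function supplied by
the normal form therefore has zero radial derivative, and homogeneous extension keeps its
differential at `g e`. -/
theorem CriticalGerm.exists_homogeneous_conormal {E F C : Type*} [NormedAddCommGroup E]
    [NormedSpace ℝ E] [FiniteDimensional ℝ E] [NormedAddCommGroup F] [NormedSpace ℝ F]
    [FiniteDimensional ℝ F] [NormedAddCommGroup C] [NormedSpace ℝ C] [FiniteDimensional ℝ C]
    {g : E → F} {e : E} {χ : E → C}
    (hχ : CriticalGerm g χ e) (hg : EvSmooth g e)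
    (hgh : ∀ᶠ p in 𝓝 ((1 : ℝ), e), g (p.1 • p.2) = p.1 • g p.2)
    (hχh : ∀ᶠ p in 𝓝 ((1 : ℝ), e), χ p.2 = 0 → χ (p.1 • p.2) = 0) (hge : g e ≠ 0)
    (lam : F →L[ℝ] ℝ) (hlam : ∀ v, lam (fderiv ℝ g e v) = 0) :
    ∃ p : F → ℝ, EvSmooth p (g e) ∧ (∀ᶠ y in 𝓝 (g e), fderiv ℝ p y y = p y) ∧ p (g e) = 0 ∧
      fderiv ℝ p (g e) = lam ∧ ∀ᶠ y in 𝓝 e, χ y = 0 →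
        p (g y) = 0 ∧ ∀ v, fderiv ℝ p (g y) (fderiv ℝ g y v) = 0 := by
  obtain ⟨p, hp, hdp, hp0⟩ := hχ.exists_conormal lam hlam
  obtain ⟨ℓ, hℓ⟩ := exists_functional_eq_one hge
  have h0 : p (g e) = 0 := (hp0.self_of_nhds hχ.eq_zero).1
  have h1 : fderiv ℝ p (g e) (g e) = 0 := by
    rw [hdp, ← (euler_of_homogeneous hg hgh).self_of_nhds]
    exact hlam e
  refine ⟨homExt ℓ p, hp.homExt hℓ, euler_homExt hp hℓ, by rw [homExt_apply_of_eq_one hℓ, h0],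
    by rw [fderiv_homExt_of_eq_zero hp hℓ h0 h1, hdp], ?_⟩
  filter_upwards [eventually_homExt_comp_eq_zero (S := fun y => χ y = 0) hg.continuousAt hgh hχh hℓ
      (hp0.mono fun y h hy => (h hy).1),
    eventually_fderiv_homExt_comp_eq_zero (S := fun y => χ y = 0) hg hgh hχh hℓ hp hp0]
    with y h2 h3 hy using ⟨h2 hy, h3 hy⟩

variable {E : Type v} {F : Type u} {C : Type*} [NormedAddCommGroup E] [NormedSpace ℝ E]
  [FiniteDimensional ℝ E] [NormedAddCommGroup F] [NormedSpace ℝ F] [FiniteDimensional ℝ F]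
  [NormedAddCommGroup C] [NormedSpace ℝ C] [FiniteDimensional ℝ C]

/-- Canonical coordinates adapted to the critical set of `g`: the last two of the `ξ` vanish with
their differentials along `g` on the critical set. -/
theorem CriticalGerm.exists_adapted_darboux {n : ℕ} (hn : 3 ≤ n)
    (hE : Module.finrank ℝ E = 2 * n - 1) (hF : Module.finrank ℝ F = 2 * n)
    (hC : Module.finrank ℝ C = 2) {g : E → F} {e : E} {χ : E → C} {θ : F → F →L[ℝ] ℝ}
    (hχ : CriticalGerm g χ e) (hg : EvSmooth g e)
    (hgh : ∀ᶠ p in 𝓝 ((1 : ℝ), e), g (p.1 • p.2) = p.1 • g p.2) (hge : g e ≠ 0)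
    (hθ : LiouvilleGerm θ (g e))
    (hinv : ∀ᶠ y in 𝓝 e, ¬ Function.Injective (fderiv ℝ g y) → ∀ x,
      (∀ v, ed θ (g y) x (fderiv ℝ g y v) = 0) → ∃ v, fderiv ℝ g y v = x)
    {X₀ : F} (hX₀ : ∀ v, ed θ (g e) X₀ (fderiv ℝ g e v) = 0)
    (hX₀' : ∀ v, fderiv ℝ χ e v = 0 → fderiv ℝ g e v ≠ X₀)
    (hnr : ∃ v, fderiv ℝ χ e v = 0 ∧ θ (g e) (fderiv ℝ g e v) ≠ 0) :
    ∃ x ξ : Fin n → F → ℝ, (∀ i, EvSmooth (x i) (g e)) ∧ (∀ i, EvSmooth (ξ i) (g e)) ∧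
      (∀ i, x i (g e) = 0) ∧ (∀ i, ξ i (g e) = unitOne n i) ∧
      (∀ᶠ y in 𝓝 (g e), ∀ b, θ y b = ∑ i, ξ i y * fderiv ℝ (x i) y b) ∧
      (∀ b, ed θ (g e) X₀ b = - fderiv ℝ (ξ (idxPen hn)) (g e) b) ∧
      ∀ᶠ y in 𝓝 e, χ y = 0 → ∀ i, i = idxPen hn ∨ i = idxLast hn →
        ξ i (g y) = 0 ∧ ∀ v, fderiv ℝ (ξ i) (g y) (fderiv ℝ g y v) = 0 := by
  have hχh := hχ.eventually_smul hgh
  obtain ⟨w, hw, hθw⟩ := hnr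
  obtain ⟨p, hp, hpe, hp0, hdp, hpg⟩ := hχ.exists_homogeneous_conormal hg hgh hχh hge
    (-(edMap θ (g e) X₀)) (fun v => by
      rw [neg_apply, edMap_apply, hX₀, neg_zero])
  have hdp' : ∀ b, ed θ (g e) X₀ b = - fderiv ℝ p (g e) b := by
    intro b
    rw [hdp, neg_apply, neg_neg, edMap_apply]
  have hX₀0 : X₀ ≠ 0 := by
    rintro rfl
    exact hX₀' 0 (map_zero _) (map_zero _)
  -- dp kills the image of dg, whereas θ is nonzero on some `dg w` with `w` tangent to the critical
  -- set, so `c = 0`; then `dp = 0` and `X₀ = 0`, which is excluded.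
  have hind : ∀ c : ℝ, fderiv ℝ p (g e) ≠ c • θ (g e) := by
    intro c hc
    have h1 := hX₀ w
    rw [hdp', hc, smul_apply, smul_eq_mul, neg_eq_zero] at h1
    have h2 := (mul_eq_zero.1 h1).resolve_right hθw
    refine hX₀0 (hθ.nondeg _ fun b => ?_)
    rw [hdp', hc, h2, zero_smul, zero_apply, neg_zero]
  obtain ⟨G₁, G, v, θ', q, Y, hfr, hv0, hθ', hq, hY, hYu, hred, hedred, hYe, hXqY⟩ :=
    hθ.exists_reduced_germ hp hpe hp0 hind hge
  subst hYu
  obtain ⟨X, hX, hXp⟩ := hθ.exists_sharp hp.fderiv.neg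
  have hXp' : ∀ᶠ y in 𝓝 (g e), ∀ b, ed θ y (X y) b = - fderiv ℝ p y b := hXp
  have hXe : X (g e) = X₀ := by
    rw [← sub_eq_zero]
    refine hθ.nondeg _ fun b => ?_
    rw [← edMap_apply, map_sub, sub_apply, edMap_apply, edMap_apply, hXp'.self_of_nhds, hdp',
      sub_self]
  -- Along the critical set dp kills the image of dg, so `X` annihilates that image and involutivity
  -- puts it inside.
  have hXg : ∀ᶠ y in 𝓝 e, χ y = 0 → ∃ k, fderiv ℝ g y k = X (g y) := by
    filter_upwards [hinv, hχ.eq_zero_iff, hg.continuousAt.eventually hXp', hpg]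
      with y h1 h2 h3 h4 hy
    refine h1 (h2.1 hy) _ fun v => ?_
    rw [h3, (h4 hy).2, neg_zero]
  let P : E → G := fun y => Y (g y)
  have hP : EvSmooth P e := EvSmooth.comp hY hg
  have hdP : ∀ v, fderiv ℝ P e v = fderiv ℝ Y (g e) (fderiv ℝ g e v) := by
    intro v
    have : HasFDerivAt P _ e :=
      hY.differentiableAt.hasFDerivAt.comp e hg.differentiableAt.hasFDerivAt
    rw [this.fderiv]; rfl
  have hPh : ∀ᶠ p in 𝓝 ((1 : ℝ), e), P (p.1 • p.2) = p.1 • P p.2 := by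
    have ht : Tendsto (fun p : ℝ × E => (p.1, g p.2)) (𝓝 (1, e)) (𝓝 (1, g e)) :=
      continuousAt_fst.prodMk_nhds (hg.continuousAt.tendsto.comp continuousAt_snd)
    filter_upwards [hgh, ht.eventually (eventually_smul_of_euler_one hY hYe)] with p h1 h2
    simp only [P, h1]
    exact h2
  -- The vectors killed by dp and dY are the multiples of `X₀`, and no nonzero multiple of `X₀`
  -- comes from a tangent vector of the critical set.
  have hPinj : ∀ v, fderiv ℝ χ e v = 0 → fderiv ℝ P e v = 0 → v = 0 := by
    intro v hv hPv
    rw [hdP] at hPv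
    have h1 : ∀ c : ℝ, fderiv ℝ g e v = c • X₀ → v = 0 := by
      intro c hc
      rcases eq_or_ne c 0 with rfl | hc0
      · exact hχ.transverse v hv (by rw [hc, zero_smul])
      · refine absurd ?_ (hX₀' (c⁻¹ • v) (by rw [map_smul, hv, smul_zero]))
        rw [map_smul, hc, inv_smul_smul₀ hc0]
    refine h1 (fderiv ℝ q (g e) (fderiv ℝ g e v)) ?_
    rw [← sub_eq_zero]
    refine hθ.nondeg _ fun b => ?_
    have h2 := hX₀ v
    rw [hdp', neg_eq_zero] at h2
    rw [← edMap_apply, map_sub, sub_apply, map_smul, smul_apply, edMap_apply, edMap_apply, hdp',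
      hedred.self_of_nhds, hPv, h2, ← edMap_apply, map_zero, zero_apply, smul_eq_mul]
    ring
  -- The critical set has dimension 2n - 3 and the reduced space 2n - 2, so its image there is a
  -- conic hypersurface.
  obtain ⟨p₂, hp₂, hp₂e, hp₂0, hdp₂, hdp₂P, hp₂g⟩ := exists_homogeneous_defining_function hP
    hχ.smooth hχ.eq_zero hχ.surjective hPinj hPh hχh (hχ.fderiv_self hgh) (by omega) hv0
  have hf : EvSmooth (fun y => p₂ (Y y)) (g e) := EvSmooth.comp hp₂ hY
  have hYt := hY.continuousAt.tendsto
  have hdf : ∀ᶠ y in 𝓝 (g e), ∀ b, fderiv ℝ (fun y => p₂ (Y y)) y b =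
      fderiv ℝ p₂ (Y y) (fderiv ℝ Y y b) := by
    filter_upwards [hY.eventually_differentiableAt, hYt.eventually hp₂.eventually_differentiableAt]
      with y h1 h2 b
    have : HasFDerivAt (fun y => p₂ (Y y)) _ y := h2.hasFDerivAt.comp y h1.hasFDerivAt
    rw [this.fderiv]; rfl
  -- `p₂ ∘ Y` is constant along `X`, because dY kills `X`; this upgrades vanishing on the image of
  -- the critical set to vanishing of the differential along dg.
  have hfg := hχ.eventually_conormal hg hC hX (by rwa [hXe]) hXg hf (by
    filter_upwards [hdf, hXp', hXqY] with y h1 h2 h3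
    rw [h1, (h3 _ h2).2, map_zero]) hp₂g
  have hind₂ : ∀ c : ℝ, fderiv ℝ p₂ (Y (g e)) ≠ c • θ' (Y (g e)) := by
    intro c hc
    have h1 := hdp₂P w hw
    have h2 := hred.self_of_nhds (fderiv ℝ g e w)
    rw [hp0, zero_mul, zero_add, ← hdP] at h2
    rw [hc, smul_apply, smul_eq_mul] at h1
    rw [h2] at hθw
    refine hdp₂ ?_
    rw [hc, (mul_eq_zero.1 h1).resolve_right hθw, zero_smul]
  obtain ⟨G₁', G', v', θ'', q₂, Y₂, hfr₂, hv'0, hθ'', hq₂, hY₂, hYu₂, hred₂, -, -, -⟩ :=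
    hθ'.exists_reduced_germ hp₂ hp₂e hp₂0 hind₂ hv0
  subst hYu₂
  obtain ⟨x', ξ', hx', hξ', hξ'u, hdar⟩ :=
    hθ''.exists_darboux' (n - 2) (by omega) (by omega) hv'0
  have hYY : EvSmooth (fun y => Y₂ (Y y)) (g e) := EvSmooth.comp hY₂ hY
  let x : Fin n → F → ℝ :=
    idxGlue n (fun j y => x' j (Y₂ (Y y))) q (fun y => q₂ (Y y))
  let ξ : Fin n → F → ℝ :=
    idxGlue n (fun j y => ξ' j (Y₂ (Y y))) p (fun y => p₂ (Y y))
  have hxh : ∀ j, x (idxHead j) = fun y => x' j (Y₂ (Y y)) := fun j => idxGlue_head _ _ _ j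
  have hxp : x (idxPen hn) = q := idxGlue_pen hn _ _ _
  have hxl : x (idxLast hn) = fun y => q₂ (Y y) := idxGlue_last hn _ _ _
  have hξh : ∀ j, ξ (idxHead j) = fun y => ξ' j (Y₂ (Y y)) := fun j => idxGlue_head _ _ _ j
  have hξp : ξ (idxPen hn) = p := idxGlue_pen hn _ _ _
  have hξl : ξ (idxLast hn) = fun y => p₂ (Y y) := idxGlue_last hn _ _ _
  have hx : ∀ i, EvSmooth (x i) (g e) := by
    intro i
    rcases eq_idxHead_or hn i with ⟨j, rfl⟩ | rfl | rfl
    · rw [hxh]; exact EvSmooth.comp (hx' j) hYY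
    · rwa [hxp]
    · rw [hxl]; exact EvSmooth.comp hq₂ hY
  have hξ : ∀ i, EvSmooth (ξ i) (g e) := by
    intro i
    rcases eq_idxHead_or hn i with ⟨j, rfl⟩ | rfl | rfl
    · rw [hξh]; exact EvSmooth.comp (hξ' j) hYY
    · rwa [hξp]
    · rwa [hξl]
  have hθx : ∀ᶠ y in 𝓝 (g e), ∀ b, θ y b = ∑ i, ξ i y * fderiv ℝ (x i) y b := by
    filter_upwards [hred, hYt.eventually hred₂, hYY.continuousAt.eventually hdar,
      hY.eventually_differentiableAt, hYt.eventually hY₂.eventually_differentiableAt,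
      hYt.eventually hq₂.eventually_differentiableAt,
      hYY.continuousAt.eventually (eventually_all.2 fun j => (hx' j).eventually_differentiableAt)]
      with y h1 h2 h3 h4 h5 h6 h7 b
    have h8 : HasFDerivAt (fun y => Y₂ (Y y)) _ y := h5.hasFDerivAt.comp y h4.hasFDerivAt
    have h9 : HasFDerivAt (fun y => q₂ (Y y)) _ y := h6.hasFDerivAt.comp y h4.hasFDerivAt
    have h10 : ∀ j, HasFDerivAt (fun y => x' j (Y₂ (Y y))) _ y := fun j =>
      HasFDerivAt.comp (g := x' j) (f := fun y => Y₂ (Y y)) y (h7 j).hasFDerivAt h8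
    rw [sum_idx hn, h1, h2, h3]
    simp only [hxh, hxp, hxl, hξh, hξp, hξl, h9.fderiv, fun j => (h10 j).fderiv,
      ContinuousLinearMap.comp_apply]
    ring
  have hxc : ∀ i y, fderiv ℝ (fun y => x i y - x i (g e)) y = fderiv ℝ (x i) y :=
    fun i y => fderiv_sub_const _
  -- Subtracting constants puts the base point at `x = 0` without changing any dx_i.
  refine ⟨fun i y => x i y - x i (g e), ξ, fun i => (hx i).sub (EvSmooth.const _), hξ,
    fun i => sub_self _, ?_, ?_, ?_, ?_⟩
  · intro i
    rcases eq_idxHead_or hn i with ⟨j, rfl⟩ | rfl | rfl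
    · rw [hξh]; exact hξ'u j
    · rw [hξp, hp0, unitOne, if_neg]
      change n - 2 ≠ 0
      omega
    · rw [hξl]
      refine hp₂0.trans ?_
      rw [unitOne, if_neg]
      change n - 1 ≠ 0
      omega
  · simpa only [hxc] using hθx
  · rwa [hξp]
  · filter_upwards [hpg, hfg, hp₂g] with y h1 h2 h3 hy i hi
    rcases hi with rfl | rfl
    · rw [hξp]; exact h1 hy
    · rw [hξl]; exact ⟨h3 hy, h2 hy⟩

end Adapted

/-! ### Coordinates on the source of the map -/

section CrossCoordinates

variable {E F : Type*} [NormedAddCommGroup E] [NormedSpace ℝ E] [FiniteDimensional ℝ E]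
  [NormedAddCommGroup F] [NormedSpace ℝ F] [FiniteDimensional ℝ F]

/-- The map `(x'', x_n, ξ'', a)`, to be used as coordinates on the source of the map `g`. -/
def crossMap {n : ℕ} (hn : 3 ≤ n) (x ξ : Fin n → F → ℝ) (g : E → F) (a : E → Fin 2 → ℝ) (y : E) :
    CrossCoord n :=
  (fun j => x (idxHead j) (g y), x (idxLast hn) (g y), fun j => ξ (idxHead j) (g y), a y)

variable {n : ℕ} (hn : 3 ≤ n) {x ξ : Fin n → F → ℝ} {g : E → F} {a : E → Fin 2 → ℝ} {e : E}

omit [FiniteDimensional ℝ E] [FiniteDimensional ℝ F] in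
theorem EvSmooth.crossMap (hg : EvSmooth g e) (hx : ∀ i, EvSmooth (x i) (g e))
    (hξ : ∀ i, EvSmooth (ξ i) (g e)) (ha : EvSmooth a e) : EvSmooth (crossMap hn x ξ g a) e :=
  (EvSmooth.pi fun j => EvSmooth.comp (hx (idxHead j)) hg).prodMk
    ((EvSmooth.comp (hx _) hg).prodMk
      ((EvSmooth.pi fun j => EvSmooth.comp (hξ (idxHead j)) hg).prodMk ha))

omit [FiniteDimensional ℝ E] [FiniteDimensional ℝ F] in
theorem eventually_fderiv_crossMap (hg : EvSmooth g e) (hx : ∀ i, EvSmooth (x i) (g e))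
    (hξ : ∀ i, EvSmooth (ξ i) (g e)) (ha : EvSmooth a e) :
    ∀ᶠ y in 𝓝 e, ∀ v, fderiv ℝ (crossMap hn x ξ g a) y v =
      (fun j => fderiv ℝ (x (idxHead j)) (g y) (fderiv ℝ g y v),
        fderiv ℝ (x (idxLast hn)) (g y) (fderiv ℝ g y v),
        fun j => fderiv ℝ (ξ (idxHead j)) (g y) (fderiv ℝ g y v), fderiv ℝ a y v) := by
  filter_upwards [hg.eventually_differentiableAt, ha.eventually_differentiableAt,
    hg.continuousAt.eventually (eventually_all.2 fun i => (hx i).eventually_differentiableAt),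
    hg.continuousAt.eventually (eventually_all.2 fun i => (hξ i).eventually_differentiableAt)]
    with y h1 h2 h3 h4 v
  have hxd : ∀ i, HasFDerivAt (fun y => x i (g y)) _ y :=
    fun i => (h3 i).hasFDerivAt.comp y h1.hasFDerivAt
  have hξd : ∀ i, HasFDerivAt (fun y => ξ i (g y)) _ y :=
    fun i => (h4 i).hasFDerivAt.comp y h1.hasFDerivAt
  have h5 : HasFDerivAt (crossMap hn x ξ g a) _ y :=
    (hasFDerivAt_pi.2 fun j => hxd (idxHead j)).prodMk ((hxd (idxLast hn)).prodMk
      ((hasFDerivAt_pi.2 fun j => hξd (idxHead j)).prodMk h2.hasFDerivAt))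
  rw [h5.fderiv]
  rfl

theorem bijective_of_injective_cross {L : E →L[ℝ] CrossCoord n} (hn : 3 ≤ n)
    (hE : Module.finrank ℝ E = 2 * n - 1) (h : ∀ v, L v = 0 → v = 0) : Function.Bijective L := by
  have h1 : Function.Injective L.toLinearMap := (injective_iff_map_eq_zero _).2 h
  refine ⟨h1, (LinearMap.injective_iff_surjective_of_finrank_eq_finrank ?_).1 h1⟩
  simp only [Module.finrank_prod, Module.finrank_fintype_fun_eq_card, Fintype.card_fin,
    Module.finrank_self]
  omega

/-- The function `a` is a homogeneous version of `χ`, with its components ordered suitably. Since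
dξ_{n-1} and dξ_n kill the image of dg at `e`, a vector with vanishing x'', x_n and ξ'' components
is mapped to a multiple of `X₀ = ∂/∂x_{n-1}`; if it is also tangent to the critical set it must
vanish. -/
theorem CriticalGerm.exists_cross_coordinates
    (hE : Module.finrank ℝ E = 2 * n - 1) (hF : Module.finrank ℝ F = 2 * n)
    {χ : E → Fin 2 → ℝ} {θ : F → F →L[ℝ] ℝ}
    (hχ : CriticalGerm g χ e) (hg : EvSmooth g e)
    (hgh : ∀ᶠ p in 𝓝 ((1 : ℝ), e), g (p.1 • p.2) = p.1 • g p.2) (hge : g e ≠ 0)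
    (hθ : LiouvilleGerm θ (g e)) {X₀ : F} (hX₀g : ∃ k, fderiv ℝ g e k = X₀)
    (hX₀' : ∀ v, fderiv ℝ χ e v = 0 → fderiv ℝ g e v ≠ X₀)
    (hx : ∀ i, EvSmooth (x i) (g e)) (hξ : ∀ i, EvSmooth (ξ i) (g e))
    (hxe : ∀ i, x i (g e) = 0) (hξe : ∀ i, ξ i (g e) = unitOne n i)
    (hdar : ∀ᶠ y in 𝓝 (g e), ∀ b, θ y b = ∑ i, ξ i y * fderiv ℝ (x i) y b)
    (hX₀ξ : ∀ b, ed θ (g e) X₀ b = - fderiv ℝ (ξ (idxPen hn)) (g e) b)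
    (hcrit : ∀ i, i = idxPen hn ∨ i = idxLast hn →
      ∀ v, fderiv ℝ (ξ i) (g e) (fderiv ℝ g e v) = 0) :
    ∃ a : E → Fin 2 → ℝ, EvSmooth a e ∧ crossMap hn x ξ g a e = (0, 0, unitOne (n - 2), 0) ∧
      Function.Bijective (fderiv ℝ (crossMap hn x ξ g a) e) ∧
      (∀ᶠ y in 𝓝 e, fderiv ℝ (crossMap hn x ξ g a) y y =
        (0, 0, (crossMap hn x ξ g a y).2.2)) ∧
      (∀ᶠ y in 𝓝 e, ∀ v, fderiv ℝ (crossMap hn x ξ g a) y v = CrossCoord.tauDir n 0 →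
        fderiv ℝ (x (idxPen hn)) (g y) (fderiv ℝ g y v) ≠ 0) ∧
      ∀ᶠ y in 𝓝 e, a y = 0 → χ y = 0 := by
  have := FiniteDimensional.complete ℝ E
  have hgee := (euler_of_homogeneous hg hgh).self_of_nhds
  have he : e ≠ 0 := by
    rintro rfl
    rw [map_zero] at hgee
    exact hge hgee.symm
  have hed := (eventually_ed_eq_sum hx hξ hdar).self_of_nhds
  have hzero : ∀ w, (∀ i, fderiv ℝ (x i) (g e) w = 0) → (∀ i, fderiv ℝ (ξ i) (g e) w = 0) →
      w = 0 := by
    intro w h1 h2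
    refine hθ.nondeg _ fun b => ?_
    rw [hed]
    simp [h1, h2]
  obtain ⟨X₁, hX₁⟩ := (eventually_darboux_surjective hF hθ hx hξ hdar).self_of_nhds
    (Pi.single (idxPen hn) 1) 0
  have hX₁₀ : X₁ = X₀ := by
    rw [← sub_eq_zero]
    refine hθ.nondeg _ fun b => ?_
    rw [← edMap_apply, map_sub, sub_apply, edMap_apply, edMap_apply, hX₀ξ, hed]
    simp [fun i => (hX₁ i).1, fun i => (hX₁ i).2, Pi.single_apply]
  subst hX₁₀
  have hX₁p : fderiv ℝ (x (idxPen hn)) (g e) X₁ = 1 := by simpa using (hX₁ (idxPen hn)).1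
  obtain ⟨ℓ, hℓ⟩ := exists_functional_eq_one he
  -- Homogeneous of degree one, with the differential of `χ` at `e`, since `e` is tangent to the
  -- conic critical set.
  let τ : E → Fin 2 → ℝ := homExt ℓ χ
  have hτ : EvSmooth τ e := hχ.smooth.homExt hℓ
  have hτe : τ e = 0 := (homExt_apply_of_eq_one hℓ).trans hχ.eq_zero
  have hdτ : fderiv ℝ τ e = fderiv ℝ χ e :=
    fderiv_homExt_of_eq_zero hχ.smooth hℓ hχ.eq_zero (hχ.fderiv_self hgh)
  have hτEuler : ∀ᶠ y in 𝓝 e, fderiv ℝ τ y y = τ y := euler_homExt hχ.smooth hℓ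
  have hτχ : ∀ᶠ y in 𝓝 e, τ y = 0 → χ y = 0 := by
    have hℓc : ContinuousAt ℓ e := ℓ.continuous.continuousAt
    have ht : Tendsto (fun y => (ℓ y, (ℓ y)⁻¹ • y)) (𝓝 e) (𝓝 (1, e)) := by
      refine Tendsto.prodMk_nhds ?_ (tendsto_normalize_smul hℓc hℓ)
      rw [← hℓ]; exact hℓc
    filter_upwards [ht.eventually (hχ.eventually_smul hgh),
      hℓc.eventually_ne (by rw [hℓ]; exact one_ne_zero)] with y h1 h2 hy
    simp only [smul_inv_smul₀ h2] at h1
    exact h1 ((smul_eq_zero.1 hy).resolve_left h2)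
  have hcoord : ∀ w, (∀ j, fderiv ℝ (x (idxHead j)) (g e) w = 0) →
      fderiv ℝ (x (idxLast hn)) (g e) w = 0 → (∀ j, fderiv ℝ (ξ (idxHead j)) (g e) w = 0) →
      (∃ v, fderiv ℝ g e v = w) → w = fderiv ℝ (x (idxPen hn)) (g e) w • X₁ := by
    rintro w h1 h2 h3 ⟨v, rfl⟩
    rw [← sub_eq_zero]
    refine hzero _ (fun i => ?_) fun i => ?_
    · rw [map_sub, map_smul, (hX₁ i).1]
      rcases eq_idxHead_or hn i with ⟨j, rfl⟩ | rfl | rfl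
      · have : idxHead j ≠ idxPen hn := fun h => by
          have := congrArg Fin.val h
          have := j.2
          simp only [idxHead, idxPen] at *
          omega
        rw [h1, Pi.single_eq_of_ne this]; simp
      · simp
      · have : idxLast hn ≠ idxPen hn := fun h => by
          have := congrArg Fin.val h
          simp only [idxLast, idxPen] at *
          omega
        rw [h2, Pi.single_eq_of_ne this]; simp
    · rw [map_sub, map_smul, (hX₁ i).2]
      rcases eq_idxHead_or hn i with ⟨j, rfl⟩ | h
      · rw [h3]; simp
      · rw [hcrit i h]; simp
  have hinjτ : ∀ v, fderiv ℝ (crossMap hn x ξ g τ) e v = 0 → v = 0 := by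
    intro v hv
    rw [(eventually_fderiv_crossMap hn hg hx hξ hτ).self_of_nhds] at hv
    simp only [Prod.mk_eq_zero] at hv
    obtain ⟨h1, h2, h3, h4⟩ := hv
    rw [hdτ] at h4
    have h5 := hcoord _ (fun j => congrFun h1 j) h2 (fun j => congrFun h3 j) ⟨v, rfl⟩
    generalize fderiv ℝ (x (idxPen hn)) (g e) (fderiv ℝ g e v) = c at h5
    rcases eq_or_ne c 0 with rfl | hc0
    · exact hχ.transverse v h4 (by rw [h5, zero_smul])
    · refine absurd ?_ (hX₀' (c⁻¹ • v) (by rw [map_smul, h4, smul_zero]))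
      rw [map_smul, h5, inv_smul_smul₀ hc0]
  have hbijτ := bijective_of_injective_cross hn hE hinjτ
  -- A preimage `k` of `X₀` has only τ components in the new coordinates. As dx_{n-1}(X₀) = 1, one
  -- of the two τ directions must have nonzero dx_{n-1} ∘ dg; a permutation moves it to index 0.
  obtain ⟨i, w, hiw, hw⟩ : ∃ (i : Fin 2) (w : E), fderiv ℝ (crossMap hn x ξ g τ) e w =
      CrossCoord.tauDir n i ∧ fderiv ℝ (x (idxPen hn)) (g e) (fderiv ℝ g e w) ≠ 0 := by
    by_contra! h
    choose w hw using fun i : Fin 2 => hbijτ.2 (CrossCoord.tauDir n i)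
    obtain ⟨k, hk⟩ := hX₀g
    have h1 : k = ∑ i, fderiv ℝ τ e k i • w i := by
      apply hbijτ.1
      rw [map_sum, (eventually_fderiv_crossMap hn hg hx hξ hτ).self_of_nhds]
      simp only [map_smul, hw, hk, fun i => (hX₁ i).1, fun i => (hX₁ i).2]
      refine Prod.ext ?_ (Prod.ext ?_ (Prod.ext ?_ ?_))
      · ext j
        have : idxHead j ≠ idxPen hn := fun h => by
          have := congrArg Fin.val h
          have := j.2
          simp only [idxHead, idxPen] at *
          omega
        simp [CrossCoord.tauDir, Pi.single_eq_of_ne this]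
      · have : idxLast hn ≠ idxPen hn := fun h => by
          have := congrArg Fin.val h
          simp only [idxLast, idxPen] at *
          omega
        simp [CrossCoord.tauDir, Pi.single_eq_of_ne this]
      · ext j
        simp [CrossCoord.tauDir]
      · ext j
        fin_cases j <;> simp [CrossCoord.tauDir]
    have h2 := hX₁p
    rw [← hk, h1, map_sum, map_sum] at h2
    simp only [map_smul, fun i => h i (w i) (hw i), smul_zero, Finset.sum_const_zero] at h2
    exact zero_ne_one h2
  let σ : Equiv.Perm (Fin 2) := Equiv.swap 0 i
  let a : E → Fin 2 → ℝ := fun y j => τ y (σ j)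
  have ha : EvSmooth a e := EvSmooth.pi fun j => hτ.apply (σ j)
  have hda : ∀ᶠ y in 𝓝 e, ∀ v j, fderiv ℝ a y v j = fderiv ℝ τ y v (σ j) := by
    filter_upwards [hτ.eventually_differentiableAt] with y h1 v j
    have h2 : HasFDerivAt a _ y :=
      hasFDerivAt_pi.2 fun j => (hasFDerivAt_pi'.1 h1.hasFDerivAt) (σ j)
    rw [h2.fderiv]
    rfl
  have hda0 := hda.self_of_nhds
  have hdca := eventually_fderiv_crossMap hn hg hx hξ ha
  have hdcτ := (eventually_fderiv_crossMap hn hg hx hξ hτ).self_of_nhds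
  have haτ : ∀ v, fderiv ℝ a e v = 0 → fderiv ℝ τ e v = 0 := by
    intro v hv
    ext j
    have := congrFun hv (σ.symm j)
    rwa [hda0, Equiv.apply_symm_apply] at this
  -- With x_{n-1} ∘ g in place of the first τ coordinate the map is still a local diffeomorphism.
  -- This open condition implies that x_{n-1} ∘ g has nonzero derivative along the first τ direction
  -- at all nearby points.
  let b : E → Fin 2 → ℝ := fun y => ![x (idxPen hn) (g y), a y 1]
  have hxg : EvSmooth (fun y => x (idxPen hn) (g y)) e := EvSmooth.comp (hx _) hg
  have hb : EvSmooth b e := by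
    refine EvSmooth.pi fun j => ?_
    fin_cases j
    · exact hxg
    · exact ha.apply 1
  have hdb : ∀ᶠ y in 𝓝 e, ∀ v, fderiv ℝ b y v =
      ![fderiv ℝ (x (idxPen hn)) (g y) (fderiv ℝ g y v), fderiv ℝ a y v 1] := by
    filter_upwards [hb.eventually_differentiableAt, ha.eventually_differentiableAt,
      hg.eventually_differentiableAt,
      hg.continuousAt.eventually (hx (idxPen hn)).eventually_differentiableAt] with y h1 h2 h3 h4 v
    have h5 := hasFDerivAt_pi'.1 h1.hasFDerivAt
    have h6 : HasFDerivAt (fun y => x (idxPen hn) (g y)) _ y :=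
      h4.hasFDerivAt.comp y h3.hasFDerivAt
    have h7 := congrArg (fun L : E →L[ℝ] ℝ => L v) ((h5 0).unique h6)
    have h8 := congrArg (fun L : E →L[ℝ] ℝ => L v)
      ((h5 1).unique (hasFDerivAt_pi'.1 h2.hasFDerivAt 1))
    ext j
    fin_cases j
    · exact h7
    · exact h8
  have hdcb := eventually_fderiv_crossMap hn hg hx hξ hb
  have hinjb : ∀ v, fderiv ℝ (crossMap hn x ξ g b) e v = 0 → v = 0 := by
    intro v hv
    rw [hdcb.self_of_nhds, hdb.self_of_nhds] at hv
    simp only [Prod.mk_eq_zero] at hv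
    obtain ⟨h1, h2, h3, h4⟩ := hv
    have h5 : fderiv ℝ (x (idxPen hn)) (g e) (fderiv ℝ g e v) = 0 := congrFun h4 0
    have h6 : fderiv ℝ a e v 1 = 0 := congrFun h4 1
    have h7 : v = fderiv ℝ τ e v i • w := by
      apply hbijτ.1
      rw [map_smul, hiw, hdcτ, h1, h2, h3]
      refine Prod.ext (by simp [CrossCoord.tauDir]) (Prod.ext (by simp [CrossCoord.tauDir])
        (Prod.ext (by simp [CrossCoord.tauDir]) ?_))
      rw [hda0] at h6
      ext j
      have h8 : j = i ∨ j = σ 1 := by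
        revert j
        simp only [σ]
        clear_value a τ
        clear * -
        revert i
        decide
      rcases h8 with rfl | rfl
      · simp [CrossCoord.tauDir]
      · have : σ 1 ≠ i := by
          simp only [σ]
          clear * -
          revert i
          decide
        change fderiv ℝ τ e v (σ 1) = _
        rw [h6]
        simp [CrossCoord.tauDir, Pi.single_eq_of_ne this]
    rw [h7, map_smul, map_smul, smul_eq_mul] at h5
    rw [h7, (mul_eq_zero.1 h5).resolve_right hw, zero_smul]
  have hbijb := eventually_bijective_fderiv (hg.crossMap hn hx hξ hb)
    (bijective_of_injective_cross hn hE hinjb)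
  refine ⟨a, ha, ?_, ?_, ?_, ?_, ?_⟩
  · refine Prod.ext ?_ (Prod.ext (hxe _) (Prod.ext ?_ ?_))
    · ext j; exact hxe _
    · ext j; exact hξe _
    · ext j; exact congrFun hτe _
  · refine bijective_of_injective_cross hn hE fun v hv => hinjτ v ?_
    rw [hdca.self_of_nhds] at hv
    simp only [Prod.mk_eq_zero] at hv
    rw [hdcτ, hv.1, hv.2.1, hv.2.2.1, haτ v hv.2.2.2]
    rfl
  · filter_upwards [hdca, euler_of_homogeneous hg hgh, hda, hτEuler,
      hg.continuousAt.eventually (eventually_darboux_euler hF hθ hx hξ hdar)] with y h1 h2 h3 h4 h5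
    rw [h1, h2]
    refine Prod.ext ?_ (Prod.ext (h5 _).1 (Prod.ext ?_ ?_))
    · ext j; exact (h5 _).1
    · ext j; exact (h5 _).2
    · ext j
      change fderiv ℝ a y y j = _
      rw [h3, h4]; rfl
  · filter_upwards [hdca, hdcb, hdb, hbijb] with y h1 h2 h3 h4 v hv hv0
    rw [h1] at hv
    have h5 : fderiv ℝ a y v = Pi.single 0 1 :=
      congrArg (fun p : CrossCoord n => p.2.2.2) hv
    have h6 : v = 0 := by
      apply h4.1
      rw [map_zero, h2, h3, hv0, h5]
      have h7 := congrArg (fun p : CrossCoord n => p.1) hv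
      have h8 := congrArg (fun p : CrossCoord n => p.2.1) hv
      have h9 := congrArg (fun p : CrossCoord n => p.2.2.1) hv
      refine Prod.ext h7 (Prod.ext h8 (Prod.ext h9 ?_))
      ext j
      fin_cases j <;> simp
    have h7 := congrFun h5 0
    rw [h6, map_zero] at h7
    simp at h7
  · filter_upwards [hτχ] with y h1 hy
    refine h1 ?_
    ext j
    have := congrFun hy (σ.symm j)
    simpa [a] using this

end CrossCoordinates

/-! ### Extending local diffeomorphisms homogeneously to cones -/

section HomogeneousDiffeo

variable {E G : Type*} [NormedAddCommGroup E] [NormedSpace ℝ E]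
  [NormedAddCommGroup G] [NormedSpace ℝ G]

/-- The dilations acting by `r` on the range of the idempotent `Q`, trivially on its kernel. -/
def partialDil (Q : G →L[ℝ] G) (r : ℝ) (z : G) : G := z - Q z + r • Q z

variable {Q : G →L[ℝ] G}

theorem partialDil_one (z : G) : partialDil Q 1 z = z := by simp [partialDil]

theorem partialDil_mul (hQ : ∀ z, Q (Q z) = Q z) (r s : ℝ) (z : G) :
    partialDil Q r (partialDil Q s z) = partialDil Q (r * s) z := by
  simp only [partialDil, map_add, map_sub, map_smul, hQ]
  module

theorem continuous_partialDil : Continuous fun p : ℝ × G => partialDil Q p.1 p.2 := by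
  unfold partialDil
  fun_prop

theorem contDiff_partialDil (r : ℝ) : ContDiff ℝ ∞ (partialDil Q r) := by
  unfold partialDil
  exact (contDiff_id.sub Q.contDiff).add (contDiff_const.smul Q.contDiff)

theorem tendsto_partialDil (z : G) :
    Tendsto (fun p : ℝ × G => partialDil Q p.1 p.2) (𝓝 (1, z)) (𝓝 z) :=
  continuous_partialDil.tendsto' _ _ (partialDil_one z)

/-- The Euler relation with weights implies local homogeneity. -/
theorem eventually_smul_of_euler_partialDil {f : E → G} {u : E} (hf : EvSmooth f u)
    (hQ : ∀ z, Q (Q z) = Q z) (he : ∀ᶠ y in 𝓝 u, fderiv ℝ f y y = Q (f y)) :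
    ∀ᶠ p in 𝓝 ((1 : ℝ), u), f (p.1 • p.2) = partialDil Q p.1 (f p.2) := by
  have h1 : EvSmooth (fun y => Q (f y)) u := EvSmooth.comp (EvSmooth.clm Q) hf
  have hd : ∀ᶠ y in 𝓝 u, fderiv ℝ (fun y => Q (f y)) y y = Q (f y) ∧
      fderiv ℝ (fun y => f y - Q (f y)) y y = 0 := by
    filter_upwards [hf.eventually_differentiableAt, he] with y h2 h3
    have h4 : HasFDerivAt (fun y => Q (f y)) _ y := Q.hasFDerivAt.comp y h2.hasFDerivAt
    have h5 := h2.hasFDerivAt.fun_sub h4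
    rw [h4.fderiv, h5.fderiv]
    simp [h3, hQ]
  filter_upwards [eventually_smul_of_euler_one h1 (hd.mono fun _ h => h.1),
    eventually_smul_of_euler_zero (hf.sub h1) (hd.mono fun _ h => h.2)] with p h2 h3
  rw [sub_eq_iff_eq_add] at h3
  rw [h3, h2]
  rfl

/-- A local diffeomorphism satisfying the Euler relation extends to a homogeneous diffeomorphism
between cones. -/
theorem exists_homogeneous_diffeo [FiniteDimensional ℝ E] [FiniteDimensional ℝ G]
    {f : E → G} {u : E} (hf : EvSmooth f u) (hb : Function.Bijective (fderiv ℝ f u))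
    (hQ : ∀ z, Q (Q z) = Q z) (he : ∀ᶠ y in 𝓝 u, fderiv ℝ f y y = Q (f y)) (hu : Q (f u) ≠ 0)
    {S : E → Prop} (hS : ∀ᶠ y in 𝓝 u, S y) :
    ∃ Φ : PartialDiffeomorph 𝓘(ℝ, E) 𝓘(ℝ, G) E G ∞, u ∈ Φ.source ∧ Φ =ᶠ[𝓝 u] f ∧
      (∀ y ∈ Φ.source, ∀ r : ℝ, 0 < r → r • y ∈ Φ.source ∧ Φ (r • y) = partialDil Q r (Φ y)) ∧
      ∀ y ∈ Φ.source, ∃ r : ℝ, 0 < r ∧ S (r • y) ∧ Φ =ᶠ[𝓝 (r • y)] f := by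
  have := FiniteDimensional.complete ℝ E
  have hu0 : u ≠ 0 := by
    rintro rfl
    have := he.self_of_nhds
    rw [map_zero] at this
    exact hu this.symm
  obtain ⟨ℓ, hℓ⟩ := exists_functional_eq_one hu0
  obtain ⟨μ₀, hμ₀⟩ := exists_functional_eq_one hu
  let μ : G →L[ℝ] ℝ := μ₀.comp Q
  have hμ : μ (f u) = 1 := hμ₀
  have hμδ : ∀ r z, μ (partialDil Q r z) = r * μ z := by
    intro r z
    simp [μ, partialDil, hQ]
  obtain ⟨φ, hφ, hφu, hφf, hfφ⟩ := hf.exists_local_inverse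
    (LinearEquiv.ofBijective (fderiv ℝ f u).toLinearMap hb).toContinuousLinearEquiv
    hf.differentiableAt.hasFDerivAt
  have hφt : Tendsto φ (𝓝 (f u)) (𝓝 u) := by
    have := hφ.continuousAt
    rwa [ContinuousAt, hφu] at this
  have hfδ := eventually_smul_of_euler_partialDil hf hQ he
  have hφδ : ∀ᶠ p in 𝓝 ((1 : ℝ), f u), φ (partialDil Q p.1 p.2) = p.1 • φ p.2 := by
    have ht : Tendsto (fun p : ℝ × G => (p.1, φ p.2)) (𝓝 (1, f u)) (𝓝 (1, u)) :=
      continuousAt_fst.prodMk_nhds (hφt.comp continuousAt_snd)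
    filter_upwards [ht.eventually hfδ, continuousAt_snd.eventually hfφ,
      ((tendsto_smul_one u).comp ht).eventually hφf] with p h1 h2 h3
    simp only [Function.comp_apply] at h1 h3
    rw [h1, h2] at h3
    exact h3
  -- Both maps are normalized by a functional of degree one on their own side, which makes them
  -- exactly homogeneous while near the base points they agree with `f` and `φ`.
  let f' : E → G := fun y => partialDil Q (ℓ y) (f ((ℓ y)⁻¹ • y))
  let φ' : G → E := fun z => μ z • φ (partialDil Q (μ z)⁻¹ z)
  have hf'δ : ∀ r : ℝ, r ≠ 0 → ∀ y, f' (r • y) = partialDil Q r (f' y) := by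
    intro r hr y
    simp only [f', map_smul, smul_eq_mul, partialDil_mul hQ, mul_inv_rev, smul_smul]
    rw [mul_assoc, inv_mul_cancel₀ hr, mul_one]
  have hφ'δ : ∀ r : ℝ, r ≠ 0 → ∀ z, φ' (partialDil Q r z) = r • φ' z := by
    intro r hr z
    simp only [φ', hμδ, partialDil_mul hQ, mul_inv_rev, smul_smul]
    rw [mul_assoc, inv_mul_cancel₀ hr, mul_one]
  have hf'f : ∀ᶠ y in 𝓝 u, f' y = f y := by
    have hℓc : ContinuousAt ℓ u := ℓ.continuous.continuousAt
    have ht : Tendsto (fun y => (ℓ y, (ℓ y)⁻¹ • y)) (𝓝 u) (𝓝 (1, u)) := by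
      refine Tendsto.prodMk_nhds ?_ (tendsto_normalize_smul hℓc hℓ)
      rw [← hℓ]; exact hℓc
    filter_upwards [ht.eventually hfδ, hℓc.eventually_ne (by rw [hℓ]; exact one_ne_zero)]
      with y h1 h2
    simp only [smul_inv_smul₀ h2] at h1
    exact h1.symm
  have hφ'φ : ∀ᶠ z in 𝓝 (f u), φ' z = φ z := by
    have hμc : ContinuousAt μ (f u) := μ.continuous.continuousAt
    have ht : Tendsto (fun z => (μ z, partialDil Q (μ z)⁻¹ z)) (𝓝 (f u)) (𝓝 (1, f u)) := by
      refine Tendsto.prodMk_nhds ?_ ((tendsto_partialDil (f u)).comp (tendsto_normalize hμc hμ))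
      rw [← hμ]; exact hμc
    filter_upwards [ht.eventually hφδ, hμc.eventually_ne (by rw [hμ]; exact one_ne_zero)]
      with z h1 h2
    simp only [partialDil_mul hQ, mul_inv_cancel₀ h2, partialDil_one] at h1
    exact h1.symm
  obtain ⟨N, hN, hNo, huN⟩ : ∃ N : Set E, (∀ y ∈ N, S y ∧ f' =ᶠ[𝓝 y] f ∧ ContDiffAt ℝ ∞ f y ∧
      φ' (f y) = y) ∧ IsOpen N ∧ u ∈ N := by
    refine eventually_nhds_iff.1 ?_
    filter_upwards [hS, eventually_eventually_nhds.2 hf'f, hf, hφf,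
      hf.continuousAt.eventually hφ'φ] with y h1 h2 h3 h4 h5
    exact ⟨h1, h2, h3, by rw [h5, h4]⟩
  obtain ⟨M, hM, hMo, huM⟩ : ∃ M : Set G, (∀ z ∈ M, φ' =ᶠ[𝓝 z] φ ∧ ContDiffAt ℝ ∞ φ z ∧
      f' (φ z) = z) ∧ IsOpen M ∧ f u ∈ M := by
    refine eventually_nhds_iff.1 ?_
    filter_upwards [eventually_eventually_nhds.2 hφ'φ, hφ, hfφ, hφt.eventually hf'f]
      with z h1 h2 h3 h4
    exact ⟨h1, h2, by rw [h4, h3]⟩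
  have hf's : ∀ y ∈ N, ContDiffAt ℝ ∞ f' y := fun y hy =>
    (hN y hy).2.2.1.congr_of_eventuallyEq (hN y hy).2.1
  have hφ's : ∀ z ∈ M, ContDiffAt ℝ ∞ φ' z := fun z hz =>
    (hM z hz).2.1.congr_of_eventuallyEq (hM z hz).1
  have hφf' : ∀ y ∈ N, φ' (f' y) = y := fun y hy => by
    rw [(hN y hy).2.1.eq_of_nhds, (hN y hy).2.2.2]
  have hfφ' : ∀ z ∈ M, f' (φ' z) = z := fun z hz => by
    rw [(hM z hz).1.eq_of_nhds, (hM z hz).2.2]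
  have hf'u : f' u = f u := hf'f.self_of_nhds
  -- On these smaller sets `f'` and `φ'` are inverse bijections; the cones `A` and `B` they generate
  -- are the source and target, and all properties reach them by homogeneity.
  let N' : Set E := N ∩ f' ⁻¹' M
  let M' : Set G := M ∩ φ' ⁻¹' N
  have hN'o : IsOpen N' :=
    ContinuousOn.isOpen_inter_preimage
      (fun y hy => (hf's y hy).continuousAt.continuousWithinAt) hNo hMo
  have hM'o : IsOpen M' :=
    ContinuousOn.isOpen_inter_preimage
      (fun z hz => (hφ's z hz).continuousAt.continuousWithinAt) hMo hNo
  have hNM : ∀ y ∈ N', f' y ∈ M' := fun y hy =>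
    ⟨hy.2, by rw [mem_preimage, hφf' y hy.1]; exact hy.1⟩
  have hMN : ∀ z ∈ M', φ' z ∈ N' := fun z hz =>
    ⟨hz.2, by rw [mem_preimage, hfφ' z hz.1]; exact hz.1⟩
  let A : Set E := {y | ∃ r : ℝ, 0 < r ∧ r • y ∈ N'}
  let B : Set G := {z | ∃ r : ℝ, 0 < r ∧ partialDil Q r z ∈ M'}
  have hAo : IsOpen A := by
    have : A = ⋃ (r : ℝ) (_ : 0 < r), (fun y => r • y) ⁻¹' N' := by ext; simp [A]
    rw [this]
    exact isOpen_biUnion fun r _ => hN'o.preimage (continuous_const_smul r)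
  have hBo : IsOpen B := by
    have : B = ⋃ (r : ℝ) (_ : 0 < r), partialDil Q r ⁻¹' M' := by ext; simp [B]
    rw [this]
    exact isOpen_biUnion fun r _ => hM'o.preimage (contDiff_partialDil r).continuous
  have hinvf : ∀ r : ℝ, r ≠ 0 → ∀ y, f' y = partialDil Q r⁻¹ (f' (r • y)) := by
    intro r hr y
    rw [hf'δ r hr, partialDil_mul hQ, inv_mul_cancel₀ hr, partialDil_one]
  have hinvφ : ∀ r : ℝ, r ≠ 0 → ∀ z, φ' z = r⁻¹ • φ' (partialDil Q r z) := by
    intro r hr z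
    rw [hφ'δ r hr, inv_smul_smul₀ hr]
  let Φ : PartialDiffeomorph 𝓘(ℝ, E) 𝓘(ℝ, G) E G ∞ :=
    { toFun := f'
      invFun := φ'
      source := A
      target := B
      map_source' := by
        rintro y ⟨r, hr, hy⟩
        exact ⟨r, hr, by rw [← hf'δ r hr.ne']; exact hNM _ hy⟩
      map_target' := by
        rintro z ⟨r, hr, hz⟩
        exact ⟨r, hr, by rw [← hφ'δ r hr.ne']; exact hMN _ hz⟩
      left_inv' := by
        rintro y ⟨r, hr, hy⟩
        have := hφf' _ hy.1
        rw [hf'δ r hr.ne', hφ'δ r hr.ne'] at this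
        exact smul_right_injective E hr.ne' this
      right_inv' := by
        rintro z ⟨r, hr, hz⟩
        have := hfφ' _ hz.1
        rw [hinvφ r hr.ne', hinvf r hr.ne', smul_inv_smul₀ hr.ne', this, partialDil_mul hQ,
          inv_mul_cancel₀ hr.ne', partialDil_one]
      open_source := hAo
      open_target := hBo
      contMDiffOn_toFun := by
        rw [contMDiffOn_iff_contDiffOn]
        rintro y ⟨r, hr, hy⟩
        rw [show f' = fun y => partialDil Q r⁻¹ (f' (r • y)) from funext (hinvf r hr.ne')]
        exact ((contDiff_partialDil _).contDiffAt.comp y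
          ((hf's _ hy.1).comp y (contDiff_const_smul r).contDiffAt)).contDiffWithinAt
      contMDiffOn_invFun := by
        rw [contMDiffOn_iff_contDiffOn]
        rintro z ⟨r, hr, hz⟩
        rw [show φ' = fun z => r⁻¹ • φ' (partialDil Q r z) from funext (hinvφ r hr.ne')]
        exact ((contDiff_const_smul _).contDiffAt.comp z
          ((hφ's _ hz.1).comp z (contDiff_partialDil r).contDiffAt)).contDiffWithinAt }
  have hN'u : u ∈ N' := ⟨huN, by rw [mem_preimage, hf'u]; exact huM⟩
  refine ⟨Φ, ⟨1, one_pos, by rwa [one_smul]⟩, hf'f, ?_, ?_⟩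
  · rintro y ⟨s, hs, hy⟩ r hr
    exact ⟨⟨s * r⁻¹, by positivity, by rwa [smul_smul, inv_mul_cancel_right₀ hr.ne']⟩,
      hf'δ r hr.ne' y⟩
  · rintro y ⟨r, hr, hy⟩
    exact ⟨r, hr, (hN _ hy.1).1, (hN _ hy.1).2.1⟩

end HomogeneousDiffeo

/-! ### Homogeneous canonical coordinates on a cone -/

section Model

/-- Carries knowledge of a derivative at a dilated point back along the ray to `p`. -/
theorem hasFDerivAt_of_eventually_eq_smul_comp {G H : Type*} [NormedAddCommGroup G]
    [NormedSpace ℝ G] [NormedAddCommGroup H] [NormedSpace ℝ H] {Q : G →L[ℝ] G} {f : G → H} {p : G}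
    {r c : ℝ} (h : ∀ᶠ p' in 𝓝 p, f p' = c • f (partialDil Q r p')) {L : G →L[ℝ] H}
    (hL : HasFDerivAt f L (partialDil Q r p)) :
    ∀ w, fderiv ℝ f p w = c • L (partialDil Q r w) := by
  intro w
  have h1 : HasFDerivAt (partialDil Q r) _ p :=
    ((hasFDerivAt_id p).fun_sub Q.hasFDerivAt).fun_add (Q.hasFDerivAt.const_smul r)
  have h2 := ((HasFDerivAt.comp (g := f) p hL h1).const_smul c).congr_of_eventuallyEq h
  rw [h2.fderiv]
  simp [partialDil]

variable {E F : Type*} [NormedAddCommGroup E] [NormedSpace ℝ E] [FiniteDimensional ℝ E]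
  [NormedAddCommGroup F] [NormedSpace ℝ F] [FiniteDimensional ℝ F]

theorem stdForm_weights {n : ℕ} (r : ℝ) (a b : CotCoord n) :
    stdForm n (a.1, r • a.2) (b.1, r • b.2) = r * stdForm n a b := by
  simp only [stdForm, Pi.smul_apply, smul_eq_mul, Finset.mul_sum]
  exact Finset.sum_congr rfl fun i _ => by ring

/-- Darboux coordinates of a Liouville germ extend to homogeneous canonical coordinates on a
cone. -/
theorem LiouvilleGerm.exists_homogeneous_canonical {n : ℕ} (hF : Module.finrank ℝ F = 2 * n)
    {θ : F → F →L[ℝ] ℝ} {u : F} (hθ : LiouvilleGerm θ u) {x ξ : Fin n → F → ℝ}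
    (hx : ∀ i, EvSmooth (x i) u) (hξ : ∀ i, EvSmooth (ξ i) u)
    (hξu : (fun i => ξ i u) ≠ 0)
    (hdar : ∀ᶠ y in 𝓝 u, ∀ b, θ y b = ∑ i, ξ i y * fderiv ℝ (x i) y b)
    {σ : F → F → F → ℝ} (hσ : ∀ᶠ z in 𝓝 u, ∀ b c, σ z b c = ed θ z b c)
    (hσh : ∀ᶠ z in 𝓝 u, ∀ r : ℝ, 0 < r → ∀ b c, σ (r • z) b c = r⁻¹ * σ z b c) :
    ∃ Ψ : PartialDiffeomorph 𝓘(ℝ, F) 𝓘(ℝ, CotCoord n) F (CotCoord n) ∞, u ∈ Ψ.source ∧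
      Ψ =ᶠ[𝓝 u] (fun z => (fun i => x i z, fun i => ξ i z)) ∧
      ∀ z ∈ Ψ.source, (Ψ z).2 ≠ 0 ∧
        (∀ r : ℝ, 0 < r → r • z ∈ Ψ.source ∧ Ψ (r • z) = ((Ψ z).1, r • (Ψ z).2)) ∧
        ∀ b c, σ z b c = stdForm n (fderiv ℝ Ψ z b) (fderiv ℝ Ψ z c) := by
  let Q : CotCoord n →L[ℝ] CotCoord n :=
    (ContinuousLinearMap.inr ℝ _ _).comp (ContinuousLinearMap.snd ℝ _ _)
  have hQ : ∀ z, Q z = (0, z.2) := fun z => rfl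
  have hδ : ∀ r z, partialDil Q r z = (z.1, r • z.2) := by
    intro r z
    rw [partialDil, hQ]
    ext <;> simp
  let f : F → CotCoord n := fun z => (fun i => x i z, fun i => ξ i z)
  have hf : EvSmooth f u := (EvSmooth.pi hx).prodMk (EvSmooth.pi hξ)
  have hdf : ∀ᶠ z in 𝓝 u, ∀ b, fderiv ℝ f z b =
      (fun i => fderiv ℝ (x i) z b, fun i => fderiv ℝ (ξ i) z b) := by
    filter_upwards [eventually_all.2 fun i => (hx i).eventually_differentiableAt,
      eventually_all.2 fun i => (hξ i).eventually_differentiableAt] with z h1 h2 b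
    have h3 : HasFDerivAt f _ z := (hasFDerivAt_pi.2 fun i => (h1 i).hasFDerivAt).prodMk
      (hasFDerivAt_pi.2 fun i => (h2 i).hasFDerivAt)
    rw [h3.fderiv]
    rfl
  have hs : Function.Surjective (fderiv ℝ f u).toLinearMap := by
    intro p
    obtain ⟨b, hb⟩ := (eventually_darboux_surjective hF hθ hx hξ hdar).self_of_nhds p.1 p.2
    refine ⟨b, (hdf.self_of_nhds b).trans ?_⟩
    ext i
    · exact (hb i).1
    · exact (hb i).2
  have hb : Function.Bijective (fderiv ℝ f u) :=
    ⟨(LinearMap.injective_iff_surjective_of_finrank_eq_finrank (by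
      rw [hF, Module.finrank_prod, Module.finrank_fintype_fun_eq_card, Fintype.card_fin,
        two_mul])).2 hs, hs⟩
  have he : ∀ᶠ z in 𝓝 u, fderiv ℝ f z z = Q (f z) := by
    filter_upwards [hdf, eventually_darboux_euler hF hθ hx hξ hdar] with z h1 h2
    rw [h1, hQ]
    ext i
    · exact (h2 i).1
    · exact (h2 i).2
  have hQu : Q (f u) ≠ 0 := fun h => hξu (congrArg Prod.snd h)
  have hξ0 : ∀ᶠ z in 𝓝 u, (f z).2 ≠ 0 := hf.snd.continuousAt.eventually_ne hξu
  -- The local identities go into the property `S`: every point of the source then has a dilate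
  -- where they hold and `Ψ` is given by the Darboux coordinates. Weights bring the conclusions
  -- back.
  obtain ⟨Ψ, hu, hΨu, hΨh, hΨ⟩ := exists_homogeneous_diffeo hf hb (fun _ => rfl) he hQu
    (hξ0.and (hσ.and (hσh.and (hdf.and (eventually_ed_eq_sum hx hξ hdar)))))
  refine ⟨Ψ, hu, hΨu, fun z hz => ?_⟩
  obtain ⟨r, hr, ⟨h2, h3, h4, h5, h6⟩, h7⟩ := hΨ z hz
  have hzd : DifferentiableAt ℝ Ψ z :=
    ((Ψ.mdifferentiableAt (by simp) hz : MDifferentiableAt _ _ _ _)).differentiableAt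
  refine ⟨?_, fun s hs => ?_, fun b c => ?_⟩
  · rw [← h7.eq_of_nhds, (hΨh z hz r hr).2, hδ] at h2
    intro h0
    rw [h0, smul_zero] at h2
    exact h2 rfl
  · rw [← hδ]
    exact hΨh z hz s hs
  · have h8 : ∀ a, fderiv ℝ Ψ (r • z) (r • a) = ((fderiv ℝ Ψ z a).1, r • (fderiv ℝ Ψ z a).2) := by
      intro a
      have h9 : (fun y => Ψ (r • y)) =ᶠ[𝓝 z] fun y => ((Ψ y).1, r • (Ψ y).2) := by
        filter_upwards [Ψ.open_source.mem_nhds hz] with y hy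
        rw [(hΨh y hy r hr).2, hδ]
      have h10 := congrArg (fun L => L a) (h9.fderiv_eq (𝕜 := ℝ))
      rw [fderiv_comp_smul] at h10
      have h11 : HasFDerivAt (fun y => ((Ψ y).1, r • (Ψ y).2)) _ z :=
        (HasFDerivAt.fst hzd.hasFDerivAt).prodMk ((HasFDerivAt.snd hzd.hasFDerivAt).const_smul r)
      rw [h11.fderiv] at h10
      rw [map_smul]
      exact h10
    have h9 : ed θ (r • z) (r • b) (r • c) =
        r * stdForm n (fderiv ℝ Ψ z b) (fderiv ℝ Ψ z c) := by
      rw [h6, ← stdForm_weights, ← h8, ← h8, h7.fderiv_eq, h5, h5]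
      exact Finset.sum_congr rfl fun i _ => by ring
    rw [← edMap_apply, map_smul, map_smul, smul_apply, edMap_apply, smul_eq_mul,
      smul_eq_mul] at h9
    have h10 := h4 r⁻¹ (inv_pos.2 hr) b c
    rw [inv_smul_smul₀ hr.ne', h3, inv_inv] at h10
    rw [h10]
    exact mul_left_cancel₀ hr.ne' h9

end Model

/-! ### The normal form for homogeneous maps between vector spaces -/

section ModelTheorem

/-- The projection onto the coordinates `τ` of `CrossCoord n`. -/
def tauProj (n : ℕ) : CrossCoord n →L[ℝ] CrossCoord n :=
  (ContinuousLinearMap.inr ℝ _ _).comp ((ContinuousLinearMap.inr ℝ _ _).comp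
    ((ContinuousLinearMap.snd ℝ _ _).comp (ContinuousLinearMap.snd ℝ _ _)))

theorem tauProj_apply {n : ℕ} (p : CrossCoord n) : tauProj n p = (0, 0, p.2.2) := rfl

theorem partialDil_tauProj {n : ℕ} (r : ℝ) (p : CrossCoord n) :
    partialDil (tauProj n) r p = (p.1, p.2.1, r • p.2.2.1, r • p.2.2.2) := by
  rw [partialDil, tauProj_apply]
  ext <;> simp

theorem partialDil_tauDir {n : ℕ} (r : ℝ) (j : Fin 2) :
    partialDil (tauProj n) r (CrossCoord.tauDir n j) = r • CrossCoord.tauDir n j := by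
  rw [partialDil_tauProj]
  simp [CrossCoord.tauDir]

variable {E : Type v} {F : Type u} [NormedAddCommGroup E] [NormedSpace ℝ E]
  [FiniteDimensional ℝ E] [NormedAddCommGroup F] [NormedSpace ℝ F] [FiniteDimensional ℝ F]

/-- The normal form of `g`, for a homogeneous map between open cones in vector spaces. -/
theorem CriticalGerm.exists_model_coordinates {n : ℕ} (hn : 3 ≤ n)
    (hE : Module.finrank ℝ E = 2 * n - 1) (hF : Module.finrank ℝ F = 2 * n)
    {g : E → F} {e : E} {χ : E → Fin 2 → ℝ} {θ : F → F →L[ℝ] ℝ}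
    (hχ : CriticalGerm g χ e) (hg : EvSmooth g e)
    (hgh : ∀ᶠ y in 𝓝 e, ∀ r : ℝ, 0 < r → g (r • y) = r • g y) (hge : g e ≠ 0)
    (hθ : LiouvilleGerm θ (g e))
    (hinv : ∀ᶠ y in 𝓝 e, ¬ Function.Injective (fderiv ℝ g y) → ∀ x,
      (∀ v, ed θ (g y) x (fderiv ℝ g y v) = 0) → ∃ v, fderiv ℝ g y v = x)
    {X₀ : F} (hX₀ : ∀ v, ed θ (g e) X₀ (fderiv ℝ g e v) = 0)
    (hX₀' : ∀ v, fderiv ℝ χ e v = 0 → fderiv ℝ g e v ≠ X₀)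
    (hnr : ∃ v, fderiv ℝ χ e v = 0 ∧ θ (g e) (fderiv ℝ g e v) ≠ 0)
    {σ : F → F → F → ℝ} (hσ : ∀ᶠ z in 𝓝 (g e), ∀ b c, σ z b c = ed θ z b c)
    (hσh : ∀ᶠ z in 𝓝 (g e), ∀ r : ℝ, 0 < r → ∀ b c, σ (r • z) b c = r⁻¹ * σ z b c)
    {S : E → Prop} (hS : ∀ᶠ y in 𝓝 e, S y) :
    ∃ (Φ : PartialDiffeomorph 𝓘(ℝ, E) 𝓘(ℝ, CrossCoord n) E (CrossCoord n) ∞)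
      (Ψ : PartialDiffeomorph 𝓘(ℝ, F) 𝓘(ℝ, CotCoord n) F (CotCoord n) ∞)
      (gpen γpen γlast : CrossCoord n → ℝ),
      (e ∈ Φ.source ∧ Φ e = (0, 0, unitOne (n - 2), 0) ∧
        g e ∈ Ψ.source ∧ Ψ (g e) = (0, unitOne n)) ∧
      (∀ y ∈ Φ.source, CrossCoord.taupp (Φ y) ≠ 0 ∧
        (∀ r : ℝ, 0 < r → r • y ∈ Φ.source ∧ Φ (r • y) = (CrossCoord.tpp (Φ y),
          CrossCoord.tn (Φ y), r • CrossCoord.taupp (Φ y), r • CrossCoord.tauppp (Φ y))) ∧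
        ∃ r : ℝ, 0 < r ∧ S (r • y)) ∧
      (∀ z ∈ Ψ.source, (Ψ z).2 ≠ 0 ∧
        (∀ r : ℝ, 0 < r → r • z ∈ Ψ.source ∧ Ψ (r • z) = ((Ψ z).1, r • (Ψ z).2)) ∧
        ∀ b c, σ z b c = stdForm n (fderiv ℝ Ψ z b) (fderiv ℝ Ψ z c)) ∧
      (∀ y ∈ Φ.source, g y ∈ Ψ.source ∧
        (∀ j, (Ψ (g y)).1 (idxHead j) = CrossCoord.tpp (Φ y) j) ∧
        (Ψ (g y)).1 (idxPen hn) = gpen (Φ y) ∧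
        (Ψ (g y)).1 (idxLast hn) = CrossCoord.tn (Φ y) ∧
        (∀ j, (Ψ (g y)).2 (idxHead j) = CrossCoord.taupp (Φ y) j) ∧
        (Ψ (g y)).2 (idxPen hn) = γpen (Φ y) ∧
        (Ψ (g y)).2 (idxLast hn) = γlast (Φ y)) ∧
      (∀ p ∈ Φ.target, CrossCoord.dtau 0 gpen p ≠ 0) ∧
      (∀ p ∈ Φ.target, CrossCoord.tauppp p = 0 →
        γpen p = 0 ∧ γlast p = 0 ∧
        ∀ j : Fin 2, CrossCoord.dtau j γpen p = 0 ∧ CrossCoord.dtau j γlast p = 0) := by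
  have hgh' : ∀ᶠ p in 𝓝 ((1 : ℝ), e), g (p.1 • p.2) = p.1 • g p.2 := by
    filter_upwards [continuousAt_snd.eventually hgh,
      continuousAt_fst.eventually (lt_mem_nhds one_pos)] with p h1 h2 using h1 _ h2
  obtain ⟨x, ξ, hx, hξ, hxe, hξe, hdar, hX₀ξ, hcrit⟩ := hχ.exists_adapted_darboux hn hE hF
    (by simp) hg hgh' hge hθ hinv hX₀ hX₀' hnr
  obtain ⟨a, ha, hTe, hTb, hTE, hTg, haχ⟩ := hχ.exists_cross_coordinates hn hE hF hg hgh' hge hθ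
    (hinv.self_of_nhds ((hχ.eq_zero_iff.self_of_nhds).1 hχ.eq_zero) _ hX₀) hX₀' hx hξ hxe hξe hdar
    hX₀ξ fun i hi => (hcrit.self_of_nhds hχ.eq_zero i hi).2
  have hξ0 : (fun i => ξ i (g e)) ≠ 0 := by
    intro h
    have := congrFun h ⟨0, by omega⟩
    simp [hξe, unitOne] at this
  have hunit : unitOne (n - 2) ≠ 0 := by
    intro h
    have := congrFun h ⟨0, by omega⟩
    simp [unitOne] at this
  obtain ⟨Ψ, hΨe, hΨx, hΨ⟩ := hθ.exists_homogeneous_canonical hF hx hξ hξ0 hdar hσ hσh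
  have hT := hg.crossMap hn hx hξ ha
  set T := crossMap hn x ξ g a with hTdef
  have htau : ∀ᶠ y in 𝓝 e, (T y).2.2.1 ≠ 0 :=
    hT.snd.snd.fst.continuousAt.eventually_ne (by rw [hTe]; exact hunit)
  have hgt := hg.continuousAt
  -- Everything known only near `e` is packed into `S`, so that each point of the cone has a dilate
  -- where it is available and `Φ` agrees with `T`.
  obtain ⟨Φ, hΦe, hΦT, hΦh, hΦ⟩ := exists_homogeneous_diffeo (Q := tauProj n) hT hTb
    (fun _ => rfl) hTE (by
      rw [hTe, tauProj_apply]
      intro h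
      exact hunit (congrArg (fun p : CrossCoord n => p.2.2.1) h))
    (hS.and (htau.and (hgh.and ((hgt.eventually (Ψ.open_source.mem_nhds hΨe)).and
      ((hgt.eventually (eventually_eventually_nhds.2 hΨx)).and (hg.eventually_differentiableAt.and
      ((hgt.eventually (eventually_all.2 fun i => (hx i).eventually_differentiableAt)).and
      ((hgt.eventually (eventually_all.2 fun i => (hξ i).eventually_differentiableAt)).and
      (hTg.and (haχ.and hcrit))))))))))
  have hgΦ : ∀ y ∈ Φ.source, g y ∈ Ψ.source ∧ ∀ r : ℝ, 0 < r → g (r • y) = r • g y := by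
    intro y hy
    obtain ⟨r, hr, ⟨-, -, h3, h4, -⟩, -⟩ := hΦ y hy
    have h5 : ∀ s : ℝ, 0 < s → g (s • y) = (s * r⁻¹) • g (r • y) := by
      intro s hs
      rw [← h3 _ (by positivity), smul_smul, inv_mul_cancel_right₀ hr.ne']
    have h6 := h5 1 one_pos
    rw [one_smul, one_mul] at h6
    refine ⟨?_, fun s hs => ?_⟩
    · rw [h6]
      exact ((hΨ _ h4).2.1 r⁻¹ (inv_pos.2 hr)).1
    · rw [h5 s hs, h6, smul_smul]
  have hsymm : ∀ p ∈ Φ.target, Φ.symm p ∈ Φ.source ∧ Φ (Φ.symm p) = p := fun p hp =>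
    ⟨Φ.map_target hp, Φ.right_inv hp⟩
  have hdil : ∀ p ∈ Φ.target, ∀ r : ℝ, 0 < r → partialDil (tauProj n) r p ∈ Φ.target ∧
      Φ.symm (partialDil (tauProj n) r p) = r • Φ.symm p := by
    intro p hp r hr
    obtain ⟨h1, h2⟩ := hsymm p hp
    obtain ⟨h3, h4⟩ := hΦh _ h1 r hr
    rw [h2] at h4
    rw [← h4]
    exact ⟨Φ.map_source h3, Φ.left_inv h3⟩
  let f₁ : Fin n → CrossCoord n → ℝ := fun i p => (Ψ (g (Φ.symm p))).1 i
  let f₂ : Fin n → CrossCoord n → ℝ := fun i p => (Ψ (g (Φ.symm p))).2 i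
  -- The x components have degree zero and the ξ components degree one; the factors `1` and `r⁻¹`
  -- match `hasFDerivAt_of_eventually_eq_smul_comp`.
  have hf₁ : ∀ i, ∀ p ∈ Φ.target, ∀ r : ℝ, 0 < r →
      f₁ i p = (1 : ℝ) • f₁ i (partialDil (tauProj n) r p) := by
    intro i p hp r hr
    have h1 := hgΦ _ (hsymm p hp).1
    simp only [f₁, (hdil p hp r hr).2, h1.2 r hr, ((hΨ _ h1.1).2.1 r hr).2, one_smul]
  have hf₂ : ∀ i, ∀ p ∈ Φ.target, ∀ r : ℝ, 0 < r →
      f₂ i p = r⁻¹ • f₂ i (partialDil (tauProj n) r p) := by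
    intro i p hp r hr
    have h1 := hgΦ _ (hsymm p hp).1
    simp only [f₂, (hdil p hp r hr).2, h1.2 r hr, ((hΨ _ h1.1).2.1 r hr).2, Pi.smul_apply,
      inv_smul_smul₀ hr.ne']
  have hnear : ∀ p ∈ Φ.target, ∀ᶠ p' in 𝓝 p, p' ∈ Φ.target := fun p hp =>
    Φ.open_target.mem_nhds hp
  -- the derivatives at the points where the coordinates are the given ones
  have hgood : ∀ p ∈ Φ.target, ∃ r : ℝ, 0 < r ∧ ∃ (L : Fin n → CrossCoord n →L[ℝ] ℝ)
      (L' : Fin n → CrossCoord n →L[ℝ] ℝ),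
      (∀ i, HasFDerivAt (f₁ i) (L i) (partialDil (tauProj n) r p)) ∧
      (∀ i, HasFDerivAt (f₂ i) (L' i) (partialDil (tauProj n) r p)) ∧
      L (idxPen hn) (CrossCoord.tauDir n 0) ≠ 0 ∧
      (CrossCoord.tauppp p = 0 → ∀ i, i = idxPen hn ∨ i = idxLast hn →
        f₂ i (partialDil (tauProj n) r p) = 0 ∧ ∀ w, L' i w = 0) := by
    intro p hp
    obtain ⟨hy, hyp⟩ := hsymm p hp
    obtain ⟨r, hr, ⟨-, -, -, h4, h5, h6, h7, h8, h9, h10, h11⟩, h12⟩ := hΦ _ hy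
    obtain ⟨hq, hqy⟩ := hdil p hp r hr
    rw [← hqy] at h4 h5 h6 h7 h8 h9 h10 h11 h12
    obtain ⟨hqs, hqq⟩ := hsymm _ hq
    set q := partialDil (tauProj n) r p with hqdef
    have hd : DifferentiableAt ℝ Φ.symm q :=
      (Φ.symm.mdifferentiableAt (by simp) hq).differentiableAt
    have hdg : HasFDerivAt (fun p => g (Φ.symm p)) _ q :=
      HasFDerivAt.comp (g := g) q h6.hasFDerivAt hd.hasFDerivAt
    have hΨq : ∀ᶠ p' in 𝓝 q, Ψ (g (Φ.symm p')) =
        (fun i => x i (g (Φ.symm p')), fun i => ξ i (g (Φ.symm p'))) :=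
      hdg.continuousAt.eventually h5
    have hT' : ∀ w, fderiv ℝ T (Φ.symm q) (fderiv ℝ Φ.symm q w) = w := by
      intro w
      have h13 : DifferentiableAt ℝ Φ (Φ.symm q) :=
        (Φ.mdifferentiableAt (by simp) hqs).differentiableAt
      have h14 : HasFDerivAt (fun p => Φ (Φ.symm p)) _ q :=
        HasFDerivAt.comp (g := Φ) q h13.hasFDerivAt hd.hasFDerivAt
      have h15 : HasFDerivAt (fun p => Φ (Φ.symm p)) (ContinuousLinearMap.id ℝ _) q :=
        (hasFDerivAt_id q).congr_of_eventuallyEq (by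
          filter_upwards [Φ.open_target.mem_nhds hq] with p' hp' using (hsymm p' hp').2)
      rw [← h12.fderiv_eq]
      exact congrArg (fun L : CrossCoord n →L[ℝ] CrossCoord n => L w) (h14.unique h15)
    refine ⟨r, hr, fun i => (fderiv ℝ (x i) (g (Φ.symm q))).comp
        ((fderiv ℝ g (Φ.symm q)).comp (fderiv ℝ Φ.symm q)),
      fun i => (fderiv ℝ (ξ i) (g (Φ.symm q))).comp
        ((fderiv ℝ g (Φ.symm q)).comp (fderiv ℝ Φ.symm q)), fun i => ?_, fun i => ?_, ?_, ?_⟩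
    · refine (HasFDerivAt.comp (g := x i) q (h7 i).hasFDerivAt hdg).congr_of_eventuallyEq ?_
      filter_upwards [hΨq] with p' hp'
      simp only [f₁, hp', Function.comp_apply]
    · refine (HasFDerivAt.comp (g := ξ i) q (h8 i).hasFDerivAt hdg).congr_of_eventuallyEq ?_
      filter_upwards [hΨq] with p' hp'
      simp only [f₂, hp', Function.comp_apply]
    · exact h9 _ (hT' _)
    · intro hp0 i hi
      have h13 : a (Φ.symm q) = 0 := by
        have h14 : T (Φ.symm q) = q := by rw [← h12.eq_of_nhds, hqq]
        have h15 : q.2.2.2 = r • CrossCoord.tauppp p :=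
          congrArg (fun p : CrossCoord n => p.2.2.2) (partialDil_tauProj r p)
        rw [hp0, smul_zero] at h15
        exact (congrArg (fun p : CrossCoord n => p.2.2.2) h14).trans h15
      obtain ⟨h14, h15⟩ := h11 (h10 h13) i hi
      exact ⟨(congrFun (congrArg Prod.snd hΨq.self_of_nhds) i).trans h14, fun w => h15 _⟩
  refine ⟨Φ, Ψ, f₁ (idxPen hn), f₂ (idxPen hn), f₂ (idxLast hn), ⟨hΦe, ?_, hΨe, ?_⟩, ?_, hΨ, ?_,
    ?_, ?_⟩
  · rw [hΦT.eq_of_nhds, hTe]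
  · rw [hΨx.eq_of_nhds]
    exact Prod.ext (funext hxe) (funext hξe)
  · intro y hy
    obtain ⟨r, hr, ⟨h1, h2, -⟩, h12⟩ := hΦ y hy
    refine ⟨?_, fun s hs => ?_, r, hr, h1⟩
    · rw [← h12.eq_of_nhds, (hΦh y hy r hr).2, partialDil_tauProj] at h2
      intro h0
      refine h2 ?_
      change r • CrossCoord.taupp (Φ y) = 0
      rw [h0, smul_zero]
    · obtain ⟨h3, h4⟩ := hΦh y hy s hs
      exact ⟨h3, by rw [h4, partialDil_tauProj]; rfl⟩
  · intro y hy
    obtain ⟨h1, h2⟩ := hgΦ y hy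
    obtain ⟨r, hr, ⟨-, -, -, h4, h5, -⟩, h12⟩ := hΦ y hy
    have h6 := h5.self_of_nhds
    rw [h2 r hr, ((hΨ _ h1).2.1 r hr).2, ← h2 r hr] at h6
    have h7 := h12.eq_of_nhds
    rw [(hΦh y hy r hr).2, partialDil_tauProj] at h7
    have h8 : Φ.symm (Φ y) = y := Φ.left_inv hy
    refine ⟨h1, fun j => ?_, ?_, ?_, fun j => ?_, ?_, ?_⟩
    · exact (congrFun (congrArg Prod.fst h6) (idxHead j)).trans
        (congrFun (congrArg (fun p : CrossCoord n => p.1) h7) j).symm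
    · simp only [f₁, h8]
    · exact (congrFun (congrArg Prod.fst h6) (idxLast hn)).trans
        (congrArg (fun p : CrossCoord n => p.2.1) h7).symm
    · exact mul_left_cancel₀ hr.ne' ((congrFun (congrArg Prod.snd h6) (idxHead j)).trans
        (congrFun (congrArg (fun p : CrossCoord n => p.2.2.1) h7) j).symm)
    · simp only [f₂, h8]
    · simp only [f₂, h8]
  · intro p hp
    obtain ⟨r, hr, L, -, hL, -, hL0, -⟩ := hgood p hp
    rw [CrossCoord.dtau, hasFDerivAt_of_eventually_eq_smul_comp
      ((hnear p hp).mono fun p' hp' => hf₁ _ p' hp' r hr) (hL _), partialDil_tauDir,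
      map_smul, one_smul]
    exact smul_ne_zero hr.ne' hL0
  · intro p hp hp0
    obtain ⟨r, hr, -, L', -, hL', -, hL0⟩ := hgood p hp
    have h1 : ∀ i, i = idxPen hn ∨ i = idxLast hn → f₂ i p = 0 ∧
        ∀ j, CrossCoord.dtau j (f₂ i) p = 0 := by
      intro i hi
      obtain ⟨h2, h3⟩ := hL0 hp0 i hi
      refine ⟨by rw [hf₂ i p hp r hr, h2, smul_zero], fun j => ?_⟩
      rw [CrossCoord.dtau, hasFDerivAt_of_eventually_eq_smul_comp
        ((hnear p hp).mono fun p' hp' => hf₂ _ p' hp' r hr) (hL' _), h3, smul_zero]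
    exact ⟨(h1 _ (Or.inl rfl)).1, (h1 _ (Or.inr rfl)).1, fun j =>
      ⟨(h1 _ (Or.inl rfl)).2 j, (h1 _ (Or.inr rfl)).2 j⟩⟩

end ModelTheorem

/-! ### Alternating forms of degree two and their homogeneous primitive -/

theorem alt_swap {T : Type*} [AddCommGroup T] [Module ℝ T] [TopologicalSpace T]
    (w : T [⋀^Fin 2]→L[ℝ] ℝ) (a b : T) : w ![a, b] = - w ![b, a] := by
  have h : w (![b, a] ∘ Equiv.swap (0 : Fin 2) 1) = - w ![b, a] :=
    w.toAlternatingMap.map_swap ![b, a] (i := 0) (j := 1) (by decide)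
  rw [← h]
  congr 1
  ext i
  fin_cases i <;> rfl

section Forms

variable {F : Type*} [NormedAddCommGroup F] [NormedSpace ℝ F]

/-- The bilinear map of an alternating form of degree two. -/
noncomputable def altBil : (F [⋀^Fin 2]→L[ℝ] ℝ) →L[ℝ] F →L[ℝ] F →L[ℝ] ℝ :=
  (ContinuousLinearMap.compL ℝ F (F [⋀^Fin 1]→L[ℝ] ℝ) (F →L[ℝ] ℝ)
    ((ContinuousAlternatingMap.ofSubsingletonLIE (𝕜 := ℝ) (E := F) (F := ℝ) (0 : Fin 1)).symm :
      (F [⋀^Fin 1]→L[ℝ] ℝ) →L[ℝ] F →L[ℝ] ℝ)).comp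
    ContinuousAlternatingMap.curryLeftLI.toContinuousLinearMap

theorem altBil_apply (w : F [⋀^Fin 2]→L[ℝ] ℝ) (a b : F) : altBil w a b = w ![a, b] := by
  change w _ = w _
  congr 1
  ext i
  fin_cases i <;> rfl

theorem hasFDerivAt_altBil_comp {η : F → F [⋀^Fin 2]→L[ℝ] ℝ} {z : F}
    (hd : DifferentiableAt ℝ η z) :
    HasFDerivAt (fun z => altBil (η z)) (altBil.comp (fderiv ℝ η z)) z :=
  HasFDerivAt.comp (g := fun w => altBil w) z
    (ContinuousLinearMap.hasFDerivAt (𝕜 := ℝ) (E := F [⋀^Fin 2]→L[ℝ] ℝ)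
      (F := F →L[ℝ] F →L[ℝ] ℝ) altBil) hd.hasFDerivAt

theorem EvSmooth.altBil {η : F → F [⋀^Fin 2]→L[ℝ] ℝ} {z : F} (h : EvSmooth η z) :
    EvSmooth (fun z => altBil (η z)) z :=
  EvSmooth.comp (f := fun w => _root_.altBil w)
    (EvSmooth.clm (E := F [⋀^Fin 2]→L[ℝ] ℝ) (F := F →L[ℝ] F →L[ℝ] ℝ) _root_.altBil) h

theorem altBil_closed {η : F → F [⋀^Fin 2]→L[ℝ] ℝ} {z : F} (hd : DifferentiableAt ℝ η z)
    (h : extDeriv η z = 0) (a b c : F) :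
    fderiv ℝ (fun z => altBil (η z)) z a b c - fderiv ℝ (fun z => altBil (η z)) z b a c +
      fderiv ℝ (fun z => altBil (η z)) z c a b = 0 := by
  have h1 : ∀ x y w : F, fderiv ℝ (fun z => altBil (η z)) z x y w =
      fderiv ℝ (fun z => η z ![y, w]) z x := by
    intro x y w
    have h2 := hasFDerivAt_altBil_comp hd
    rw [h2.fderiv, fderiv_continuousAlternatingMap_apply_const_apply hd]
    exact altBil_apply _ _ _
  have h2 := congrArg (fun L : F [⋀^Fin 3]→L[ℝ] ℝ => L ![a, b, c]) h
  rw [extDeriv_apply hd] at h2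
  replace h2 := (Fin.sum_univ_three _).symm.trans h2
  have e0 : (0 : Fin 3).removeNth ![a, b, c] = ![b, c] := by
    ext i; fin_cases i <;> rfl
  have e1 : (1 : Fin 3).removeNth ![a, b, c] = ![a, c] := by
    ext i; fin_cases i <;> rfl
  have e2 : (2 : Fin 3).removeNth ![a, b, c] = ![a, b] := by
    ext i; fin_cases i <;> rfl
  simp only [e0, e1, e2] at h2
  simp only [h1]
  simpa [sub_eq_add_neg] using h2

/-- The contraction of a closed form of degree two, homogeneous of degree one, by the Euler field is
a primitive of it. -/
theorem LiouvilleGerm.of_form {η : F → F [⋀^Fin 2]→L[ℝ] ℝ} {u : F}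
    (hβ : EvSmooth (fun z => altBil (η z)) u) (hd : ∀ᶠ z in 𝓝 u, DifferentiableAt ℝ η z)
    (hclosed : ∀ᶠ z in 𝓝 u, extDeriv η z = 0)
    (hhom : ∀ᶠ z in 𝓝 u, ∀ r : ℝ, 0 < r → ∀ b c, η (r • z) ![b, c] = r⁻¹ * η z ![b, c])
    (hnd : ∀ a, (∀ b, η u ![a, b] = 0) → a = 0) :
    LiouvilleGerm (fun z => altBil (η z) z) u ∧
      ∀ᶠ z in 𝓝 u, ∀ b c, η z ![b, c] = ed (fun z => altBil (η z) z) z b c := by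
  have hed : ∀ᶠ z in 𝓝 u, ∀ b c, η z ![b, c] = ed (fun z => altBil (η z) z) z b c := by
    filter_upwards [hβ.eventually_differentiableAt, hd, hclosed, hhom] with z h1 h2 h3 h4 b c
    have h5 := h1.hasFDerivAt.clm_apply (hasFDerivAt_id z)
    -- On constant vectors the coefficients have degree -1. In the exterior derivative of the
    -- contraction, closedness turns the derivative terms into this radial derivative `-η(b, c)`,
    -- and the two zeroth-order terms give `2 η(b, c)`.
    have h6 : fderiv ℝ (fun z => altBil (η z)) z z b c = - η z ![b, c] := by
      have h7 := hasDerivAt_comp_smul (f := fun z => altBil (η z)) (s := 1) (y := z)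
        (by rwa [one_smul])
      rw [one_smul] at h7
      have h8 : HasDerivAt (fun s : ℝ => altBil (η (s • z)) b c)
          (fderiv ℝ (fun z => altBil (η z)) z z b c) 1 := by
        have h9 := h7.clm_apply (hasDerivAt_const 1 b)
        have h10 := h9.clm_apply (hasDerivAt_const 1 c)
        simpa using h10
      have h9 : HasDerivAt (fun s : ℝ => s⁻¹ * η z ![b, c]) (- η z ![b, c]) 1 := by
        simpa using (hasDerivAt_inv (one_ne_zero (α := ℝ))).mul_const (η z ![b, c])
      refine h8.unique (h9.congr_of_eventuallyEq ?_)
      filter_upwards [lt_mem_nhds one_pos] with s hs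
      rw [altBil_apply, h4 s hs]
    have h7 := altBil_closed h2 h3 z b c
    simp only [id] at h5
    simp only [ed, h5.fderiv, add_apply, ContinuousLinearMap.comp_apply,
      ContinuousLinearMap.flip_apply, ContinuousLinearMap.id_apply, altBil_apply]
    have h8 : ∀ x y w, fderiv ℝ (fun z => altBil (η z)) z x y w =
        - fderiv ℝ (fun z => altBil (η z)) z x w y := by
      intro x y w
      have h9 := hasFDerivAt_altBil_comp h2
      rw [h9.fderiv]
      simp only [ContinuousLinearMap.comp_apply, altBil_apply]
      exact alt_swap _ _ _
    rw [alt_swap _ c b]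
    linarith
  refine ⟨⟨hβ.clm_apply EvSmooth.id', ?_, ?_⟩, hed⟩
  · filter_upwards [hed] with z h1 b
    rw [← h1, altBil_apply]
  · intro a ha
    exact hnd a fun b => by rw [hed.self_of_nhds, ha]

/-- Moves smoothness and closedness from the atlas charts, where they are assumed, to a cone chart;
`φ` is then the transition map. -/
theorem eventually_closed_pullback {φ : F → F} {η κ : F → F [⋀^Fin 2]→L[ℝ] ℝ} {u : F}
    (hφ : EvSmooth φ u) (hκ : EvSmooth κ (φ u)) (hclosed : ∀ᶠ z in 𝓝 (φ u), extDeriv κ z = 0)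
    (h : ∀ᶠ z in 𝓝 u, η z = (κ (φ z)).compContinuousLinearMap (fderiv ℝ φ z)) :
    EvSmooth (fun z => altBil (η z)) u ∧ (∀ᶠ z in 𝓝 u, DifferentiableAt ℝ η z) ∧
      ∀ᶠ z in 𝓝 u, extDeriv η z = 0 := by
  have h' := eventually_eventually_nhds.2 h
  refine ⟨?_, ?_, ?_⟩
  · have h1 : EvSmooth (fun z => ((ContinuousLinearMap.compL ℝ F F ℝ).flip (fderiv ℝ φ z)).comp
        ((altBil (κ (φ z))).comp (fderiv ℝ φ z))) u :=
      (EvSmooth.comp (EvSmooth.clm _) hφ.fderiv).clm_comp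
        (EvSmooth.clm_comp (f := fun z => altBil (κ (φ z)))
          (EvSmooth.altBil (EvSmooth.comp hκ hφ)) hφ.fderiv)
    refine h1.congr ?_
    filter_upwards [h] with z hz
    refine ContinuousLinearMap.ext fun a => ContinuousLinearMap.ext fun b => ?_
    rw [hz, altBil_apply, ContinuousAlternatingMap.compContinuousLinearMap_apply]
    refine Eq.trans ?_ (altBil_apply _ _ _).symm
    congr 1
    ext i
    fin_cases i <;> rfl
  · filter_upwards [h', hφ.fderiv.eventually_differentiableAt, hφ.eventually_differentiableAt,
      hφ.continuousAt.eventually hκ.eventually_differentiableAt] with z h1 h2 h3 h4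
    have h5 : DifferentiableAt ℝ (fun z => κ (φ z)) z := h4.comp z h3
    exact (h5.hasFDerivAt.continuousAlternatingMapCompContinuousLinearMap
      h2.hasFDerivAt).differentiableAt.congr_of_eventuallyEq h1
  · filter_upwards [h', hφ, hφ.continuousAt.eventually hκ.eventually_differentiableAt,
      hφ.continuousAt.eventually hclosed] with z h1 h2 h3 h4
    rw [Filter.EventuallyEq.extDeriv_eq h1, extDeriv_pullback h3 h2 (by
      rw [minSmoothness_of_isRCLikeNormedField]
      exact WithTop.coe_le_coe.2 le_top), h4]
    ext
    simp

end Forms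

/-! ### The dimension count for annihilators -/

section RankLemma

variable {T : Type*} [AddCommGroup T] [Module ℝ T] [TopologicalSpace T] [FiniteDimensional ℝ T]

/-- The annihilator is the kernel of the map from `T` to the dual of `W` induced by σ; nondegeneracy
plays no role. -/
theorem finrank_le_add_annihilator2 (σ : T [⋀^Fin 2]→L[ℝ] ℝ) (W : Submodule ℝ T) :
    Module.finrank ℝ T ≤ Module.finrank ℝ W + Module.finrank ℝ (annihilator2 σ W) := by
  let M : T →ₗ[ℝ] Module.Dual ℝ W := LinearMap.mk₂ ℝ (fun a (b : W) => σ ![a, b])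
    (fun a a' b => σ.vecCons_add ![(b : T)] a a') (fun c a b => σ.vecCons_smul ![(b : T)] c a)
    (fun a b b' => by
      rw [alt_swap, alt_swap _ _ (b : T), alt_swap _ _ (b' : T)]
      have h2 := σ.vecCons_add ![a] (b : T) (b' : T)
      rw [← neg_add]
      exact congrArg Neg.neg h2)
    (fun c a b => by
      rw [alt_swap, alt_swap _ _ (b : T), smul_neg]
      exact congrArg Neg.neg (σ.vecCons_smul ![a] c (b : T)))
  have hker : LinearMap.ker M = annihilator2 σ W := by
    ext a
    constructor
    · intro ha b hb
      exact congrArg (fun L : Module.Dual ℝ W => L ⟨b, hb⟩) ha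
    · intro ha
      exact LinearMap.ext fun b => ha b b.2
  have h1 := LinearMap.finrank_range_add_finrank_ker M
  have h2 := Submodule.finrank_le (LinearMap.range M)
  rw [Subspace.dual_finrank_eq] at h2
  rw [hker] at h1
  omega

omit [FiniteDimensional ℝ T] in
theorem annihilator2_anti (σ : T [⋀^Fin 2]→L[ℝ] ℝ) {W W' : Submodule ℝ T} (h : W' ≤ W) :
    annihilator2 σ W ≤ annihilator2 σ W' := fun _ ha b hb => ha b (h hb)

/-- If the restriction of `σ` to a subspace of `W₁` has rank `2 n - 4`, then the annihilator of
`W` is not contained in `W₁`. -/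
theorem exists_annihilator_not_mem {n : ℕ} (σ : T [⋀^Fin 2]→L[ℝ] ℝ) {W' W₁ W : Submodule ℝ T}
    (h1 : W' ≤ W₁) (h2 : W₁ ≤ W) (hn : 3 ≤ n) (hT : Module.finrank ℝ T = 2 * n)
    (hW : Module.finrank ℝ W ≤ 2 * n - 2) (hW₁ : Module.finrank ℝ W₁ ≤ 2 * n - 3)
    (hrank : rankOn σ W' = 2 * n - 4) : ∃ X ∈ annihilator2 σ W, X ∉ W₁ := by
  -- Otherwise the annihilator of `W`, of dimension at least 2, lies in `W₁ ⊓ annihilator2 σ W'`.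
  -- The latter meets `W'` in the radical, so its sum with `W'` has dimension at least (2n - 4) + 2,
  -- too large for `W₁`.
  by_contra! h
  have h3 : annihilator2 σ W ≤ W₁ ⊓ annihilator2 σ W' :=
    le_inf h (annihilator2_anti σ (h1.trans h2))
  have h4 := Submodule.finrank_mono h3
  have h5 := finrank_le_add_annihilator2 σ W
  have h6 := Submodule.finrank_sup_add_finrank_inf_eq W' (W₁ ⊓ annihilator2 σ W')
  rw [← inf_assoc, inf_eq_left.2 h1] at h6
  have h7 := Submodule.finrank_mono (sup_le h1 (inf_le_left : W₁ ⊓ annihilator2 σ W' ≤ W₁))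
  have h8 : Module.finrank ℝ W' - Module.finrank ℝ ↥(W' ⊓ annihilator2 σ W') = 2 * n - 4 := hrank
  omega

end RankLemma

/-! ### Differentials of partial diffeomorphisms -/

section TangentMaps

variable {E F G V U X : Type*} [NormedAddCommGroup E] [NormedSpace ℝ E]
  [NormedAddCommGroup F] [NormedSpace ℝ F] [NormedAddCommGroup G] [NormedSpace ℝ G]
  [TopologicalSpace V] [ChartedSpace E V] [TopologicalSpace U] [ChartedSpace F U]
  [TopologicalSpace X] [ChartedSpace G X]

/-- The differential of `f` at `v`, as a map between the model spaces. -/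
noncomputable def tderiv (f : V → U) (v : V) : E →L[ℝ] F := mfderiv 𝓘(ℝ, E) 𝓘(ℝ, F) f v

theorem tderiv_comp {h : U → X} {f : V → U} {v : V}
    (hh : MDifferentiableAt 𝓘(ℝ, F) 𝓘(ℝ, G) h (f v))
    (hf : MDifferentiableAt 𝓘(ℝ, E) 𝓘(ℝ, F) f v) :
    tderiv (fun v => h (f v)) v = (tderiv h (f v) : F →L[ℝ] G).comp (tderiv f v : E →L[ℝ] F) :=
  mfderiv_comp v hh hf

theorem tderiv_congr {f f' : V → U} {v : V} (h : f =ᶠ[𝓝 v] f') :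
    (tderiv f v : E →L[ℝ] F) = tderiv f' v := h.mfderiv_eq

theorem tderiv_eq_fderiv (f : E → F) (y : E) : tderiv f y = fderiv ℝ f y := mfderiv_eq_fderiv

theorem tderiv_id' (v : V) : (tderiv (fun v : V => v) v : E →L[ℝ] E) =
    ContinuousLinearMap.id ℝ E := mfderiv_id

variable (c : PartialDiffeomorph 𝓘(ℝ, E) 𝓘(ℝ, F) V U ∞)

theorem PartialDiffeomorph.mdiffAt {v : V} (hv : v ∈ c.source) :
    MDifferentiableAt 𝓘(ℝ, E) 𝓘(ℝ, F) c v := c.mdifferentiableAt (by simp) hv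

theorem PartialDiffeomorph.contMDiffAt {v : V} (hv : v ∈ c.source) :
    ContMDiffAt 𝓘(ℝ, E) 𝓘(ℝ, F) ∞ c v := c.contMDiffOn.contMDiffAt (c.open_source.mem_nhds hv)

theorem PartialDiffeomorph.eventually_left_inv {v : V} (hv : v ∈ c.source) :
    ∀ᶠ v in 𝓝 v, c.symm (c v) = v := by
  filter_upwards [c.open_source.mem_nhds hv] with v hv using c.left_inv hv

theorem PartialDiffeomorph.symm_mem {u : U} (hu : u ∈ c.target) : c.symm u ∈ c.source :=
  c.map_target hu

theorem PartialDiffeomorph.apply_symm {u : U} (hu : u ∈ c.target) : c (c.symm u) = u :=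
  c.right_inv hu

theorem PartialDiffeomorph.symm_apply {v : V} (hv : v ∈ c.source) : c.symm (c v) = v :=
  c.left_inv hv

theorem PartialDiffeomorph.tderiv_symm_tderiv {v : V} (hv : v ∈ c.source) (a : E) :
    (tderiv c.symm (c v) : F →L[ℝ] E) ((tderiv c v : E →L[ℝ] F) a) = a := by
  have h := tderiv_comp (c.symm.mdiffAt (c.map_source hv)) (c.mdiffAt hv)
  rw [tderiv_congr (c.eventually_left_inv hv), tderiv_id'] at h
  exact (congrArg (fun L : E →L[ℝ] E => L a) h).symm

theorem PartialDiffeomorph.tderiv_tderiv_symm {v : V} (hv : v ∈ c.source) (b : F) :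
    (tderiv c v : E →L[ℝ] F) ((tderiv c.symm (c v) : F →L[ℝ] E) b) = b := by
  have h := c.symm.tderiv_symm_tderiv (c.map_source hv) b
  have h' : c.symm (c v) = v := c.left_inv hv
  rw [h'] at h
  exact h

theorem PartialDiffeomorph.bijective_tderiv {v : V} (hv : v ∈ c.source) :
    Function.Bijective (tderiv c v : E →L[ℝ] F) :=
  ⟨Function.LeftInverse.injective (c.tderiv_symm_tderiv hv),
    Function.RightInverse.surjective (c.tderiv_tderiv_symm hv)⟩

theorem PartialDiffeomorph.continuousAt {v : V} (hv : v ∈ c.source) : ContinuousAt c v :=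
  (c.contMDiffAt hv).continuousAt

theorem evSmooth_of_contMDiffAt {f : E → F} {y : E} (h : ∀ᶠ y in 𝓝 y,
    ContMDiffAt 𝓘(ℝ, E) 𝓘(ℝ, F) ∞ f y) : EvSmooth f y :=
  h.mono fun _ hy => hy.contDiffAt

end TangentMaps

/-! ### The symplectic form in a cone chart -/

section ConicCharts

variable {F U : Type*} [NormedAddCommGroup F] [NormedSpace ℝ F]
  [TopologicalSpace U] [ChartedSpace F U]

theorem ConicStructure.mdiffAt_dil (K : ConicStructure F U) {r : ℝ} (hr : 0 < r) (u : U) :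
    MDifferentiableAt 𝓘(ℝ, F) 𝓘(ℝ, F) (K.dil r) u := by
  have h1 : ContMDiffAt (𝓘(ℝ, ℝ).prod 𝓘(ℝ, F)) 𝓘(ℝ, F) ∞ (fun p : ℝ × U => K.dil p.1 p.2) (r, u) :=
    K.contMDiffOn_dil.contMDiffAt ((isOpen_Ioi.prod isOpen_univ).mem_nhds ⟨hr, mem_univ _⟩)
  have h2 : ContMDiffAt 𝓘(ℝ, F) (𝓘(ℝ, ℝ).prod 𝓘(ℝ, F)) ∞ (fun u : U => (r, u)) u :=
    contMDiffAt_const.prodMk contMDiffAt_id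
  have h3 := ContMDiffAt.comp (g := fun p : ℝ × U => K.dil p.1 p.2) u h1 h2
  exact h3.mdifferentiableAt (by simp)

theorem ConicStructure.mdiffAt_orbit (K : ConicStructure F U) (u : U) :
    MDifferentiableAt 𝓘(ℝ, ℝ) 𝓘(ℝ, F) (fun r => K.dil r u) 1 := by
  have h1 : ContMDiffAt (𝓘(ℝ, ℝ).prod 𝓘(ℝ, F)) 𝓘(ℝ, F) ∞ (fun p : ℝ × U => K.dil p.1 p.2) (1, u) :=
    K.contMDiffOn_dil.contMDiffAt
      ((isOpen_Ioi.prod isOpen_univ).mem_nhds ⟨one_pos (α := ℝ), mem_univ _⟩)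
  have h2 : ContMDiffAt 𝓘(ℝ, ℝ) (𝓘(ℝ, ℝ).prod 𝓘(ℝ, F)) ∞ (fun r : ℝ => (r, u)) 1 :=
    contMDiffAt_id.prodMk contMDiffAt_const
  have h3 := ContMDiffAt.comp (g := fun p : ℝ × U => K.dil p.1 p.2) (1 : ℝ) h1 h2
  exact h3.mdifferentiableAt (by simp)

/-- A chart onto an open cone, in which the dilations are the multiplications by scalars. -/
def ConicStructure.IsConeChart (K : ConicStructure F U)
    (c : PartialDiffeomorph 𝓘(ℝ, F) 𝓘(ℝ, F) U F ∞) : Prop :=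
  (0 : F) ∉ c.target ∧
    ∀ w ∈ c.source, ∀ r : ℝ, 0 < r → K.dil r w ∈ c.source ∧ c (K.dil r w) = r • c w

variable {K : ConicStructure F U} {c : PartialDiffeomorph 𝓘(ℝ, F) 𝓘(ℝ, F) U F ∞}

theorem ConicStructure.IsConeChart.symm_smul (hc : K.IsConeChart c) {z : F} (hz : z ∈ c.target)
    {r : ℝ} (hr : 0 < r) : r • z ∈ c.target ∧ c.symm (r • z) = K.dil r (c.symm z) := by
  obtain ⟨h1, h2⟩ := hc.2 _ (c.symm_mem hz) r hr
  rw [c.apply_symm hz] at h2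
  rw [← h2]
  exact ⟨c.map_source h1, c.symm_apply h1⟩

theorem ConicStructure.IsConeChart.mem_of_dil_mem (hc : K.IsConeChart c) {u : U} {r : ℝ}
    (hr : 0 < r) (h : K.dil r u ∈ c.source) : u ∈ c.source := by
  have h1 := (hc.2 _ h r⁻¹ (inv_pos.2 hr)).1
  rwa [← K.dil_mul _ _ (inv_pos.2 hr) hr, inv_mul_cancel₀ hr.ne', K.dil_one] at h1

/-- Orbits become rays, so the radial field becomes the Euler field; hence the canonical one-form
becomes the contraction used as θ. -/
theorem ConicStructure.IsConeChart.tderiv_radial (hc : K.IsConeChart c) {u : U}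
    (hu : u ∈ c.source) : (tderiv c u : F →L[ℝ] F) (K.radial u) = c u := by
  have h1 : MDifferentiableAt 𝓘(ℝ, F) 𝓘(ℝ, F) c (K.dil 1 u) := by
    rw [K.dil_one]; exact c.mdiffAt hu
  have h2 := tderiv_comp (h := c) (f := fun r : ℝ => K.dil r u) h1 (K.mdiffAt_orbit u)
  rw [tderiv_eq_fderiv] at h2
  have h3 : HasDerivAt (fun r : ℝ => c (K.dil r u)) (c u) 1 := by
    have h4 : HasDerivAt (fun r : ℝ => r • c u) (c u) 1 := by
      simpa using (hasDerivAt_id (1 : ℝ)).smul_const (c u)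
    refine h4.congr_of_eventuallyEq ?_
    filter_upwards [lt_mem_nhds one_pos] with r hr using (hc.2 u hu r hr).2
  have h5 := congrArg (fun L : ℝ →L[ℝ] F => L 1) h2
  simp only [h3.hasFDerivAt.fderiv, ContinuousLinearMap.toSpanSingleton_apply, one_smul] at h5
  rw [h5, K.dil_one]
  rfl

/-- The pullback of a form on the manifold `U` by the map `s`. -/
noncomputable def pullForm (σ : ∀ u : U, (TangentSpace 𝓘(ℝ, F) u) [⋀^Fin 2]→L[ℝ] ℝ) (s : F → U)
    (z : F) : F [⋀^Fin 2]→L[ℝ] ℝ :=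
  ContinuousAlternatingMap.compContinuousLinearMap (show F [⋀^Fin 2]→L[ℝ] ℝ from σ (s z))
    (tderiv s z : F →L[ℝ] F)

theorem pullForm_apply (σ : ∀ u : U, (TangentSpace 𝓘(ℝ, F) u) [⋀^Fin 2]→L[ℝ] ℝ) (s : F → U)
    (z a b : F) : pullForm σ s z ![a, b] =
      σ (s z) ![(tderiv s z : F →L[ℝ] F) a, (tderiv s z : F →L[ℝ] F) b] := by
  rw [pullForm, ContinuousAlternatingMap.compContinuousLinearMap_apply]
  change σ (s z) _ = σ (s z) _
  congr 1
  ext i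
  fin_cases i <;> rfl

theorem pullForm_tderiv (σ : ∀ u : U, (TangentSpace 𝓘(ℝ, F) u) [⋀^Fin 2]→L[ℝ] ℝ) {u : U}
    (hu : u ∈ c.source) (a b : F) : pullForm σ c.symm (c u)
      ![(tderiv c u : F →L[ℝ] F) a, (tderiv c u : F →L[ℝ] F) b] = σ u ![a, b] := by
  rw [pullForm_apply, c.tderiv_symm_tderiv hu, c.tderiv_symm_tderiv hu, c.symm_apply hu]

/-- Scalar multiplication by `r` stretches both arguments by `r`, so degree one for the form means
degree -1 for its coefficients on constant vectors. -/
theorem ConicSymplecticForm.pullForm_smul (σ : ConicSymplecticForm K) (hc : K.IsConeChart c) {z : F}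
    (hz : z ∈ c.target) {r : ℝ} (hr : 0 < r) (a b : F) :
    pullForm σ.form c.symm (r • z) ![a, b] = r⁻¹ * pullForm σ.form c.symm z ![a, b] := by
  obtain ⟨h1, h2⟩ := hc.symm_smul hz hr
  have h3 : ∀ a : F, (tderiv c.symm (r • z) : F →L[ℝ] F) (r • a) =
      (tderiv (K.dil r) (c.symm z) : F →L[ℝ] F) ((tderiv c.symm z : F →L[ℝ] F) a) := by
    intro a
    have h4 : (fun y => c.symm (r • y)) =ᶠ[𝓝 z] fun y => K.dil r (c.symm y) := by
      filter_upwards [c.open_target.mem_nhds hz] with y hy using (hc.symm_smul hy hr).2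
    have h5 : (tderiv _ z : F →L[ℝ] F) = tderiv _ z := tderiv_congr h4
    have h6 : HasFDerivAt (fun y : F => r • y) (r • ContinuousLinearMap.id ℝ F) z :=
      (hasFDerivAt_id z).const_smul r
    rw [tderiv_comp (h := K.dil r) (K.mdiffAt_dil hr _) (c.symm.mdiffAt hz),
      tderiv_comp (h := c.symm) (f := fun y : F => r • y) (c.symm.mdiffAt h1)
        h6.differentiableAt.mdifferentiableAt, tderiv_eq_fderiv, h6.fderiv] at h5
    exact congrArg (fun L : F →L[ℝ] F => L a) h5
  have h4 : pullForm σ.form c.symm (r • z) ![r • a, r • b] =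
      r * pullForm σ.form c.symm z ![a, b] := by
    rw [pullForm_apply, pullForm_apply, h3, h3, h2]
    exact σ.homogeneous r hr _ _ _
  rw [← altBil_apply, map_smul, map_smul, smul_apply, altBil_apply, smul_eq_mul, smul_eq_mul] at h4
  rw [eq_inv_mul_iff_mul_eq₀ hr.ne']
  exact mul_left_cancel₀ hr.ne' h4

theorem ConicSymplecticForm.eventually_closed_pullForm [IsManifold 𝓘(ℝ, F) ∞ U]
    (σ : ConicSymplecticForm K) {u : U} (hu : u ∈ c.source) :
    EvSmooth (fun z => altBil (pullForm σ.form c.symm z)) (c u) ∧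
      (∀ᶠ z in 𝓝 (c u), DifferentiableAt ℝ (pullForm σ.form c.symm) z) ∧
      ∀ᶠ z in 𝓝 (c u), extDeriv (pullForm σ.form c.symm) z = 0 := by
  let k := chartAt F u
  have hcu : c.symm (c u) = u := c.symm_apply hu
  let φ : F → F := fun z => k (c.symm z)
  have hst : Tendsto c.symm (𝓝 (c u)) (𝓝 u) := by
    have := c.symm.continuousAt (c.map_source hu)
    rwa [ContinuousAt, hcu] at this
  have hk : ∀ᶠ z in 𝓝 (c u), c.symm z ∈ k.source :=
    hst.eventually (k.open_source.mem_nhds (mem_chart_source F u))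
  have ht : ∀ᶠ z in 𝓝 (c u), z ∈ c.target := c.open_target.mem_nhds (c.map_source hu)
  have hφ : EvSmooth φ (c u) := by
    refine evSmooth_of_contMDiffAt ?_
    filter_upwards [hk, ht] with z h1 h2
    exact ((contMDiffOn_chart (I := 𝓘(ℝ, F)) (n := ∞) (x := u)).contMDiffAt
      (k.open_source.mem_nhds h1)).comp z (c.symm.contMDiffAt h2)
  have hφu : φ (c u) ∈ k.target := k.map_source (by rw [hcu]; exact mem_chart_source F u)
  refine eventually_closed_pullback (φ := φ) (κ := chartForm σ.form k) hφ
    (EvSmooth.of_contDiffOn (σ.smooth k (chart_mem_atlas F u)) k.open_target hφu) ?_ ?_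
  · filter_upwards [k.open_target.mem_nhds hφu] with y hy
      using σ.closed k (chart_mem_atlas F u) y hy
  · filter_upwards [eventually_eventually_nhds.2 hk, ht] with z h1 h2
    have h3 : k.symm (φ z) = c.symm z := k.left_inv h1.self_of_nhds
    have h4 : c.symm =ᶠ[𝓝 z] fun z => k.symm (φ z) := by
      filter_upwards [h1] with y hy using (k.left_inv hy).symm
    have h5 : MDifferentiableAt 𝓘(ℝ, F) 𝓘(ℝ, F) k.symm (φ z) :=
      ((contMDiffOn_chart_symm (I := 𝓘(ℝ, F)) (n := ∞) (x := u)).contMDiffAt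
        (k.open_target.mem_nhds (k.map_source h1.self_of_nhds))).mdifferentiableAt (by simp)
    have h6 : MDifferentiableAt 𝓘(ℝ, F) 𝓘(ℝ, F) φ z :=
      (((contMDiffOn_chart (I := 𝓘(ℝ, F)) (n := ∞) (x := u)).contMDiffAt
        (k.open_source.mem_nhds h1.self_of_nhds)).comp z (c.symm.contMDiffAt h2)).mdifferentiableAt
        (by simp)
    have h7 : (tderiv c.symm z : F →L[ℝ] F) =
        (tderiv k.symm (φ z) : F →L[ℝ] F).comp (fderiv ℝ φ z) := by
      rw [tderiv_congr h4, tderiv_comp h5 h6, tderiv_eq_fderiv]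
    change pullForm σ.form c.symm z =
      (pullForm σ.form k.symm (φ z)).compContinuousLinearMap (fderiv ℝ φ z)
    rw [pullForm, h7, pullForm, h3]
    rfl

/-- The germ of the symplectic form in a cone chart. -/
theorem ConicSymplecticForm.liouvilleGerm [IsManifold 𝓘(ℝ, F) ∞ U]
    (σ : ConicSymplecticForm K) (hc : K.IsConeChart c) {u : U} (hu : u ∈ c.source) :
    LiouvilleGerm (fun z => altBil (pullForm σ.form c.symm z) z) (c u) ∧
      ∀ᶠ z in 𝓝 (c u), ∀ a b, pullForm σ.form c.symm z ![a, b] =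
        ed (fun z => altBil (pullForm σ.form c.symm z) z) z a b := by
  obtain ⟨h1, h2, h3⟩ := σ.eventually_closed_pullForm hu
  refine LiouvilleGerm.of_form h1 h2 h3 ?_ fun a ha => ?_
  · filter_upwards [c.open_target.mem_nhds (c.map_source hu)] with z hz r hr a b
    exact σ.pullForm_smul hc hz hr a b
  · obtain ⟨a, rfl⟩ := (c.bijective_tderiv hu).2 a
    have h4 : a = 0 := σ.nondegenerate u a fun b =>
      (pullForm_tderiv σ.form hu a b).symm.trans (ha _)
    rw [h4, map_zero]

end ConicCharts

/-- Kernel and range dimensions feed the rank count. Only the inclusion of `W` in the image of `ker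
L` is required, so the span of velocities of curves in the critical set never has to be shown to
fill the tangent space. -/
theorem exists_transverse_annihilator {T₁ T C : Type*} [AddCommGroup T₁] [Module ℝ T₁]
    [FiniteDimensional ℝ T₁] [AddCommGroup T] [Module ℝ T] [TopologicalSpace T]
    [FiniteDimensional ℝ T] [AddCommGroup C] [Module ℝ C] {n : ℕ} (hn : 3 ≤ n)
    (hT₁ : Module.finrank ℝ T₁ = 2 * n - 1) (hT : Module.finrank ℝ T = 2 * n)
    (hC : Module.finrank ℝ C = 2) (σ : T [⋀^Fin 2]→L[ℝ] ℝ) (A : T₁ →ₗ[ℝ] T) (L : T₁ →ₗ[ℝ] C)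
    (hA : ¬ Function.Injective A) (hL : Function.Surjective L) {W : Submodule ℝ T}
    (hW : W ≤ (LinearMap.ker L).map A) (hrank : rankOn σ W = 2 * n - 4) :
    ∃ X ∈ annihilator2 σ (LinearMap.range A), ∀ a, L a = 0 → A a ≠ X := by
  obtain ⟨X, hX, hX'⟩ := exists_annihilator_not_mem (W := LinearMap.range A) σ hW
    LinearMap.map_le_range hn hT (by
      have h1 := LinearMap.finrank_range_add_finrank_ker A
      have h2 : Module.finrank ℝ (LinearMap.ker A) ≠ 0 := fun h =>
        hA (LinearMap.ker_eq_bot.1 (Submodule.finrank_eq_zero.1 h))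
      omega) (by
      have h1 := LinearMap.finrank_range_add_finrank_ker L
      rw [LinearMap.range_eq_top.2 hL, finrank_top] at h1
      have h2 := Submodule.finrank_map_le A (LinearMap.ker L)
      omega) hrank
  exact ⟨X, hX, fun a ha h => hX' ⟨a, ha, h⟩⟩

/-! ### The map in cone charts -/

section LocalRepresentative

variable {E F V U : Type*} [NormedAddCommGroup E] [NormedSpace ℝ E] [FiniteDimensional ℝ E]
  [NormedAddCommGroup F] [NormedSpace ℝ F] [FiniteDimensional ℝ F]
  [TopologicalSpace V] [ChartedSpace E V] [TopologicalSpace U] [ChartedSpace F U]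
  {c : PartialDiffeomorph 𝓘(ℝ, E) 𝓘(ℝ, E) V E ∞} {d : PartialDiffeomorph 𝓘(ℝ, F) 𝓘(ℝ, F) U F ∞}
  {g : V → U} {v : V}

omit [FiniteDimensional ℝ E] [FiniteDimensional ℝ F] in
theorem fderiv_localRep (hg : ContMDiff 𝓘(ℝ, E) 𝓘(ℝ, F) ∞ g) (hv : v ∈ c.source)
    (hgv : g v ∈ d.source) (w : E) : fderiv ℝ (fun y => d (g (c.symm y))) (c v) w =
      (tderiv d (g v) : F →L[ℝ] F) ((tderiv g v : E →L[ℝ] F)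
        ((tderiv c.symm (c v) : E →L[ℝ] E) w)) := by
  have hs := c.symm_apply hv
  have h1 : MDifferentiableAt 𝓘(ℝ, E) 𝓘(ℝ, F) (fun y => g (c.symm y)) (c v) :=
    ((hg _).mdifferentiableAt (by simp)).comp _ (c.symm.mdiffAt (c.map_source hv))
  have h2 : MDifferentiableAt 𝓘(ℝ, F) 𝓘(ℝ, F) d (g (c.symm (c v))) := by
    rw [hs]; exact d.mdiffAt hgv
  rw [← tderiv_eq_fderiv, tderiv_comp (h := d) (f := fun y => g (c.symm y)) h2 h1,
    tderiv_comp (h := g)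
    ((hg _).mdifferentiableAt (by simp)) (c.symm.mdiffAt (c.map_source hv)), hs]
  rfl

omit [FiniteDimensional ℝ E] [FiniteDimensional ℝ F] in
theorem eventually_localRep (hg : ContMDiff 𝓘(ℝ, E) 𝓘(ℝ, F) ∞ g) (hv : v ∈ c.source)
    {s : Set V} (hs : IsOpen s) (hvs : v ∈ s) {t : Set U} (ht : IsOpen t) (hvt : g v ∈ t) :
    ∀ᶠ y in 𝓝 (c v), y ∈ c.target ∧ c.symm y ∈ s ∧ g (c.symm y) ∈ t := by
  have hst : Tendsto c.symm (𝓝 (c v)) (𝓝 v) := by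
    have := c.symm.continuousAt (c.map_source hv)
    rwa [ContinuousAt, c.symm_apply hv] at this
  filter_upwards [c.open_target.mem_nhds (c.map_source hv), hst.eventually (hs.mem_nhds hvs),
    hst.eventually (hg.continuous.continuousAt.eventually (ht.mem_nhds hvt))]
    with y h1 h2 h3 using ⟨h1, h2, h3⟩

omit [FiniteDimensional ℝ E] [FiniteDimensional ℝ F] in
theorem evSmooth_localRep (hg : ContMDiff 𝓘(ℝ, E) 𝓘(ℝ, F) ∞ g) (hv : v ∈ c.source)
    (hgv : g v ∈ d.source) : EvSmooth (fun y => d (g (c.symm y))) (c v) := by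
  refine evSmooth_of_contMDiffAt ?_
  filter_upwards [eventually_localRep hg hv isOpen_univ (mem_univ v) d.open_source hgv] with y hy
  exact (d.contMDiffAt hy.2.2).comp y ((hg _).comp y (c.symm.contMDiffAt hy.1))

omit [FiniteDimensional ℝ E] [FiniteDimensional ℝ F] in
theorem mem_criticalSet_iff (hg : ContMDiff 𝓘(ℝ, E) 𝓘(ℝ, F) ∞ g) (hv : v ∈ c.source)
    (hgv : g v ∈ d.source) : v ∈ criticalSet E F g ↔
      ¬ Function.Injective (fderiv ℝ (fun y => d (g (c.symm y))) (c v)) := by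
  refine not_congr ?_
  have h1 : ⇑(fderiv ℝ (fun y => d (g (c.symm y))) (c v)) = (tderiv d (g v) : F →L[ℝ] F) ∘
      (tderiv g v : E →L[ℝ] F) ∘ (tderiv c.symm (c v) : E →L[ℝ] E) :=
    funext fun w => fderiv_localRep hg hv hgv w
  rw [h1, Function.Injective.of_comp_iff (d.bijective_tderiv hgv).1,
    Function.Injective.of_comp_iff' _ (c.symm.bijective_tderiv (c.map_source hv))]
  rfl

/-- A cross cap has a critical germ in local coordinates. -/
theorem IsCrossCapAt.exists_criticalGerm {n : ℕ} (hn : 3 ≤ n)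
    (hE : Module.finrank ℝ E = 2 * n - 1) (hF : Module.finrank ℝ F = 2 * n)
    (hg : ContMDiff 𝓘(ℝ, E) 𝓘(ℝ, F) ∞ g) (hcc : IsCrossCapAt E F g v)
    (hcrit : v ∈ criticalSet E F g) (hv : v ∈ c.source) (hgv : g v ∈ d.source) :
    ∃ χ : E → Fin 2 → ℝ, CriticalGerm (fun y => d (g (c.symm y))) χ (c v) := by
  obtain ⟨m, q, Φ, Ψ, G, χ, hvΦ, hloc, hχ, ⟨i, hi⟩, hs⟩ := hcc
  have hcv := c.symm_apply hv
  have hdv := d.symm_apply hgv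
  -- The charts force `m + 1 = 2n - 1` and `m + q = 2n`.
  have hq : q = 2 := by
    have h1 := (LinearEquiv.ofBijective (tderiv Φ v : E →L[ℝ] (Fin m → ℝ) × ℝ).toLinearMap
      (Φ.bijective_tderiv hvΦ)).finrank_eq
    have h2 := (LinearEquiv.ofBijective
      (tderiv Ψ (g v) : F →L[ℝ] (Fin m → ℝ) × (Fin q → ℝ)).toLinearMap
      (Ψ.bijective_tderiv (hloc v hvΦ).1)).finrank_eq
    simp only [Module.finrank_prod, Module.finrank_fintype_fun_eq_card, Fintype.card_fin,
      Module.finrank_self] at h1 h2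
    omega
  subst hq
  let φ : E → (Fin m → ℝ) × ℝ := fun y => Φ (c.symm y)
  have hφe : φ (c v) = Φ v := congrArg Φ hcv
  have hG : EvSmooth G (Φ v) := by
    have h1 : EvSmooth (fun p => Ψ (g (Φ.symm p))) (Φ v) := by
      refine evSmooth_of_contMDiffAt ?_
      filter_upwards [Φ.open_target.mem_nhds (Φ.map_source hvΦ)] with p hp
      exact (Ψ.contMDiffAt (hloc _ (Φ.symm_mem hp)).1).comp p
        ((hg _).comp p (Φ.symm.contMDiffAt hp))
    refine h1.snd.congr ?_
    filter_upwards [Φ.open_target.mem_nhds (Φ.map_source hvΦ)] with p hp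
    rw [(hloc _ (Φ.symm_mem hp)).2, Φ.apply_symm hp]
  have hχ' : ∀ᶠ p in 𝓝 (Φ v), χ p = fderiv ℝ G p (0, 1) := by
    filter_upwards [Φ.open_target.mem_nhds (Φ.map_source hvΦ)] with p hp using hχ p hp
  have hχs : EvSmooth χ (Φ v) := (hG.fderiv.clm_apply (EvSmooth.const (0, 1))).congr hχ'
  have hφ : EvSmooth φ (c v) := by
    refine evSmooth_of_contMDiffAt ?_
    filter_upwards [eventually_localRep hg hv Φ.open_source hvΦ isOpen_univ (mem_univ _)] with y hy
    exact (Φ.contMDiffAt hy.2.1).comp y (c.symm.contMDiffAt hy.1)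
  have hψ : EvSmooth (fun z => Ψ (d.symm z)) (d (g v)) := by
    refine evSmooth_of_contMDiffAt ?_
    have hst : Tendsto d.symm (𝓝 (d (g v))) (𝓝 (g v)) := by
      have := d.symm.continuousAt (d.map_source hgv)
      rwa [ContinuousAt, hdv] at this
    filter_upwards [d.open_target.mem_nhds (d.map_source hgv),
      hst.eventually (Ψ.open_source.mem_nhds (hloc v hvΦ).1)] with z h1 h2
    exact (Ψ.contMDiffAt h2).comp z (d.symm.contMDiffAt h1)
  have hφb : Function.Bijective (fderiv ℝ φ (c v)) := by
    have h1 : MDifferentiableAt 𝓘(ℝ, E) 𝓘(ℝ, (Fin m → ℝ) × ℝ) Φ (c.symm (c v)) := by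
      rw [hcv]; exact Φ.mdiffAt hvΦ
    rw [← tderiv_eq_fderiv, tderiv_comp (h := Φ) h1 (c.symm.mdiffAt (c.map_source hv)), hcv]
    exact (Φ.bijective_tderiv hvΦ).comp (c.symm.bijective_tderiv (c.map_source hv))
  have hψb : Function.Bijective (fderiv ℝ (fun z => Ψ (d.symm z)) (d (g v))) := by
    have h1 : MDifferentiableAt 𝓘(ℝ, F) 𝓘(ℝ, (Fin m → ℝ) × (Fin 2 → ℝ)) Ψ
        (d.symm (d (g v))) := by
      rw [hdv]; exact Ψ.mdiffAt (hloc v hvΦ).1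
    rw [← tderiv_eq_fderiv, tderiv_comp (h := Ψ) h1 (d.symm.mdiffAt (d.map_source hgv)), hdv]
    exact (Ψ.bijective_tderiv (hloc v hvΦ).1).comp (d.symm.bijective_tderiv (d.map_source hgv))
  refine ⟨fun y => χ (φ y), CriticalGerm.of_normal_form (φ := φ) (ψ := fun z => Ψ (d.symm z))
    (Γ := G) (evSmooth_localRep hg hv hgv) hφ hφb (by rwa [hcv]) (by rwa [hcv]) (by rwa [hφe]) ?_
    (by rwa [hφe]) ?_ (by rwa [hφe]) ((mem_criticalSet_iff hg hv hgv).1 hcrit)⟩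
  · filter_upwards [eventually_localRep hg hv Φ.open_source hvΦ d.open_source hgv] with y hy
    rw [d.symm_apply hy.2.2, (hloc _ hy.2.1).2]
  · rw [hφe]
    intro h
    refine hi ?_
    have h1 := hasFDerivAt_pi'.1 hχs.differentiableAt.hasFDerivAt i
    rw [h1.fderiv]
    exact congrFun h i

omit [FiniteDimensional ℝ E] [FiniteDimensional ℝ F] in
/-- The tangent vectors of the critical set are killed by its defining function. -/
theorem CriticalGerm.tangentAt_le {C : Type*} [NormedAddCommGroup C] [NormedSpace ℝ C]
    {χ : E → C} (hχ : CriticalGerm (fun y => d (g (c.symm y))) χ (c v))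
    (hg : ContMDiff 𝓘(ℝ, E) 𝓘(ℝ, F) ∞ g) (hv : v ∈ c.source) (hgv : g v ∈ d.source) :
    tangentAt E (criticalSet E F g) v ≤
      LinearMap.ker ((fderiv ℝ χ (c v)).comp (tderiv c v : E →L[ℝ] E)).toLinearMap := by
  refine Submodule.span_le.2 ?_
  rintro a ⟨k, hk, hkS, rfl, rfl⟩
  change fderiv ℝ χ (c (k 0)) ((tderiv c (k 0) : E →L[ℝ] E) ((tderiv k 0 : ℝ →L[ℝ] E) 1)) = 0
  have h1 : MDifferentiableAt 𝓘(ℝ, ℝ) 𝓘(ℝ, E) k 0 := (hk 0).mdifferentiableAt (by simp)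
  have h2 : MDifferentiableAt 𝓘(ℝ, ℝ) 𝓘(ℝ, E) (fun s => c (k s)) 0 := (c.mdiffAt hv).comp 0 h1
  have h3 := tderiv_comp (h := c) (c.mdiffAt hv) h1
  rw [tderiv_eq_fderiv] at h3
  have h4 : HasFDerivAt (fun s => χ (c (k s))) _ 0 :=
    HasFDerivAt.comp (g := χ) (f := fun s => c (k s)) 0 hχ.smooth.differentiableAt.hasFDerivAt
      h2.differentiableAt.hasFDerivAt
  have hkc : ContinuousAt k 0 := hk.continuous.continuousAt
  have h5 : ∀ᶠ s in 𝓝 (0 : ℝ), χ (c (k s)) = 0 := by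
    filter_upwards [hkc.eventually (c.open_source.mem_nhds hv),
      (hg.continuous.continuousAt.comp hkc).eventually (d.open_source.mem_nhds hgv),
      h2.differentiableAt.continuousAt.eventually hχ.eq_zero_iff] with s h6 h7 h8
    exact h8.2 ((mem_criticalSet_iff hg h6 h7).1 (hkS s))
  have h6 := h4.unique ((hasFDerivAt_const (0 : C) (0 : ℝ)).congr_of_eventuallyEq h5)
  rw [h3] at h6
  exact congrArg (fun L : ℝ →L[ℝ] C => L 1) h6

end LocalRepresentative

/-! ### Assembly: from manifolds to the model and back -/

theorem proposition6p3 {E F V U : Type*}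
    [NormedAddCommGroup E] [NormedSpace ℝ E] [FiniteDimensional ℝ E]
    [NormedAddCommGroup F] [NormedSpace ℝ F] [FiniteDimensional ℝ F]
    [TopologicalSpace V] [ChartedSpace E V] [IsManifold 𝓘(ℝ, E) ∞ V]
    [TopologicalSpace U] [ChartedSpace F U] [IsManifold 𝓘(ℝ, F) ∞ U]
    (n : ℕ) (hn : 3 ≤ n)
    (hE : Module.finrank ℝ E = 2 * n - 1) (hF : Module.finrank ℝ F = 2 * n)
    (KV : ConicStructure E V) (KU : ConicStructure F U) (σU : ConicSymplecticForm KU)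
    (g : V → U) (hg : IsConicMap KV KU g) (hcc : IsCrossCap E F g)
    (hinv : ∀ v ∈ criticalSet E F g, IsInvolutive (σU.form (g v)) (imageTangent E F g v))
    (hmax : ∀ v ∈ criticalSet E F g,
      rankOn (σU.form (g v)) (imageTangentCritical E F g v) = 2 * n - 4)
    (hnonrad : ∀ v ∈ criticalSet E F g, IsNonradialAt σU (g v) (imageTangentCritical E F g v))
    (v₀ : V) (hv₀ : v₀ ∈ criticalSet E F g) :
    ∃ (Φ : PartialDiffeomorph 𝓘(ℝ, E) 𝓘(ℝ, CrossCoord n) V (CrossCoord n) ∞)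
      (Ψ : PartialDiffeomorph 𝓘(ℝ, F) 𝓘(ℝ, CotCoord n) U (CotCoord n) ∞)
      (gpen γpen γlast : CrossCoord n → ℝ),
      IsHomogeneousCoord KV Φ ∧ IsCanonicalCoord σU Ψ ∧
      v₀ ∈ Φ.source ∧ Φ v₀ = (0, 0, unitOne (n - 2), 0) ∧
      g v₀ ∈ Ψ.source ∧ Ψ (g v₀) = (0, unitOne n) ∧
      (∀ v ∈ Φ.source, g v ∈ Ψ.source ∧
        (∀ j, (Ψ (g v)).1 (idxHead j) = CrossCoord.tpp (Φ v) j) ∧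
        (Ψ (g v)).1 (idxPen hn) = gpen (Φ v) ∧
        (Ψ (g v)).1 (idxLast hn) = CrossCoord.tn (Φ v) ∧
        (∀ j, (Ψ (g v)).2 (idxHead j) = CrossCoord.taupp (Φ v) j) ∧
        (Ψ (g v)).2 (idxPen hn) = γpen (Φ v) ∧
        (Ψ (g v)).2 (idxLast hn) = γlast (Φ v)) ∧
      (∀ p ∈ Φ.target, CrossCoord.dtau 0 gpen p ≠ 0) ∧
      (∀ p ∈ Φ.target, CrossCoord.tauppp p = 0 →
        γpen p = 0 ∧ γlast p = 0 ∧
        ∀ j : Fin 2, CrossCoord.dtau j γpen p = 0 ∧ CrossCoord.dtau j γlast p = 0) := by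
  obtain ⟨c, hv, hc0, hch⟩ := KV.exists_cone v₀
  obtain ⟨d, hgv, hd0, hdh⟩ := KU.exists_cone (g v₀)
  have hc : KV.IsConeChart c := ⟨hc0, hch⟩
  have hd : KU.IsConeChart d := ⟨hd0, hdh⟩
  obtain ⟨hgs, hgh⟩ := hg
  let f : E → F := fun y => d (g (c.symm y))
  have hcv : c.symm (c v₀) = v₀ := c.symm_apply hv
  have hfe : f (c v₀) = d (g v₀) := by simp only [f, hcv]
  have hf : EvSmooth f (c v₀) := evSmooth_localRep hgs hv hgv
  obtain ⟨χ, hχ⟩ := (hcc v₀ hv₀).exists_criticalGerm hn hE hF hgs hv₀ hv hgv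
  have hnear := eventually_localRep hgs hv c.open_source hv d.open_source hgv
  have hfh : ∀ᶠ y in 𝓝 (c v₀), ∀ r : ℝ, 0 < r → f (r • y) = r • f y := by
    filter_upwards [hnear] with y hy r hr
    simp only [f, (hc.symm_smul hy.1 hr).2, hgh r hr, (hd.2 _ hy.2.2 r hr).2]
  let η : F → F [⋀^Fin 2]→L[ℝ] ℝ := pullForm σU.form d.symm
  obtain ⟨hθ, hη⟩ := σU.liouvilleGerm hd hgv
  have hηe := hη.self_of_nhds
  have hdf : ∀ {v}, v ∈ c.source → g v ∈ d.source → ∀ w, fderiv ℝ f (c v) w =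
      (tderiv d (g v) : F →L[ℝ] F) ((tderiv g v : E →L[ℝ] F)
        ((tderiv c.symm (c v) : E →L[ℝ] E) w)) := fun h1 h2 w => fderiv_localRep hgs h1 h2 w
  have hdf' : ∀ {v}, v ∈ c.source → g v ∈ d.source → ∀ a : E,
      fderiv ℝ f (c v) ((tderiv c v : E →L[ℝ] E) a) =
        (tderiv d (g v) : F →L[ℝ] F) ((tderiv g v : E →L[ℝ] F) a) := by
    intro v h1 h2 a
    rw [hdf h1 h2, c.tderiv_symm_tderiv h1]
  have htan := hχ.tangentAt_le hgs hv hgv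
  obtain ⟨X, hX, hX'⟩ : ∃ X : F, (∀ a : E, σU.form (g v₀)
      ![X, (tderiv g v₀ : E →L[ℝ] F) a] = 0) ∧
      ∀ a : E, fderiv ℝ χ (c v₀) ((tderiv c v₀ : E →L[ℝ] E) a) = 0 →
        (tderiv g v₀ : E →L[ℝ] F) a ≠ X := by
    obtain ⟨X, hX, hX'⟩ := exists_transverse_annihilator (T₁ := E) (T := F) (C := Fin 2 → ℝ) hn hE hF
      (by simp) (σU.form (g v₀)) (tderiv g v₀ : E →L[ℝ] F).toLinearMap
      ((fderiv ℝ χ (c v₀)).comp (tderiv c v₀ : E →L[ℝ] E)).toLinearMap hv₀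
      (hχ.surjective.comp (c.bijective_tderiv hv).2)
      (W := imageTangentCritical E F g v₀) (Submodule.map_mono htan) (hmax v₀ hv₀)
    exact ⟨X, fun a => hX _ ⟨a, rfl⟩, hX'⟩
  have hinv' : ∀ᶠ y in 𝓝 (c v₀), ¬ Function.Injective (fderiv ℝ f y) → ∀ x,
      (∀ v, ed (fun z => altBil (η z) z) (f y) x (fderiv ℝ f y v) = 0) →
        ∃ v, fderiv ℝ f y v = x := by
    filter_upwards [hnear, hf.continuousAt.eventually (by rw [hfe]; exact hη)] with y hy hηy
    obtain ⟨hyt, hyc, hyd⟩ := hy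
    have hyv := c.apply_symm hyt
    -- Writing `y` as `c v` expresses the claim through the tangent spaces at `v` and `g v`, where
    -- the involutivity hypothesis lives.
    generalize c.symm y = v at hyc hyd hyv
    subst hyv
    have hfv : f (c v) = d (g v) := congrArg (fun v => d (g v)) (c.symm_apply hyc)
    rw [hfv] at hηy ⊢
    intro hinj x hx
    obtain ⟨a, rfl⟩ := (d.bijective_tderiv hyd).2 x
    have ha : a ∈ annihilator2 (σU.form (g v)) (imageTangent E F g v) := by
      have h1 : ∀ b : E, σU.form (g v) ![a, (tderiv g v : E →L[ℝ] F) b] = 0 := by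
        intro b
        have h1 := hx ((tderiv c v : E →L[ℝ] E) b)
        rw [← hηy, hdf' hyc hyd] at h1
        exact (pullForm_tderiv σU.form hyd _ _).symm.trans h1
      rintro _ ⟨b, rfl⟩
      exact h1 b
    obtain ⟨b, hb⟩ := hinv v ((mem_criticalSet_iff hgs hyc hyd).2 hinj) ha
    refine ⟨(tderiv c v : E →L[ℝ] E) b, ?_⟩
    exact (hdf' hyc hyd b).trans (congrArg (tderiv d (g v) : F →L[ℝ] F) hb)
  obtain ⟨Φ, Ψ, gpen, γpen, γlast, ⟨h1, h2, h3, h4⟩, h5, h6, h7, h8, h9⟩ :=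
    hχ.exists_model_coordinates hn hE hF (θ := fun z => altBil (η z) z) hf hfh
      (by
        intro h
        change f (c v₀) = 0 at h
        rw [hfe] at h
        exact hd0 (h ▸ d.map_source hgv))
      (by change LiouvilleGerm _ (f (c v₀)); rwa [hfe]) hinv'
      (X₀ := (tderiv d (g v₀) : F →L[ℝ] F) X) (by
        intro w
        change ed _ (f (c v₀)) _ (fderiv ℝ f (c v₀) w) = 0
        rw [hfe, ← hηe, hdf hv hgv]
        exact (pullForm_tderiv σU.form hgv _ _).trans (hX _))
      (by
        intro w hw hw'
        obtain ⟨a, rfl⟩ := (c.bijective_tderiv hv).2 w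
        exact hX' a hw ((d.bijective_tderiv hgv).1 ((hdf' hv hgv a).symm.trans hw')))
      (by
        have key : ∀ a : E, altBil (η (f (c v₀))) (f (c v₀))
            (fderiv ℝ f (c v₀) ((tderiv c v₀ : E →L[ℝ] E) a)) =
            σU.form (g v₀) ![KU.radial (g v₀), (tderiv g v₀ : E →L[ℝ] F) a] := by
          intro a
          rw [hdf' hv hgv, hfe, altBil_apply]
          exact (congrArg (fun w => η (d (g v₀))
            ![w, (tderiv d (g v₀) : F →L[ℝ] F) ((tderiv g v₀ : E →L[ℝ] F) a)])
            (hd.tderiv_radial hgv).symm).trans (pullForm_tderiv σU.form hgv _ _)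
        obtain ⟨_, ⟨a, ha, rfl⟩, hb⟩ := hnonrad v₀ hv₀
        exact ⟨(tderiv c v₀ : E →L[ℝ] E) a, htan ha, fun h => hb ((key a).symm.trans h)⟩)
      (σ := fun z b c => η z ![b, c])
      (by change ∀ᶠ z in 𝓝 (f (c v₀)), _; rwa [hfe])
      (by
        change ∀ᶠ z in 𝓝 (f (c v₀)), _
        rw [hfe]
        filter_upwards [d.open_target.mem_nhds (d.map_source hgv)] with z hz r hr a b
        exact σU.pullForm_smul hd hz hr a b)
      (S := fun y => y ∈ c.target ∧ g (c.symm y) ∈ d.source)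
      (hnear.mono fun y hy => ⟨hy.1, hy.2.2⟩)
  -- A point of the model cone has a dilate whose image lies in the domain of `d`; as that domain is
  -- conic, the image of the point lies there too. This is why `S` is passed to the model theorem.
  have hgd : ∀ v ∈ c.source, c v ∈ Φ.source → g v ∈ d.source ∧ f (c v) = d (g v) := by
    intro v hvc hvΦ
    obtain ⟨-, -, r, hr, -, hS⟩ := h5 _ hvΦ
    rw [(hc.symm_smul (c.map_source hvc) hr).2, c.symm_apply hvc, hgh r hr] at hS
    exact ⟨hd.mem_of_dil_mem hr hS, congrArg (fun v => d (g v)) (c.symm_apply hvc)⟩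
  refine ⟨c.trans Φ, d.trans Ψ, gpen, γpen, γlast, ?_, ?_, ⟨hv, h1⟩, h2, ?_, ?_, ?_, ?_, ?_⟩
  · rintro v ⟨hvc, hvΦ⟩
    obtain ⟨h10, h11, -⟩ := h5 _ hvΦ
    refine ⟨h10, fun r hr => ?_⟩
    obtain ⟨h12, h13⟩ := hc.2 v hvc r hr
    obtain ⟨h14, h15⟩ := h11 r hr
    exact ⟨⟨h12, (congrArg (· ∈ Φ.source) h13).mpr h14⟩, (congrArg Φ h13).trans h15⟩
  · rintro u ⟨hud, huΨ⟩
    obtain ⟨h10, h11, h12⟩ := h6 _ huΨ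
    refine ⟨h10, fun r hr => ?_, fun a b => ?_⟩
    · obtain ⟨h12, h13⟩ := hd.2 u hud r hr
      obtain ⟨h14, h15⟩ := h11 r hr
      exact ⟨⟨h12, (congrArg (· ∈ Ψ.source) h13).mpr h14⟩, (congrArg Ψ h13).trans h15⟩
    · have h13 : (tderiv (fun u => Ψ (d u)) u : F →L[ℝ] CotCoord n) = _ :=
        tderiv_comp (h := Ψ) (Ψ.mdiffAt huΨ) (d.mdiffAt hud)
      rw [tderiv_eq_fderiv] at h13
      have h14 := h12 ((tderiv d u : F →L[ℝ] F) a) ((tderiv d u : F →L[ℝ] F) b)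
      refine ((pullForm_tderiv σU.form hud a b).symm.trans h14).trans ?_
      change _ = stdForm n ((tderiv (fun u => Ψ (d u)) u : F →L[ℝ] CotCoord n) a)
        ((tderiv (fun u => Ψ (d u)) u : F →L[ℝ] CotCoord n) b)
      rw [h13]
      rfl
  · exact ⟨hgv, (congrArg (· ∈ Ψ.source) hfe).mp h3⟩
  · exact (congrArg Ψ hfe).symm.trans h4
  · rintro v ⟨hvc, hvΦ⟩
    obtain ⟨h10, h11⟩ := hgd v hvc hvΦ
    obtain ⟨h12, h13⟩ := h7 (c v) hvΦ
    change f (c v) ∈ _ at h12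
    rw [h11] at h12
    refine ⟨⟨h10, h12⟩, ?_⟩
    rw [show d (g (c.symm (c v))) = d (g v) from h11] at h13
    exact h13
  · rintro p ⟨hp, -⟩
    exact h8 p hp
  · rintro p ⟨hp, -⟩
    exact h9 p hp
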